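/- Let $n\ge 0$ and let $A=\mathcal A_{2n}$ be the polynomial Weyl algebra: the space $\mathbb C[y_1,\dots,y_{2n}]$ with $y_{2j-1}=p_j$, $y_{2j}=q_j$, and the Moyal product $a\star b=m\big(e^{\frac12\alpha_{01}}(a\otimes b)\big)$. Here $m$ is the commutative multiplication, and on tensor products $a_0\otimes\dots\otimes a_k$, with ${}_r\partial_\beta$ denoting $\partial/\partial y_\beta$ applied to the factor $a_r$, $$\alpha_{rs}=\sum_{j=1}^n\big({}_r\partial_{2j-1}\,{}_s\partial_{2j}-{}_r\partial_{2j}\,{}_s\partial_{2j-1}\big).$$ Let $C^k(A,A^*)=\mathrm{Hom}(\bar A^{\otimes k},A^*)$, $\bar A=A/\mathbb C1$, be the normalized Hochschild cochains, written as multilinear functionals $\varphi(a_0,\dots,a_k)$ that vanish if some $a_i=1$ with $i\ge1$. On $C^\bullet(A,A^*)=\bigoplus_k C^k(A,A^*)$ put, for $x\in A$, $$(d\varphi)(a_0,\dots,a_{k+1})=\sum_{j=0}^{k}(-1)^j\varphi(a_0,\dots,a_ja_{j+1},\dots,a_{k+1})+(-1)^{k+1}\varphi(a_{k+1}a_0,a_1,\dots,a_k)\quad(\varphi\in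 C^k),$$ $$(B\varphi)(a_0,\dots,a_k)=\sum_{j=0}^k(-1)^{kj}\varphi(1,a_j,a_{j+1},\dots,a_{j-1}),\qquad (\iota_x\varphi)(a_0,\dots,a_k)=\sum_{j=0}^k(-1)^j\varphi(a_0,\dots,a_j,x,a_{j+1},\dots,a_k)\quad(\varphi\in C^{k+1}),$$ with $B=\iota_x=0$ on $C^0$, and let $\iota_\omega=\sum_{j=1}^n\iota_{p_j}\iota_{q_j}$. The Feigin–Felder–Shoikhet cochain $\tau_{2n}\in C^{2n}(A,A^*)$ is $$\tau_{2n}=\mu_{2n}\circ\int_{0=u_0<u_1<\dots<u_{2n}<1}\ \prod_{0\le i<j\le 2n}e^{(u_j-u_i-\frac12)\alpha_{ji}}\,du_1\cdots du_{2n}\circ\pi_{2n},\qquad \pi_{2n}=\det\big({}_i\partial_\beta\big)_{1\le i,\beta\le 2n},$$ where $\mu_{2n}(a_0\otimes\dots\otimes a_{2n})=a_0(0)\cdots a_{2n}(0)$. Let $\mathfrak{sp}_{2n}\subset A$ be the space of homogeneous quadratic polynomials. Let $W$ be a $\mathbb C[u]$-module and equip $C^\bullet(A,A^*)\otimes_{\mathbb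 C}W$ with the cyclic differential $d+uB$ ($u$ acts on $W$; $\iota_x$ is extended by $\iota_x\otimes\mathrm{id}_W$). **Theorem.** For every $w\in W\setminus\{0\}$, the cyclic cochain $$\tau_w=e^{u\iota_\omega}\,\tau_{2n}\otimes w=\sum_{k\ge0}\tfrac1{k!}\,\iota_\omega^k\tau_{2n}\otimes u^kw$$ is a cyclic cocycle, $(d+uB)\tau_w=0$; it is nontrivial, i.e. not of the form $(d+uB)\psi$; it satisfies $\iota_a\tau_w=0$ for all $a\in\mathfrak{sp}_{2n}$; and its value on the chain $$1\otimes p_1\wedge q_1\wedge\dots\wedge p_n\wedge q_n,\qquad v_1\wedge\dots\wedge v_{k}:=\sum_{\sigma}\mathrm{sgn}(\sigma)\,v_{\sigma(1)}\otimes\dots\otimes v_{\sigma(k)},$$ is $w$ (that is, $\tau_{2n}$ takes the value $1$ on it). -/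

import Mathlib

open scoped TensorProduct

noncomputable section

namespace WeylCyclic

/-! ### Exponentials of locally nilpotent operators -/

section LocExp

open scoped Nat

variable {V : Type*} [AddCommMonoid V] [Module ℂ V] {V' : Type*} [AddCommMonoid V']
  [Module ℂ V']

/-- Every vector is killed by some power of `T`. -/
def LocNilp (T : Module.End ℂ V) : Prop := ∀ x, ∃ N : ℕ, (T ^ N) x = 0

/-- The exponential `e^T x = ∑ₖ Tᵏ x / k!`; a finite sum if `T` is locally nilpotent. -/
def locExp (T : Module.End ℂ V) (x : V) : V := ∑ᶠ k : ℕ, ((k ! : ℂ)⁻¹) • (T ^ k) x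

theorem pow_apply_eq_zero_of_le {T : Module.End ℂ V} {x : V} {N k : ℕ}
    (h : (T ^ N) x = 0) (hk : N ≤ k) : (T ^ k) x = 0 := by
  obtain ⟨c, rfl⟩ := Nat.exists_eq_add_of_le hk
  rw [add_comm, pow_add, Module.End.mul_apply, h, map_zero]

theorem locExp_eq_sum {T : Module.End ℂ V} {x : V} {N : ℕ} (h : (T ^ N) x = 0) :
    locExp T x = ∑ k ∈ Finset.range N, ((k ! : ℂ)⁻¹) • (T ^ k) x := by
  unfold locExp
  apply finsum_eq_sum_of_support_subset
  intro k hk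
  by_contra hk'
  apply hk
  have : N ≤ k := by simpa using hk'
  simp [pow_apply_eq_zero_of_le h this]

theorem locExp_add {T : Module.End ℂ V} (hT : LocNilp T) (x y : V) :
    locExp T (x + y) = locExp T x + locExp T y := by
  obtain ⟨N, hN⟩ := hT x
  obtain ⟨M, hM⟩ := hT y
  have h1 := pow_apply_eq_zero_of_le hN (le_max_left N M)
  have h2 := pow_apply_eq_zero_of_le hM (le_max_right N M)
  have h3 : (T ^ (max N M)) (x + y) = 0 := by rw [map_add, h1, h2, add_zero]
  rw [locExp_eq_sum h1, locExp_eq_sum h2, locExp_eq_sum h3, ← Finset.sum_add_distrib]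
  simp

theorem locExp_smul {T : Module.End ℂ V} (hT : LocNilp T) (c : ℂ) (x : V) :
    locExp T (c • x) = c • locExp T x := by
  obtain ⟨N, hN⟩ := hT x
  have h3 : (T ^ N) (c • x) = 0 := by rw [map_smul, hN, smul_zero]
  rw [locExp_eq_sum hN, locExp_eq_sum h3, Finset.smul_sum]
  refine Finset.sum_congr rfl fun k _ => ?_
  rw [map_smul, smul_comm]

theorem locExp_of_apply_eq_zero {T : Module.End ℂ V} {x : V} (h : T x = 0) :
    locExp T x = x := by
  have : (T ^ 1) x = 0 := by simpa using h
  rw [locExp_eq_sum this]; simp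

theorem pow_intertwine {S : Module.End ℂ V'} {T : Module.End ℂ V} {M : V →ₗ[ℂ] V'}
    (h : ∀ x, S (M x) = M (T x)) (k : ℕ) (x : V) : (S ^ k) (M x) = M ((T ^ k) x) := by
  induction k with
  | zero => simp
  | succ k ih => rw [pow_succ', pow_succ', Module.End.mul_apply, Module.End.mul_apply, ih, h]

theorem locExp_intertwine {S : Module.End ℂ V'} {T : Module.End ℂ V} {M : V →ₗ[ℂ] V'}
    (hT : LocNilp T) (h : ∀ x, S (M x) = M (T x)) (x : V) :
    locExp S (M x) = M (locExp T x) := by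
  obtain ⟨N, hN⟩ := hT x
  have hS : (S ^ N) (M x) = 0 := by rw [pow_intertwine h, hN, map_zero]
  rw [locExp_eq_sum hN, locExp_eq_sum hS, map_sum]
  refine Finset.sum_congr rfl fun k _ => ?_
  rw [pow_intertwine h, map_smul]

theorem locExp_add_op {A B : Module.End ℂ V} (hA : LocNilp A) (hB : LocNilp B)
    (hAB : Commute A B) (x : V) :
    locExp (A + B) x = locExp A (locExp B x) := by
  obtain ⟨N₁, hN₁⟩ := hA x
  obtain ⟨N₂, hN₂⟩ := hB x
  set N := max N₁ N₂ with hN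
  have hAx : ∀ k, N ≤ k → (A ^ k) x = 0 := fun k hk =>
    pow_apply_eq_zero_of_le hN₁ ((le_max_left _ _).trans hk)
  have hBx : ∀ k, N ≤ k → (B ^ k) x = 0 := fun k hk =>
    pow_apply_eq_zero_of_le hN₂ ((le_max_right _ _).trans hk)
  have hz : ∀ i j, N ≤ i ∨ N ≤ j → (A ^ i) ((B ^ j) x) = 0 := by
    intro i j hij
    rcases hij with h | h
    · have := (hAB.pow_pow i j).eq
      rw [← Module.End.mul_apply, this, Module.End.mul_apply, hAx i h, map_zero]
    · rw [hBx j h, map_zero]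
  have hpow : ∀ k, ((k ! : ℂ)⁻¹) • ((A + B) ^ k) x =
      ∑ p ∈ Finset.HasAntidiagonal.antidiagonal k,
        ((p.1 ! : ℂ)⁻¹ * (p.2 ! : ℂ)⁻¹) • (A ^ p.1) ((B ^ p.2) x) := by
    intro k
    rw [hAB.add_pow', LinearMap.sum_apply, Finset.smul_sum]
    refine Finset.sum_congr rfl fun p hp => ?_
    have hp' : p.1 + p.2 = k := by simpa using hp
    subst hp'
    rw [LinearMap.smul_apply, Module.End.mul_apply, ← Nat.cast_smul_eq_nsmul ℂ, smul_smul]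
    congr 1
    have h1 : ((p.1 ! : ℕ) : ℂ) ≠ 0 := by exact_mod_cast Nat.factorial_ne_zero _
    have h2 : ((p.2 ! : ℕ) : ℂ) ≠ 0 := by exact_mod_cast Nat.factorial_ne_zero _
    have h3 : (((p.1 + p.2) ! : ℕ) : ℂ) ≠ 0 := by exact_mod_cast Nat.factorial_ne_zero _
    have h4 : (((p.1 + p.2).choose p.1 : ℕ) : ℂ) * (p.1 ! : ℂ) * (p.2 ! : ℂ)
        = ((p.1 + p.2) ! : ℂ) := by
      have h5 := Nat.add_choose_mul_factorial_mul_factorial p.1 p.2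
      rw [← Nat.choose_symm_add] at h5
      exact_mod_cast h5
    field_simp
    linear_combination h4
  have hAB0 : ((A + B) ^ (2 * N)) x = 0 := by
    have h1 := hpow (2 * N)
    rw [Finset.sum_eq_zero] at h1
    · have : (((2 * N) ! : ℕ) : ℂ) ≠ 0 := by exact_mod_cast Nat.factorial_ne_zero _
      rw [← smul_inv_smul₀ this (((A + B) ^ (2 * N)) x), h1, smul_zero]
    · intro p hp
      have hp' : p.1 + p.2 = 2 * N := by simpa using hp
      rw [hz _ _ (by omega), smul_zero]
  have hA0 : (A ^ N) (locExp B x) = 0 := by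
    rw [locExp_eq_sum (hBx N le_rfl), map_sum]
    refine Finset.sum_eq_zero fun k _ => ?_
    rw [map_smul, hz _ _ (Or.inl le_rfl), smul_zero]
  rw [locExp_eq_sum hAB0, locExp_eq_sum hA0, locExp_eq_sum (hBx N le_rfl)]
  simp_rw [hpow, map_sum, map_smul, Finset.smul_sum, smul_smul]
  rw [← Finset.sum_product', Finset.sum_sigma']
  refine Finset.sum_bij_ne_zero (fun s _ _ => s.2) ?_ ?_ ?_ ?_
  · rintro ⟨k, p⟩ h1 h2
    simp only [Finset.mem_product, Finset.mem_range]
    by_contra hcon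
    apply h2
    simp only
    rw [hz _ _ (by omega), smul_zero]
  · rintro ⟨k, p⟩ h1 _ ⟨k', p'⟩ h1' _ h
    simp only [Finset.mem_sigma, Finset.HasAntidiagonal.mem_antidiagonal] at h1 h1' h
    subst h
    obtain rfl : k = k' := by omega
    rfl
  · rintro ⟨i, j⟩ h1 h2
    simp only [Finset.mem_product, Finset.mem_range] at h1
    refine ⟨⟨i + j, (i, j)⟩, ?_, h2, rfl⟩
    simp only [Finset.mem_sigma, Finset.mem_range, Finset.HasAntidiagonal.mem_antidiagonal, and_true]
    omega
  · intro s _ _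
    rfl

end LocExp

/-! ### Polynomials and bidifferential operators -/

/-- Polynomial functions on the symplectic space, in the coordinates
`y₀ = p₁, y₁ = q₁, y₂ = p₂, y₃ = q₂, …`. -/
abbrev Poly (n : ℕ) := MvPolynomial (Fin (2 * n)) ℂ

/-- The index of the coordinate `p_j`. -/
def pIdx {n : ℕ} (j : Fin n) : Fin (2 * n) := ⟨2 * j, by omega⟩

/-- The index of the coordinate `q_j`. -/
def qIdx {n : ℕ} (j : Fin n) : Fin (2 * n) := ⟨2 * j + 1, by omega⟩

/-- The `k`-fold tensor power of `Poly n`, realized as the polynomial ring in `k` copies of the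
coordinates; the variable `(i, β)` is the coordinate `y_β` in the `i`-th factor. -/
abbrev Tens (n k : ℕ) := MvPolynomial (Fin k × Fin (2 * n)) ℂ

/-- The pure tensor `a₀ ⊗ ⋯ ⊗ a_{k-1}`, as a multilinear map. -/
def tens (n k : ℕ) : MultilinearMap ℂ (fun _ : Fin k => Poly n) (Tens n k) :=
  (MultilinearMap.mkPiAlgebra ℂ (Fin k) (Tens n k)).compLinearMap
    fun i => (MvPolynomial.rename (Prod.mk i)).toLinearMap

theorem tens_apply {n k : ℕ} (a : Fin k → Poly n) :
    tens n k a = ∏ i, MvPolynomial.rename (Prod.mk i) (a i) := by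
  simp [tens]

/-- The partial derivative with respect to `y_β` in the `i`-th tensor factor. -/
def slotD {n k : ℕ} (i : Fin k) (β : Fin (2 * n)) : Module.End ℂ (Tens n k) :=
  (MvPolynomial.pderiv (i, β)).toLinearMap

theorem slotD_apply {n k : ℕ} (i : Fin k) (β : Fin (2 * n)) (x : Tens n k) :
    slotD i β x = MvPolynomial.pderiv (i, β) x := rfl

/-- The operator `α_{rs} = ∑_j (∂_{p_j} in slot r) (∂_{q_j} in slot s)
  - (∂_{q_j} in slot r) (∂_{p_j} in slot s)`. -/
def alpha {n k : ℕ} (r s : Fin k) : Module.End ℂ (Tens n k) :=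
  ∑ j : Fin n, (slotD r (pIdx j) * slotD s (qIdx j) - slotD r (qIdx j) * slotD s (pIdx j))

theorem slotD_commute {n k : ℕ} (i i' : Fin k) (β β' : Fin (2 * n)) :
    Commute (slotD i β) (slotD i' β') := by
  refine LinearMap.ext fun x => MvPolynomial.ext _ _ fun m => ?_
  simp only [Module.End.mul_apply, slotD_apply, MvPolynomial.coeff_pderiv, Finsupp.add_apply,
    Finsupp.single_apply]
  rw [add_right_comm]
  by_cases h : (i, β) = (i', β')
  · rw [h]
  · rw [if_neg h, if_neg (Ne.symm h)]
    push_cast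
    ring

theorem alpha_commute_slotD {n k : ℕ} (r s i : Fin k) (β : Fin (2 * n)) :
    Commute (alpha r s) (slotD i β) := by
  refine Commute.sum_left _ _ _ fun j _ => Commute.sub_left ?_ ?_ <;>
  exact Commute.mul_left (slotD_commute _ _ _ _) (slotD_commute _ _ _ _)

theorem alpha_commute {n k : ℕ} (r s r' s' : Fin k) :
    Commute (alpha (n := n) r s) (alpha r' s') := by
  refine Commute.sum_right _ _ _ fun j _ => Commute.sub_right ?_ ?_ <;>
  exact Commute.mul_right (alpha_commute_slotD _ _ _ _) (alpha_commute_slotD _ _ _ _)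

/-- `T` strictly lowers the total degree. -/
def Lowers {σ : Type*} (T : Module.End ℂ (MvPolynomial σ ℂ)) : Prop :=
  ∀ x, T x = 0 ∨ (T x).totalDegree < x.totalDegree

theorem Lowers.pow_eq_zero {σ : Type*} {T : Module.End ℂ (MvPolynomial σ ℂ)} (hT : Lowers T)
    (N : ℕ) : ∀ x, x.totalDegree < N → (T ^ N) x = 0 := by
  induction N with
  | zero => intro x h; omega
  | succ N ih =>
    intro x h
    rw [pow_succ, Module.End.mul_apply]
    rcases hT x with h0 | h0
    · rw [h0, map_zero]
    · exact ih _ (by omega)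

theorem Lowers.locNilp {σ : Type*} {T : Module.End ℂ (MvPolynomial σ ℂ)} (hT : Lowers T) :
    LocNilp T := fun x => ⟨x.totalDegree + 1, hT.pow_eq_zero _ x (Nat.lt_succ_self _)⟩

theorem Lowers.zero {σ : Type*} : Lowers (0 : Module.End ℂ (MvPolynomial σ ℂ)) :=
  fun _ => Or.inl rfl

theorem Lowers.add {σ : Type*} {S T : Module.End ℂ (MvPolynomial σ ℂ)} (hS : Lowers S)
    (hT : Lowers T) : Lowers (S + T) := by
  intro x
  rw [LinearMap.add_apply]
  rcases hS x with h1 | h1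
  · rw [h1, zero_add]; exact hT x
  · rcases hT x with h2 | h2
    · rw [h2, add_zero]; exact Or.inr h1
    · exact Or.inr ((MvPolynomial.totalDegree_add _ _).trans_lt (max_lt h1 h2))

theorem Lowers.smul {σ : Type*} {T : Module.End ℂ (MvPolynomial σ ℂ)} (hT : Lowers T)
    (c : ℂ) : Lowers (c • T) := by
  intro x
  rw [LinearMap.smul_apply]
  rcases hT x with h1 | h1
  · rw [h1, smul_zero]; exact Or.inl rfl
  · exact Or.inr ((MvPolynomial.totalDegree_smul_le _ _).trans_lt h1)

theorem Lowers.sum {σ ι : Type*} (s : Finset ι) {T : ι → Module.End ℂ (MvPolynomial σ ℂ)}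
    (hT : ∀ i ∈ s, Lowers (T i)) : Lowers (∑ i ∈ s, T i) :=
  Finset.sum_induction T Lowers (fun _ _ => Lowers.add) Lowers.zero hT

theorem Lowers.mul {σ : Type*} {S T : Module.End ℂ (MvPolynomial σ ℂ)} (hS : Lowers S)
    (hT : Lowers T) : Lowers (S * T) := by
  intro x
  rw [Module.End.mul_apply]
  rcases hT x with h1 | h1
  · rw [h1, map_zero]; exact Or.inl rfl
  · rcases hS (T x) with h2 | h2
    · exact Or.inl h2
    · exact Or.inr (h2.trans h1)

theorem lowers_slotD {n k : ℕ} (i : Fin k) (β : Fin (2 * n)) : Lowers (slotD i β) := by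
  intro x
  rw [or_iff_not_imp_left]
  intro h
  rw [slotD_apply] at h ⊢
  obtain ⟨m, hm, hdeg⟩ := Finset.exists_mem_eq_sup (MvPolynomial.pderiv (i, β) x).support
    (MvPolynomial.support_nonempty.2 h) (fun s => s.sum fun _ e => e)
  have hx : m + Finsupp.single (i, β) 1 ∈ x.support := by
    rw [MvPolynomial.mem_support_iff] at hm ⊢
    intro h0
    apply hm
    rw [MvPolynomial.coeff_pderiv, h0, zero_mul]
  have h1 := MvPolynomial.le_totalDegree hx
  rw [Finsupp.sum_add_index' (fun _ => rfl) (fun _ _ _ => rfl), Finsupp.sum_single_index rfl]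
    at h1
  have h2 : (MvPolynomial.pderiv (i, β) x).totalDegree = m.sum fun _ e => e := hdeg
  omega

theorem lowers_alpha {n k : ℕ} (r s : Fin k) : Lowers (alpha (n := n) r s) := by
  refine Lowers.sum _ fun j _ => ?_
  rw [sub_eq_add_neg, ← neg_one_smul ℂ]
  exact ((lowers_slotD _ _).mul (lowers_slotD _ _)).add
    (((lowers_slotD _ _).mul (lowers_slotD _ _)).smul _)

/-! ### The Moyal product -/

/-- Multiplication of the tensor factors, with the commutative product of polynomials. -/
def mulSlots (n k : ℕ) : Tens n k →ₐ[ℂ] Poly n := MvPolynomial.rename Prod.snd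

/-- The Moyal product `a ⋆ b = m (e^{α₀₁ / 2} (a ⊗ b))`. -/
def moyal {n : ℕ} (a b : Poly n) : Poly n :=
  mulSlots n 2 (locExp ((1 / 2 : ℂ) • alpha 0 1) (tens n 2 ![a, b]))

theorem lowers_half_alpha {n k : ℕ} (c : ℂ) (r s : Fin k) :
    Lowers (c • alpha (n := n) r s) := (lowers_alpha r s).smul c

theorem moyal_add_left {n : ℕ} (a a' b : Poly n) : moyal (a + a') b = moyal a b + moyal a' b := by
  have h' : tens n 2 ![a + a', b] = tens n 2 ![a, b] + tens n 2 ![a', b] := by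
    simp [tens_apply, add_mul]
  rw [moyal, h', locExp_add (lowers_half_alpha _ _ _).locNilp, map_add]; rfl

theorem moyal_add_right {n : ℕ} (a b b' : Poly n) : moyal a (b + b') = moyal a b + moyal a b' := by
  have h' : tens n 2 ![a, b + b'] = tens n 2 ![a, b] + tens n 2 ![a, b'] := by
    simp [tens_apply, mul_add]
  rw [moyal, h', locExp_add (lowers_half_alpha _ _ _).locNilp, map_add]; rfl

theorem moyal_smul_left {n : ℕ} (c : ℂ) (a b : Poly n) : moyal (c • a) b = c • moyal a b := by
  have h' : tens n 2 ![c • a, b] = c • tens n 2 ![a, b] := by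
    simp [tens_apply]
  rw [moyal, h', locExp_smul (lowers_half_alpha _ _ _).locNilp, map_smul]; rfl

theorem moyal_smul_right {n : ℕ} (c : ℂ) (a b : Poly n) : moyal a (c • b) = c • moyal a b := by
  have h' : tens n 2 ![a, c • b] = c • tens n 2 ![a, b] := by
    simp [tens_apply]
  rw [moyal, h', locExp_smul (lowers_half_alpha _ _ _).locNilp, map_smul]; rfl

theorem slotD_rename_of_ne {n k : ℕ} {i j : Fin k} (h : j ≠ i) (β : Fin (2 * n)) (a : Poly n) :
    slotD i β (MvPolynomial.rename (Prod.mk j) a) = 0 := by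
  classical
  rw [slotD_apply]
  apply MvPolynomial.pderiv_eq_zero_of_notMem_vars
  intro hm
  have := MvPolynomial.vars_rename (Prod.mk j) a hm
  simp only [Finset.mem_image] at this
  obtain ⟨x, _, hx⟩ := this
  exact h (congrArg Prod.fst hx)

theorem slotD_tens_eq_zero {n k : ℕ} (a : Fin k → Poly n) (i : Fin k) (h : a i = 1)
    (β : Fin (2 * n)) : slotD i β (tens n k a) = 0 := by
  rw [tens_apply]
  refine Finset.prod_induction (fun j => MvPolynomial.rename (Prod.mk j) (a j))
    (fun x => slotD i β x = 0) ?_ ?_ ?_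
  · intro x y hx hy
    rw [slotD_apply] at hx hy ⊢
    rw [MvPolynomial.pderiv_mul, hx, hy, zero_mul, mul_zero, add_zero]
  · exact MvPolynomial.pderiv_one
  · intro j _
    by_cases hj : j = i
    · subst hj
      rw [h, map_one]
      exact MvPolynomial.pderiv_one
    · exact slotD_rename_of_ne hj β _

theorem alpha_apply_eq_zero_right {n k : ℕ} {r s : Fin k} {x : Tens n k}
    (h : ∀ β, slotD s β x = 0) : alpha r s x = 0 := by
  simp [alpha, LinearMap.sum_apply, h]

theorem alpha_apply_eq_zero_left {n k : ℕ} {r s : Fin k} {x : Tens n k}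
    (h : ∀ β, slotD r β x = 0) : alpha r s x = 0 := by
  have hc : ∀ β γ, slotD r β (slotD s γ x) = 0 := fun β γ => by
    rw [← Module.End.mul_apply, (slotD_commute r s β γ).eq, Module.End.mul_apply, h, map_zero]
  simp [alpha, LinearMap.sum_apply, hc]

theorem mulSlots_rename {n k : ℕ} (i : Fin k) (a : Poly n) :
    mulSlots n k (MvPolynomial.rename (Prod.mk i) a) = a := by
  rw [mulSlots, MvPolynomial.rename_rename]
  exact MvPolynomial.rename_id_apply a

theorem one_moyal {n : ℕ} (a : Poly n) : moyal 1 a = a := by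
  rw [moyal, locExp_of_apply_eq_zero, tens_apply]
  · simp [mulSlots_rename]
  · rw [LinearMap.smul_apply, alpha_apply_eq_zero_left, smul_zero]
    exact slotD_tens_eq_zero _ 0 rfl

theorem moyal_one {n : ℕ} (a : Poly n) : moyal a 1 = a := by
  rw [moyal, locExp_of_apply_eq_zero, tens_apply]
  · simp [mulSlots_rename]
  · rw [LinearMap.smul_apply, alpha_apply_eq_zero_right, smul_zero]
    exact slotD_tens_eq_zero _ 1 rfl

/-- Relabel tensor factors along `f`, multiplying the factors with the same label. -/
def relabel (n : ℕ) {k l : ℕ} (f : Fin k → Fin l) : Tens n k →ₐ[ℂ] Tens n l :=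
  MvPolynomial.rename (Prod.map f id)

theorem slotD_relabel {n k l : ℕ} (f : Fin k → Fin l) (j : Fin l) (β : Fin (2 * n))
    (x : Tens n k) :
    slotD j β (relabel n f x) = ∑ i, if f i = j then relabel n f (slotD i β x) else 0 := by
  simp only [slotD_apply, relabel]
  induction x using MvPolynomial.induction_on with
  | C a => simp
  | add p q hp hq =>
    simp only [map_add, hp, hq, ← Finset.sum_add_distrib]
    refine Finset.sum_congr rfl fun i _ => ?_
    split_ifs <;> simp
  | mul_X p v hp =>
    obtain ⟨v, γ⟩ := v
    simp only [map_mul, MvPolynomial.rename_X, MvPolynomial.pderiv_mul, hp, map_add,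
      MvPolynomial.pderiv_X, Prod.map_apply, id]
    have hsplit : ∀ i : Fin k, (if f i = j then
        (MvPolynomial.rename (Prod.map f id) (MvPolynomial.pderiv (i, β) p) *
          MvPolynomial.X (f v, γ) +
        MvPolynomial.rename (Prod.map f id) p * MvPolynomial.rename (Prod.map f id)
          (Pi.single (M := fun _ => Tens n k) (i, β) 1 (v, γ))
        : Tens n l) else 0) =
        (if f i = j then MvPolynomial.rename (Prod.map f id) (MvPolynomial.pderiv (i, β) p)
          else 0) * MvPolynomial.X (f v, γ) +
        (if i = v then MvPolynomial.rename (Prod.map f id) p *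
          Pi.single (M := fun _ => Tens n l) (j, β) 1 (f v, γ) else 0) := by
      intro i
      by_cases h1 : i = v
      · subst h1
        by_cases h2 : f i = j <;> by_cases h3 : γ = β <;>
          simp [h2, h3, Prod.ext_iff]
      · by_cases h2 : f i = j
        · have : ¬ v = i := fun h => h1 h.symm
          simp [h1, h2, Prod.ext_iff, this]
        · simp [h1, h2]
    rw [Finset.sum_congr rfl fun i _ => hsplit i, Finset.sum_add_distrib, Finset.sum_mul]
    simp

theorem relabel_rename {n k l : ℕ} (f : Fin k → Fin l) (i : Fin k) (a : Poly n) :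
    relabel n f (MvPolynomial.rename (Prod.mk i) a) = MvPolynomial.rename (Prod.mk (f i)) a := by
  rw [relabel, MvPolynomial.rename_rename]; rfl

theorem mulSlots_relabel {n k l : ℕ} (f : Fin k → Fin l) (x : Tens n k) :
    mulSlots n l (relabel n f x) = mulSlots n k x := by
  rw [mulSlots, relabel, MvPolynomial.rename_rename]; rfl

theorem rename_mulSlots {n k l : ℕ} (j : Fin l) (x : Tens n k) :
    MvPolynomial.rename (Prod.mk j) (mulSlots n k x) = relabel n (fun _ => j) x := by
  rw [mulSlots, relabel, MvPolynomial.rename_rename]; rfl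

theorem relabel_relabel {n k l m : ℕ} (f : Fin k → Fin l) (g : Fin l → Fin m) (x : Tens n k) :
    relabel n g (relabel n f x) = relabel n (g ∘ f) x := by
  rw [relabel, relabel, MvPolynomial.rename_rename]; rfl

/-- Tensoring with a further factor intertwines the operators `α`. -/
theorem alpha_relabel_mul {n k l : ℕ} (f : Fin k → Fin l) (hf : Function.Injective f)
    (c : Fin l) (hc : ∀ i, f i ≠ c) (b : Poly n) (r s : Fin k) (x : Tens n k) :
    alpha (f r) (f s) (relabel n f x * MvPolynomial.rename (Prod.mk c) b) =
      relabel n f (alpha r s x) * MvPolynomial.rename (Prod.mk c) b := by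
  have key : ∀ (r : Fin k) (β : Fin (2 * n)) (x : Tens n k),
      slotD (f r) β (relabel n f x * MvPolynomial.rename (Prod.mk c) b) =
        relabel n f (slotD r β x) * MvPolynomial.rename (Prod.mk c) b := by
    intro r β x
    have h1 := slotD_rename_of_ne (hc r).symm β b
    have h2 := slotD_relabel f (f r) β x
    simp only [hf.eq_iff, Finset.sum_ite_eq', Finset.mem_univ, if_true] at h2
    rw [slotD_apply] at h1 h2 ⊢
    rw [MvPolynomial.pderiv_mul, h1, h2, mul_zero, add_zero]
  simp only [alpha, LinearMap.sum_apply, LinearMap.sub_apply, Module.End.mul_apply, key,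
    map_sum, map_sub, Finset.sum_mul, sub_mul]

theorem alpha01_relabel_left {n : ℕ} (x : Tens n 3) :
    alpha (0 : Fin 2) 1 (relabel n ![0, 0, 1] x) = relabel n ![0, 0, 1] ((alpha 0 2 + alpha 1 2 : Module.End ℂ (Tens n 3)) x) := by
  have h0 : ∀ β (x : Tens n 3), slotD (0 : Fin 2) β (relabel n ![0, 0, 1] x) =
      relabel n ![0, 0, 1] ((slotD 0 β + slotD 1 β : Module.End ℂ (Tens n 3)) x) := by
    intro β x
    rw [slotD_relabel]
    simp [Fin.sum_univ_three]
  have h1 : ∀ β (x : Tens n 3), slotD (1 : Fin 2) β (relabel n ![0, 0, 1] x) =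
      relabel n ![0, 0, 1] (slotD 2 β x) := by
    intro β x
    rw [slotD_relabel]
    simp [Fin.sum_univ_three]
  simp only [alpha, LinearMap.sum_apply, LinearMap.sub_apply, Module.End.mul_apply, h0, h1,
    LinearMap.add_apply, map_sum, map_sub, map_add, ← Finset.sum_add_distrib]
  exact Finset.sum_congr rfl fun j _ => by ring

theorem alpha01_relabel_right {n : ℕ} (x : Tens n 3) :
    alpha (0 : Fin 2) 1 (relabel n ![0, 1, 1] x) = relabel n ![0, 1, 1] ((alpha 0 1 + alpha 0 2 : Module.End ℂ (Tens n 3)) x) := by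
  have h0 : ∀ β (x : Tens n 3), slotD (0 : Fin 2) β (relabel n ![0, 1, 1] x) =
      relabel n ![0, 1, 1] (slotD 0 β x) := by
    intro β x
    rw [slotD_relabel]
    simp [Fin.sum_univ_three]
  have h1 : ∀ β (x : Tens n 3), slotD (1 : Fin 2) β (relabel n ![0, 1, 1] x) =
      relabel n ![0, 1, 1] ((slotD 1 β + slotD 2 β : Module.End ℂ (Tens n 3)) x) := by
    intro β x
    rw [slotD_relabel]
    simp [Fin.sum_univ_three]
  simp only [alpha, LinearMap.sum_apply, LinearMap.sub_apply, Module.End.mul_apply, h0, h1,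
    LinearMap.add_apply, map_sum, map_sub, map_add, ← Finset.sum_add_distrib]
  exact Finset.sum_congr rfl fun j _ => by ring

theorem moyal_moyal_left {n : ℕ} (a b c : Poly n) :
    moyal (moyal a b) c = mulSlots n 3
      (locExp ((1 / 2 : ℂ) • (alpha 0 1 + alpha 0 2 + alpha 1 2)) (tens n 3 ![a, b, c])) := by
  let R : Tens n 2 →ₗ[ℂ] Tens n 3 :=
    (LinearMap.mulRight ℂ (MvPolynomial.rename (Prod.mk 2) c)).comp
      (relabel n ![0, 1]).toLinearMap
  let Φ : Tens n 3 →ₗ[ℂ] Tens n 2 := (relabel n ![0, 0, 1]).toLinearMap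
  have hR : ∀ x, ((1 / 2 : ℂ) • alpha (n := n) (0 : Fin 3) 1) (R x) =
      R (((1 / 2 : ℂ) • alpha (n := n) (0 : Fin 2) 1) x) := by
    intro x
    have := alpha_relabel_mul (n := n) (![0, 1] : Fin 2 → Fin 3) (by decide) 2 (by decide) c 0 1 x
    rw [LinearMap.smul_apply, LinearMap.smul_apply, map_smul]
    exact congrArg _ this
  have hΦ : ∀ x, ((1 / 2 : ℂ) • alpha (n := n) (0 : Fin 2) 1) (Φ x) =
      Φ (((1 / 2 : ℂ) • alpha (n := n) (0 : Fin 3) 2 + (1 / 2 : ℂ) • alpha 1 2 : Module.End ℂ (Tens n 3)) x) := by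
    intro x
    rw [← smul_add, LinearMap.smul_apply, LinearMap.smul_apply, map_smul]
    exact congrArg _ (alpha01_relabel_left x)
  have hL1 : LocNilp ((1 / 2 : ℂ) • alpha (n := n) (0 : Fin 3) 2 + (1 / 2 : ℂ) • alpha 1 2) :=
    ((lowers_half_alpha _ _ _).add (lowers_half_alpha _ _ _)).locNilp
  have e1 : tens n 2 ![moyal a b, c] =
      Φ (R (locExp ((1 / 2 : ℂ) • alpha 0 1) (tens n 2 ![a, b]))) := by
    rw [tens_apply]
    simp only [Fin.prod_univ_two, Matrix.cons_val_zero, Matrix.cons_val_one, R, Φ,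
      LinearMap.comp_apply, AlgHom.toLinearMap_apply, LinearMap.mulRight_apply, map_mul,
      relabel_relabel, relabel_rename, moyal, rename_mulSlots]
    congr 2
    congr 1
    funext i
    fin_cases i <;> rfl
  have e2 : R (tens n 2 ![a, b]) = tens n 3 ![a, b, c] := by
    simp [R, tens_apply, Fin.prod_univ_three, relabel_rename]
  have hcomm : Commute ((1 / 2 : ℂ) • alpha (n := n) (0 : Fin 3) 2 + (1 / 2 : ℂ) • alpha 1 2)
      ((1 / 2 : ℂ) • alpha 0 1) :=
    ((((alpha_commute _ _ _ _).smul_left _).smul_right _).add_left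
      (((alpha_commute _ _ _ _).smul_left _).smul_right _))
  rw [moyal, e1, locExp_intertwine hL1 hΦ, ← locExp_intertwine
    (lowers_half_alpha _ _ _).locNilp hR, e2,
    ← locExp_add_op hL1 (lowers_half_alpha _ _ _).locNilp hcomm]
  change mulSlots n 2 (relabel n ![0, 0, 1] _) = _
  rw [mulSlots_relabel]
  rw [← smul_add, ← smul_add, add_comm _ (alpha 0 1), ← add_assoc]

theorem moyal_moyal_right {n : ℕ} (a b c : Poly n) :
    moyal a (moyal b c) = mulSlots n 3
      (locExp ((1 / 2 : ℂ) • (alpha 0 1 + alpha 0 2 + alpha 1 2)) (tens n 3 ![a, b, c])) := by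
  let R : Tens n 2 →ₗ[ℂ] Tens n 3 :=
    (LinearMap.mulRight ℂ (MvPolynomial.rename (Prod.mk 0) a)).comp
      (relabel n ![1, 2]).toLinearMap
  let Φ : Tens n 3 →ₗ[ℂ] Tens n 2 := (relabel n ![0, 1, 1]).toLinearMap
  have hR : ∀ x, ((1 / 2 : ℂ) • alpha (n := n) (1 : Fin 3) 2) (R x) =
      R (((1 / 2 : ℂ) • alpha (n := n) (0 : Fin 2) 1) x) := by
    intro x
    have := alpha_relabel_mul (n := n) (![1, 2] : Fin 2 → Fin 3) (by decide) 0 (by decide) a 0 1 x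
    rw [LinearMap.smul_apply, LinearMap.smul_apply, map_smul]
    exact congrArg _ this
  have hΦ : ∀ x, ((1 / 2 : ℂ) • alpha (n := n) (0 : Fin 2) 1) (Φ x) =
      Φ (((1 / 2 : ℂ) • alpha (n := n) (0 : Fin 3) 1 + (1 / 2 : ℂ) • alpha 0 2 : Module.End ℂ (Tens n 3)) x) := by
    intro x
    rw [← smul_add, LinearMap.smul_apply, LinearMap.smul_apply, map_smul]
    exact congrArg _ (alpha01_relabel_right x)
  have hL1 : LocNilp ((1 / 2 : ℂ) • alpha (n := n) (0 : Fin 3) 1 + (1 / 2 : ℂ) • alpha 0 2) :=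
    ((lowers_half_alpha _ _ _).add (lowers_half_alpha _ _ _)).locNilp
  have e1 : tens n 2 ![a, moyal b c] =
      Φ (R (locExp ((1 / 2 : ℂ) • alpha 0 1) (tens n 2 ![b, c]))) := by
    rw [tens_apply]
    simp only [Fin.prod_univ_two, Matrix.cons_val_zero, Matrix.cons_val_one, R, Φ,
      LinearMap.comp_apply, AlgHom.toLinearMap_apply, LinearMap.mulRight_apply, map_mul,
      relabel_relabel, relabel_rename, moyal, rename_mulSlots]
    rw [mul_comm]
    congr 2
    congr 1
    funext i
    fin_cases i <;> rfl
  have e2 : R (tens n 2 ![b, c]) = tens n 3 ![a, b, c] := by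
    simp [R, tens_apply, Fin.prod_univ_three, relabel_rename]
    ring
  have hcomm : Commute ((1 / 2 : ℂ) • alpha (n := n) (0 : Fin 3) 1 + (1 / 2 : ℂ) • alpha 0 2)
      ((1 / 2 : ℂ) • alpha 1 2) :=
    ((((alpha_commute _ _ _ _).smul_left _).smul_right _).add_left
      (((alpha_commute _ _ _ _).smul_left _).smul_right _))
  rw [moyal, e1, locExp_intertwine hL1 hΦ, ← locExp_intertwine
    (lowers_half_alpha _ _ _).locNilp hR, e2,
    ← locExp_add_op hL1 (lowers_half_alpha _ _ _).locNilp hcomm]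
  change mulSlots n 2 (relabel n ![0, 1, 1] _) = _
  rw [mulSlots_relabel]
  rw [← smul_add, ← smul_add]

theorem moyal_assoc {n : ℕ} (a b c : Poly n) :
    moyal (moyal a b) c = moyal a (moyal b c) := by
  rw [moyal_moyal_left, moyal_moyal_right]

/-- The polynomial Weyl algebra `A_{2n}`: complex polynomials in `p₁, q₁, …, p_n, q_n` with the
Moyal product. -/
def Weyl (n : ℕ) : Type := Poly n

instance (n : ℕ) : AddCommGroup (Weyl n) := inferInstanceAs (AddCommGroup (Poly n))

instance (n : ℕ) : Module ℂ (Weyl n) := inferInstanceAs (Module ℂ (Poly n))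

/-- The underlying polynomial of an element of the Weyl algebra. -/
def Weyl.toPoly {n : ℕ} : Weyl n ≃ₗ[ℂ] Poly n := LinearEquiv.refl ℂ (Poly n)

instance (n : ℕ) : Ring (Weyl n) where
  __ := (inferInstance : AddCommGroup (Weyl n))
  mul a b := Weyl.toPoly.symm (moyal (Weyl.toPoly a) (Weyl.toPoly b))
  one := Weyl.toPoly.symm 1
  left_distrib _ _ _ := moyal_add_right _ _ _
  right_distrib _ _ _ := moyal_add_left _ _ _
  zero_mul b := by
    have := moyal_smul_left (0 : ℂ) (0 : Poly n) (Weyl.toPoly b)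
    rw [zero_smul, zero_smul] at this
    exact this
  mul_zero a := by
    have := moyal_smul_right (0 : ℂ) (Weyl.toPoly a) (0 : Poly n)
    rw [zero_smul, zero_smul] at this
    exact this
  mul_assoc _ _ _ := moyal_assoc _ _ _
  one_mul _ := one_moyal _
  mul_one _ := moyal_one _

instance (n : ℕ) : Algebra ℂ (Weyl n) :=
  Algebra.ofModule (fun _ _ _ => moyal_smul_left _ _ _) (fun _ _ _ => moyal_smul_right _ _ _)

theorem Weyl.toPoly_mul {n : ℕ} (a b : Weyl n) :
    Weyl.toPoly (a * b) = moyal (Weyl.toPoly a) (Weyl.toPoly b) := rfl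

theorem Weyl.toPoly_one {n : ℕ} : Weyl.toPoly (1 : Weyl n) = 1 := rfl

/-- The coordinate function `y_β` (one of `p₁, q₁, p₂, q₂, …`). -/
def Weyl.y {n : ℕ} (β : Fin (2 * n)) : Weyl n := Weyl.toPoly.symm (MvPolynomial.X β)

/-- The symplectic Lie algebra `sp_{2n}`, as the homogeneous quadratic polynomials in `A_{2n}`. -/
def sp (n : ℕ) : Submodule ℂ (Weyl n) :=
  (MvPolynomial.homogeneousSubmodule (Fin (2 * n)) ℂ 2).comap Weyl.toPoly.toLinearMap

/-! ### The normalized Hochschild complex and the cyclic complex -/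

section Hochschild

variable {A : Type*} [Ring A] [Algebra ℂ A]

/-- Precomposition of a multilinear functional with a map of tuples which is linear in each
argument, each argument entering a single slot. -/
def compSlots {m l : ℕ} (F : (Fin m → A) → (Fin l → A))
    (hF : ∀ a i, ∃ (i' : Fin l) (L : A →ₗ[ℂ] A),
      ∀ x, F (Function.update a i x) = Function.update (F a) i' (L x)) :
    MultilinearMap ℂ (fun _ : Fin l => A) ℂ →ₗ[ℂ] MultilinearMap ℂ (fun _ : Fin m => A) ℂ where
  toFun φ := MultilinearMap.mk' (fun a => φ (F a))
    (fun a i x y => by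
      obtain ⟨i', L, h⟩ := hF a i
      rw [h, h, h, map_add, φ.map_update_add])
    (fun a i c x => by
      obtain ⟨i', L, h⟩ := hF a i
      rw [h, h, map_smul, φ.map_update_smul])
  map_add' _ _ := rfl
  map_smul' _ _ := rfl

variable (A) in
/-- The normalized Hochschild cochains `C^k(A, A^*) = Hom(Ā^{⊗k}, A^*)` with `Ā = A / ℂ·1`,
written as functionals `φ(a₀, a₁, …, a_k)`, where `a₀` is the argument of the value in `A^*`;
they vanish as soon as one of `a₁, …, a_k` is `1`. -/
def Cochain (k : ℕ) : Submodule ℂ (MultilinearMap ℂ (fun _ : Fin (k + 1) => A) ℂ) where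
  carrier := {φ | ∀ (a : Fin (k + 1) → A) (i : Fin k), a i.succ = 1 → φ a = 0}
  add_mem' hφ hψ a i h := by
    rw [add_apply, hφ a i h, hψ a i h, add_zero]
  zero_mem' _ _ _ := rfl
  smul_mem' c φ hφ a i h := by
    rw [smul_apply, hφ a i h, smul_zero]

/-- `(a₀, …, a_{k+1}) ↦ (a₀, …, a_j a_{j+1}, …, a_{k+1})`. -/
def innerFace {k : ℕ} (j : Fin (k + 1)) (a : Fin (k + 2) → A) : Fin (k + 1) → A :=
  Fin.contractNth j.castSucc (· * ·) a

/-- `(a₀, …, a_{k+1}) ↦ (a_{k+1} a₀, a₁, …, a_k)`. -/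
def lastFace {k : ℕ} (a : Fin (k + 2) → A) : Fin (k + 1) → A :=
  Function.update (fun i => a i.castSucc) 0 (a (Fin.last (k + 1)) * a 0)

/-- `(a₀, …, a_k) ↦ (1, a_j, a_{j+1}, …, a_{j-1})` with indices modulo `k + 1`. -/
def rotate {k : ℕ} (j : Fin (k + 1)) (a : Fin (k + 1) → A) : Fin (k + 2) → A :=
  Fin.cons 1 fun i => a (j + i)

/-- `(a₀, …, a_k) ↦ (a₀, …, a_j, x, a_{j+1}, …, a_k)`. -/
def insertAfter {k : ℕ} (x : A) (j : Fin (k + 1)) (a : Fin (k + 1) → A) : Fin (k + 2) → A :=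
  j.succ.insertNth x a

theorem innerFace_apply {k : ℕ} (j : Fin (k + 1)) (a : Fin (k + 2) → A) (i : Fin (k + 1)) :
    innerFace j a i = if (i : ℕ) < j then a i.castSucc
      else if (i : ℕ) = j then a i.castSucc * a i.succ else a i.succ := rfl

theorem innerFace_slots {k : ℕ} (j : Fin (k + 1)) (a : Fin (k + 2) → A) (i : Fin (k + 2)) :
    ∃ (i' : Fin (k + 1)) (L : A →ₗ[ℂ] A), ∀ x,
      innerFace j (Function.update a i x) = Function.update (innerFace j a) i' (L x) := by
  rcases lt_trichotomy (i : ℕ) j with h | h | h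
  · refine ⟨⟨i, by omega⟩, LinearMap.id, fun x => funext fun l => ?_⟩
    simp only [innerFace_apply, Function.update_apply, Fin.ext_iff, Fin.val_castSucc, Fin.val_succ,
      LinearMap.id_apply]
    split_ifs <;> first | rfl | omega
  · refine ⟨j, LinearMap.mulRight ℂ (a j.succ), fun x => funext fun l => ?_⟩
    by_cases hl : l = j
    · subst hl
      simp [innerFace_apply, Function.update_apply, Fin.ext_iff, h]
    · have hl' : (l : ℕ) ≠ j := fun h => hl (Fin.ext h)
      simp only [innerFace_apply, Function.update_apply, Fin.ext_iff, Fin.val_castSucc,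
        Fin.val_succ]
      split_ifs <;> first | rfl | omega
  · by_cases h' : (i : ℕ) = j + 1
    · refine ⟨j, LinearMap.mulLeft ℂ (a j.castSucc), fun x => funext fun l => ?_⟩
      by_cases hl : l = j
      · subst hl
        simp [innerFace_apply, Function.update_apply, Fin.ext_iff, h']
      · have hl' : (l : ℕ) ≠ j := fun h => hl (Fin.ext h)
        simp only [innerFace_apply, Function.update_apply, Fin.ext_iff, Fin.val_castSucc,
          Fin.val_succ]
        split_ifs <;> first | rfl | omega
    · refine ⟨⟨i - 1, by omega⟩, LinearMap.id, fun x => funext fun l => ?_⟩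
      simp only [innerFace_apply, Function.update_apply, Fin.ext_iff, Fin.val_castSucc,
        Fin.val_succ, LinearMap.id_apply]
      split_ifs <;> first | rfl | omega

theorem lastFace_slots {k : ℕ} (a : Fin (k + 2) → A) (i : Fin (k + 2)) :
    ∃ (i' : Fin (k + 1)) (L : A →ₗ[ℂ] A), ∀ x,
      lastFace (Function.update a i x) = Function.update (lastFace a) i' (L x) := by
  refine Fin.lastCases ?_ (fun i => ?_) i
  · refine ⟨0, LinearMap.mulRight ℂ (a 0), fun x => funext fun l => ?_⟩
    by_cases hl : l = 0
    · subst hl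
      have : (0 : Fin (k + 2)) ≠ Fin.last (k + 1) := (Fin.last_pos).ne
      simp [lastFace, this]
    · have : l.castSucc ≠ Fin.last (k + 1) := (Fin.castSucc_lt_last l).ne
      simp [lastFace, hl]
  · have hi : Fin.last (k + 1) ≠ i.castSucc := (Fin.castSucc_lt_last i).ne'
    by_cases h0 : i = 0
    · subst h0
      refine ⟨0, LinearMap.mulLeft ℂ (a (Fin.last (k + 1))), fun x => funext fun l => ?_⟩
      by_cases hl : l = 0
      · subst hl
        have : Fin.last (k + 1) ≠ Fin.castSucc 0 := (Fin.last_pos).ne'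
        simp only [lastFace, Function.update_self, Function.update_of_ne this]
        rfl
      · have : l.castSucc ≠ 0 := fun h => hl (Fin.castSucc_eq_zero_iff.1 h)
        simp only [lastFace, Function.update_of_ne hl]
        exact Function.update_of_ne this _ _
    · refine ⟨i, LinearMap.id, fun x => funext fun l => ?_⟩
      have h0' : (0 : Fin (k + 2)) ≠ i.castSucc := fun h =>
        h0 (Fin.castSucc_eq_zero_iff.1 h.symm)
      by_cases hl : l = 0
      · subst hl
        simp [lastFace, Function.update_apply, hi, h0', Ne.symm h0]
      · simp [lastFace, Function.update_apply, hl]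

theorem rotate_slots {k : ℕ} (j : Fin (k + 1)) (a : Fin (k + 1) → A) (i : Fin (k + 1)) :
    ∃ (i' : Fin (k + 2)) (L : A →ₗ[ℂ] A), ∀ x,
      rotate j (Function.update a i x) = Function.update (rotate j a) i' (L x) := by
  refine ⟨(i - j).succ, LinearMap.id, fun x => funext fun l => ?_⟩
  refine Fin.cases ?_ (fun l => ?_) l
  · rw [Function.update_of_ne (Fin.succ_ne_zero _).symm]; rfl
  · by_cases h : l = i - j
    · subst h
      rw [Function.update_self]
      change Function.update a i x (j + (i - j)) = x
      rw [add_sub_cancel, Function.update_self]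
    · rw [Function.update_of_ne (fun h' => h (Fin.succ_injective _ h'))]
      change Function.update a i x (j + l) = a (j + l)
      rw [Function.update_of_ne fun h' => h (eq_sub_of_add_eq' h')]

theorem insertAfter_slots {k : ℕ} (y : A) (j : Fin (k + 1)) (a : Fin (k + 1) → A)
    (i : Fin (k + 1)) :
    ∃ (i' : Fin (k + 2)) (L : A →ₗ[ℂ] A), ∀ x,
      insertAfter y j (Function.update a i x) = Function.update (insertAfter y j a) i' (L x) :=
  ⟨j.succ.succAbove i, LinearMap.id, fun x => by
    simp [insertAfter]⟩

/-- The Hochschild differential on all multilinear functionals: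
`(dφ)(a₀, …, a_{k+1}) = ∑_{j=0}^{k} (-1)^j φ(a₀, …, a_j a_{j+1}, …, a_{k+1})
  + (-1)^{k+1} φ(a_{k+1} a₀, a₁, …, a_k)`. -/
def preD (k : ℕ) : MultilinearMap ℂ (fun _ : Fin (k + 1) => A) ℂ →ₗ[ℂ]
    MultilinearMap ℂ (fun _ : Fin (k + 2) => A) ℂ :=
  ∑ j : Fin (k + 1), (-1 : ℂ) ^ (j : ℕ) • compSlots (innerFace j) (innerFace_slots j) +
    (-1 : ℂ) ^ (k + 1) • compSlots lastFace lastFace_slots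

theorem preD_apply {k : ℕ} (φ : MultilinearMap ℂ (fun _ : Fin (k + 1) => A) ℂ)
    (a : Fin (k + 2) → A) :
    preD k φ a = ∑ j : Fin (k + 1), (-1 : ℂ) ^ (j : ℕ) * φ (innerFace j a) +
      (-1 : ℂ) ^ (k + 1) * φ (lastFace a) := by
  simp only [preD, LinearMap.add_apply, LinearMap.sum_apply, LinearMap.smul_apply,
    add_apply, sum_apply, smul_apply, smul_eq_mul]
  rfl

/-- The Connes operator on all multilinear functionals:
`(Bφ)(a₀, …, a_k) = ∑_{j=0}^{k} (-1)^{kj} φ(1, a_j, a_{j+1}, …, a_{j-1})`. -/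
def preB (k : ℕ) : MultilinearMap ℂ (fun _ : Fin (k + 2) => A) ℂ →ₗ[ℂ]
    MultilinearMap ℂ (fun _ : Fin (k + 1) => A) ℂ :=
  ∑ j : Fin (k + 1), (-1 : ℂ) ^ (k * (j : ℕ)) • compSlots (rotate j) (rotate_slots j)

theorem preB_apply {k : ℕ} (φ : MultilinearMap ℂ (fun _ : Fin (k + 2) => A) ℂ)
    (a : Fin (k + 1) → A) :
    preB k φ a = ∑ j : Fin (k + 1), (-1 : ℂ) ^ (k * (j : ℕ)) * φ (rotate j a) := by
  simp only [preB, LinearMap.sum_apply, LinearMap.smul_apply, sum_apply,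
    smul_apply, smul_eq_mul]
  rfl

/-- The contraction on all multilinear functionals:
`(ι_x φ)(a₀, …, a_k) = ∑_{j=0}^{k} (-1)^j φ(a₀, …, a_j, x, a_{j+1}, …, a_k)`. -/
def preIota (x : A) (k : ℕ) : MultilinearMap ℂ (fun _ : Fin (k + 2) => A) ℂ →ₗ[ℂ]
    MultilinearMap ℂ (fun _ : Fin (k + 1) => A) ℂ :=
  ∑ j : Fin (k + 1), (-1 : ℂ) ^ (j : ℕ) • compSlots (insertAfter x j) (insertAfter_slots x j)

theorem preIota_apply (x : A) {k : ℕ} (φ : MultilinearMap ℂ (fun _ : Fin (k + 2) => A) ℂ)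
    (a : Fin (k + 1) → A) :
    preIota x k φ a = ∑ j : Fin (k + 1), (-1 : ℂ) ^ (j : ℕ) * φ (insertAfter x j a) := by
  simp only [preIota, LinearMap.sum_apply, LinearMap.smul_apply, sum_apply,
    smul_apply, smul_eq_mul]
  rfl

theorem Cochain.apply_eq_zero {k : ℕ} {φ : MultilinearMap ℂ (fun _ : Fin (k + 1) => A) ℂ}
    (hφ : φ ∈ Cochain A k) (a : Fin (k + 1) → A) (i : Fin (k + 1)) (hi : 0 < (i : ℕ))
    (h : a i = 1) : φ a = 0 := by
  obtain ⟨l, rfl⟩ : ∃ l : Fin k, i = l.succ :=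
    ⟨⟨i - 1, by omega⟩, Fin.ext (by simp; omega)⟩
  exact hφ a l h

theorem preD_mem {k : ℕ} {φ : MultilinearMap ℂ (fun _ : Fin (k + 1) => A) ℂ}
    (hφ : φ ∈ Cochain A k) : preD k φ ∈ Cochain A (k + 1) := by
  intro a i h
  rw [preD_apply]
  have hlow : ∀ j : Fin (k + 1), (j : ℕ) < i → φ (innerFace j a) = 0 := by
    intro j hj
    refine Cochain.apply_eq_zero hφ _ i (by omega) ?_
    rw [innerFace_apply, if_neg (by omega), if_neg (by omega), h]
  have hhigh : ∀ j : Fin (k + 1), (i : ℕ) + 1 < j → φ (innerFace j a) = 0 := by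
    intro j hj
    refine Cochain.apply_eq_zero hφ _ ⟨i + 1, by omega⟩ (by simp) ?_
    rw [innerFace_apply, if_pos (by simpa using hj)]
    exact h
  by_cases hik : (i : ℕ) < k
  · have hlast : φ (lastFace a) = 0 := by
      refine Cochain.apply_eq_zero hφ _ ⟨i + 1, by omega⟩ (by simp) ?_
      rw [lastFace, Function.update_of_ne (Fin.ne_of_val_ne (Nat.succ_ne_zero _))]
      exact h
    let i' : Fin (k + 1) := ⟨i + 1, by omega⟩
    have hii' : i ≠ i' := by simp [i', Fin.ext_iff]
    have heq : innerFace i a = innerFace i' a := by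
      funext l
      rw [innerFace_apply, innerFace_apply]
      rcases lt_trichotomy (l : ℕ) i with hl | hl | hl
      · rw [if_pos hl, if_pos (by simp [i']; omega)]
      · obtain rfl : l = i := Fin.ext hl
        rw [if_neg (lt_irrefl _), if_pos rfl, if_pos (by simp [i']), h, mul_one]
      · rw [if_neg (by omega), if_neg (by omega)]
        by_cases hl' : (l : ℕ) = i + 1
        · have e : l.castSucc = i.succ := Fin.ext (by simpa using hl')
          rw [if_neg (by simp [i', hl']), if_pos (by simp [i', hl']), e, h, one_mul]
        · rw [if_neg (by simp [i']; omega), if_neg (by simp [i']; omega)]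
    rw [hlast, mul_zero, add_zero, Finset.sum_eq_add i i' hii', heq]
    · simp [i', pow_succ]
    · rintro j - ⟨hj, hj'⟩
      have h1 : (j : ℕ) ≠ i := fun h => hj (Fin.ext h)
      have h2 : (j : ℕ) ≠ i + 1 := fun h => hj' (Fin.ext h)
      rcases lt_or_ge (j : ℕ) i with h3 | h3
      · rw [hlow j h3, mul_zero]
      · rw [hhigh j (by omega), mul_zero]
    · intro h; exact absurd (Finset.mem_univ _) h
    · intro h; exact absurd (Finset.mem_univ _) h
  · have hik' : (i : ℕ) = k := by omega
    have hs : i.succ = Fin.last (k + 1) := Fin.ext (by simp [hik'])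
    have heq : innerFace i a = lastFace a := by
      funext l
      rw [innerFace_apply, lastFace]
      have hl0 : ∀ l : Fin (k + 1), Function.update (fun i => a i.castSucc) 0
          (a (Fin.last (k + 1)) * a 0) l = a l.castSucc := by
        intro l
        by_cases hl : l = 0
        · subst hl
          rw [Function.update_self, ← hs, h, one_mul]; rfl
        · rw [Function.update_of_ne hl]
      rw [hl0]
      by_cases hl : (l : ℕ) < i
      · rw [if_pos hl]
      · obtain rfl : l = i := Fin.ext (by omega)
        rw [if_neg hl, if_pos rfl, h, mul_one]
    rw [Finset.sum_eq_single i, heq, hik']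
    · ring
    · intro j _ hj
      have h1 : (j : ℕ) ≠ i := fun h => hj (Fin.ext h)
      rw [hlow j (by omega), mul_zero]
    · intro h; exact absurd (Finset.mem_univ _) h

theorem preB_mem {k : ℕ} {φ : MultilinearMap ℂ (fun _ : Fin (k + 2) => A) ℂ}
    (hφ : φ ∈ Cochain A (k + 1)) : preB k φ ∈ Cochain A k := by
  intro a i h
  rw [preB_apply]
  refine Finset.sum_eq_zero fun j _ => ?_
  rw [hφ _ (i.succ - j), mul_zero]
  simp [rotate, h]

theorem preIota_mem (x : A) {k : ℕ} {φ : MultilinearMap ℂ (fun _ : Fin (k + 2) => A) ℂ}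
    (hφ : φ ∈ Cochain A (k + 1)) : preIota x k φ ∈ Cochain A k := by
  intro a i h
  rw [preIota_apply]
  refine Finset.sum_eq_zero fun j _ => ?_
  rw [Cochain.apply_eq_zero hφ _ (j.succ.succAbove i.succ), mul_zero]
  · rw [Fin.succ_succAbove_succ]; simp
  · rw [insertAfter, Fin.insertNth_apply_succAbove, h]

/-- Evaluation of cochains at `(a₀, …, a_k)`. -/
def evalAt {k : ℕ} (a : Fin (k + 1) → A) : Cochain A k →ₗ[ℂ] ℂ where
  toFun φ := φ.1 a
  map_add' _ _ := rfl
  map_smul' _ _ := rfl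

/-- The Hochschild differential `d : C^k(A, A^*) → C^{k+1}(A, A^*)`. -/
def hochD (k : ℕ) : Cochain A k →ₗ[ℂ] Cochain A (k + 1) :=
  (preD k).restrict fun _ => preD_mem

/-- The Connes operator `B : C^{k+1}(A, A^*) → C^k(A, A^*)`. -/
def connesB (k : ℕ) : Cochain A (k + 1) →ₗ[ℂ] Cochain A k :=
  (preB k).restrict fun _ => preB_mem

/-- The contraction `ι_x : C^{k+1}(A, A^*) → C^k(A, A^*)`. -/
def contr (x : A) (k : ℕ) : Cochain A (k + 1) →ₗ[ℂ] Cochain A k :=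
  (preIota x k).restrict fun _ => preIota_mem x

variable (A) in
/-- The graded vector space `C^•(A, A^*)`. -/
abbrev Cochains := DirectSum ℕ fun k => Cochain A k

/-- The inclusion of the cochains of degree `k`. -/
def ofDeg (k : ℕ) : Cochain A k →ₗ[ℂ] Cochains A := DirectSum.lof ℂ ℕ (fun k => Cochain A k) k

/-- The operator of degree `-1` on `C^•(A, A^*)` with the given components; it is zero on `C^0`. -/
def lowering (T : ∀ k, Cochain A (k + 1) →ₗ[ℂ] Cochain A k) : Module.End ℂ (Cochains A) :=
  DirectSum.toModule ℂ ℕ (Cochains A) fun k =>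
    match k with
    | 0 => 0
    | k + 1 => (ofDeg k).comp (T k)

/-- The Hochschild differential `d` on `C^•(A, A^*)`. -/
def dTot : Module.End ℂ (Cochains A) :=
  DirectSum.toModule ℂ ℕ (Cochains A) fun k => (ofDeg (k + 1)).comp (hochD k)

/-- The Connes differential `B` on `C^•(A, A^*)`. -/
def bTot : Module.End ℂ (Cochains A) := lowering connesB

/-- The contraction `ι_x` on `C^•(A, A^*)`. -/
def iota (x : A) : Module.End ℂ (Cochains A) := lowering (contr x)

variable (W : Type*) [AddCommGroup W] [Module ℂ W] [Module (Polynomial ℂ) W]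
  [IsScalarTower ℂ (Polynomial ℂ) W]

variable (A) in
/-- The cyclic cochains `C^•(A, A^*) ⊗ W` with coefficients in the `ℂ[u]`-module `W`. -/
abbrev Cyc := Cochains A ⊗[ℂ] W

/-- The action of the variable `u` on `W`. -/
def uAct : Module.End ℂ W := Algebra.lsmul ℂ ℂ W (Polynomial.X : Polynomial ℂ)

/-- The operator `u T` on `C^•(A, A^*) ⊗ W`. -/
def uOp (T : Module.End ℂ (Cochains A)) : Module.End ℂ (Cyc A W) :=
  TensorProduct.map T (uAct W)

/-- The cyclic differential `d + u B`. -/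
def cycD : Module.End ℂ (Cyc A W) := dTot.rTensor W + uOp W bTot

end Hochschild

/-! ### The cocycles -/

/-- The operator `ι_ω = ∑_j ι_{p_j} ι_{q_j}`. -/
def iotaOmega (n : ℕ) : Module.End ℂ (Cochains (Weyl n)) :=
  ∑ j : Fin n, iota (Weyl.y (pIdx j)) * iota (Weyl.y (qIdx j))

theorem lowering_zero {A : Type*} [Ring A] [Algebra ℂ A]
    (T : ∀ k, Cochain A (k + 1) →ₗ[ℂ] Cochain A k) (φ : Cochain A 0) :
    lowering T (ofDeg 0 φ) = 0 := by
  simp [lowering, ofDeg, DirectSum.toModule_lof]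

theorem lowering_succ {A : Type*} [Ring A] [Algebra ℂ A]
    (T : ∀ k, Cochain A (k + 1) →ₗ[ℂ] Cochain A k) (k : ℕ) (φ : Cochain A (k + 1)) :
    lowering T (ofDeg (k + 1) φ) = ofDeg k (T k φ) := by
  simp [lowering, ofDeg, DirectSum.toModule_lof]

theorem iotaOmega_low {n k : ℕ} (hk : k < 2) (φ : Cochain (Weyl n) k) :
    iotaOmega n (ofDeg k φ) = 0 := by
  rw [iotaOmega, LinearMap.sum_apply]
  refine Finset.sum_eq_zero fun j _ => ?_
  rw [Module.End.mul_apply, iota, iota]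
  match k, hk, φ with
  | 0, _, φ => rw [lowering_zero, map_zero]
  | 1, _, φ => rw [lowering_succ, lowering_zero]

theorem iotaOmega_high {n k : ℕ} (φ : Cochain (Weyl n) (k + 2)) :
    ∃ ψ, iotaOmega n (ofDeg (k + 2) φ) = ofDeg k ψ := by
  refine ⟨∑ j : Fin n, contr (Weyl.y (pIdx j)) k (contr (Weyl.y (qIdx j)) (k + 1) φ), ?_⟩
  rw [iotaOmega, LinearMap.sum_apply, map_sum]
  refine Finset.sum_congr rfl fun j _ => ?_
  rw [Module.End.mul_apply, iota, iota, lowering_succ, lowering_succ]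

theorem iotaOmega_pow {n : ℕ} (N : ℕ) : ∀ (k : ℕ) (_ : k < 2 * N) (φ : Cochain (Weyl n) k),
    (iotaOmega n ^ N) (ofDeg k φ) = 0 := by
  induction N with
  | zero => intro k hk; omega
  | succ N ih =>
    intro k hk φ
    rw [pow_succ, Module.End.mul_apply]
    match k, hk, φ with
    | 0, _, φ => rw [iotaOmega_low (by omega), map_zero]
    | 1, _, φ => rw [iotaOmega_low (by omega), map_zero]
    | k + 2, hk, φ =>
      obtain ⟨ψ, h⟩ := iotaOmega_high φ
      rw [h, ih k (by omega)]

/-- `u ι_ω` is locally nilpotent, so that `e^{u ι_ω}` is given by finite sums. -/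
theorem locNilp_uOp_iotaOmega (n : ℕ) (W : Type*) [AddCommGroup W] [Module ℂ W]
    [Module (Polynomial ℂ) W] [IsScalarTower ℂ (Polynomial ℂ) W] :
    LocNilp (uOp W (iotaOmega n)) := by
  have hadd : ∀ x y : Cyc (Weyl n) W, (∃ N : ℕ, (uOp W (iotaOmega n) ^ N) x = 0) →
      (∃ N : ℕ, (uOp W (iotaOmega n) ^ N) y = 0) →
      ∃ N : ℕ, (uOp W (iotaOmega n) ^ N) (x + y) = 0 := by
    rintro x y ⟨N, hN⟩ ⟨M, hM⟩
    exact ⟨max N M, by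
      rw [map_add, pow_apply_eq_zero_of_le hN (le_max_left _ _),
        pow_apply_eq_zero_of_le hM (le_max_right _ _), add_zero]⟩
  intro x
  induction x using TensorProduct.induction_on with
  | zero => exact ⟨0, map_zero _⟩
  | add x y hx hy => exact hadd x y hx hy
  | tmul φ w =>
    induction φ using DirectSum.induction_on with
    | zero => exact ⟨0, by rw [TensorProduct.zero_tmul, map_zero]⟩
    | add x y hx hy => rw [TensorProduct.add_tmul]; exact hadd _ _ hx hy
    | of k φ =>
      refine ⟨k + 1, ?_⟩
      rw [uOp, TensorProduct.map_pow, TensorProduct.map_tmul]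
      have := iotaOmega_pow (k + 1) k (by omega) φ
      rw [ofDeg, DirectSum.lof_eq_of] at this
      rw [this, TensorProduct.zero_tmul]

/-- The operator `π_{2n}`: the determinant of the matrix `(∂_β in slot i)`, `1 ≤ i ≤ 2n`, of
commuting operators, by the Leibniz formula. -/
def piOp (n : ℕ) : Module.End ℂ (Tens n (2 * n + 1)) :=
  ∑ σ : Equiv.Perm (Fin (2 * n)), ((Equiv.Perm.sign σ : ℤ) : ℂ) •
    (List.ofFn fun i : Fin (2 * n) => slotD i.succ (σ i)).prod

/-- The open simplex `0 < u₁ < ⋯ < u_m < 1`. -/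
def openSimplex (m : ℕ) : Set (Fin m → ℝ) := {u | StrictMono u ∧ ∀ i, 0 < u i ∧ u i < 1}

/-- `∑_{0 ≤ i < j ≤ 2n} B₁(u_j - u_i) α_{ji}` with `u₀ = 0` and `B₁(t) = t - 1/2`. -/
def exponent (n : ℕ) (u : Fin (2 * n) → ℝ) : Module.End ℂ (Tens n (2 * n + 1)) :=
  ∑ i : Fin (2 * n + 1), ∑ j ∈ Finset.Ioi i,
    (((Fin.cons 0 u : Fin (2 * n + 1) → ℝ) j - (Fin.cons 0 u : Fin (2 * n + 1) → ℝ) i - 1 / 2 : ℝ)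
      : ℂ) • alpha j i

/-- `μ_{2n}(∏_{0 ≤ i < j ≤ 2n} e^{B₁(u_j - u_i) α_{ji}} F)`, where `μ_{2n}` is the evaluation at
the origin. The operators `α_{ji}` commute, and the product is the exponential of the sum. -/
def integrand (n : ℕ) (F : Tens n (2 * n + 1)) (u : Fin (2 * n) → ℝ) : ℂ :=
  MvPolynomial.constantCoeff (locExp (exponent n u) F)

theorem lowers_exponent (n : ℕ) (u : Fin (2 * n) → ℝ) : Lowers (exponent n u) :=
  Lowers.sum _ fun _ _ => Lowers.sum _ fun _ _ => (lowers_alpha _ _).smul _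

theorem continuous_coeff_pow_exponent (n : ℕ) (F : Tens n (2 * n + 1)) (N : ℕ) :
    ∀ m, Continuous fun u => MvPolynomial.coeff m ((exponent n u ^ N) F) := by
  have hslot : ∀ (i : Fin (2 * n + 1)) (β : Fin (2 * n))
      (G : (Fin (2 * n) → ℝ) → Tens n (2 * n + 1)),
      (∀ m, Continuous fun u => MvPolynomial.coeff m (G u)) →
      ∀ m, Continuous fun u => MvPolynomial.coeff m (slotD i β (G u)) := by
    intro i β G hG m
    simp only [slotD_apply, MvPolynomial.coeff_pderiv]
    exact (hG _).mul continuous_const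
  have hcons : ∀ i : Fin (2 * n + 1),
      Continuous fun u : Fin (2 * n) → ℝ => (Fin.cons 0 u : Fin (2 * n + 1) → ℝ) i := by
    intro i
    refine Fin.cases ?_ (fun i => ?_) i
    · simpa using continuous_const
    · simpa using continuous_apply i
  induction N with
  | zero => intro m; simpa using continuous_const
  | succ N ih =>
    intro m
    simp only [pow_succ', Module.End.mul_apply]
    simp only [exponent, alpha, LinearMap.sum_apply, LinearMap.smul_apply, LinearMap.sub_apply,
      Module.End.mul_apply, MvPolynomial.coeff_sum, MvPolynomial.coeff_smul,
      MvPolynomial.coeff_sub]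
    refine continuous_finsetSum _ fun i _ => continuous_finsetSum _ fun j _ => ?_
    refine Continuous.smul (Complex.continuous_ofReal.comp
      (((hcons j).sub (hcons i)).sub continuous_const)) ?_
    refine continuous_finsetSum _ fun l _ => Continuous.sub ?_ ?_ <;>
    exact hslot _ _ _ (hslot _ _ _ ih) m

theorem integrand_eq_sum (n : ℕ) (F : Tens n (2 * n + 1)) (u : Fin (2 * n) → ℝ) :
    integrand n F u = ∑ k ∈ Finset.range (F.totalDegree + 1),
      ((Nat.factorial k : ℂ)⁻¹) * MvPolynomial.coeff 0 ((exponent n u ^ k) F) := by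
  rw [integrand, locExp_eq_sum ((lowers_exponent n u).pow_eq_zero _ F (Nat.lt_succ_self _)),
    MvPolynomial.constantCoeff_eq, MvPolynomial.coeff_sum]
  simp [MvPolynomial.coeff_smul]

theorem continuous_integrand (n : ℕ) (F : Tens n (2 * n + 1)) : Continuous (integrand n F) := by
  have : integrand n F = fun u => ∑ k ∈ Finset.range (F.totalDegree + 1),
      ((Nat.factorial k : ℂ)⁻¹) * MvPolynomial.coeff 0 ((exponent n u ^ k) F) :=
    funext fun u => integrand_eq_sum n F u
  rw [this]
  exact continuous_finsetSum _ fun k _ =>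
    continuous_const.mul (continuous_coeff_pow_exponent n F k 0)

theorem integrableOn_integrand (n : ℕ) (F : Tens n (2 * n + 1)) :
    MeasureTheory.IntegrableOn (integrand n F) (openSimplex (2 * n)) := by
  refine ((continuous_integrand n F).continuousOn.integrableOn_compact
    (isCompact_univ_pi fun _ => isCompact_Icc (a := (0 : ℝ)) (b := 1))).mono_set ?_
  intro u hu i _
  exact ⟨(hu.2 i).1.le, (hu.2 i).2.le⟩

/-- The functional `F ↦ ∫_{Δ_{2n}} μ_{2n}(∏_{i < j} e^{B₁(u_j - u_i) α_{ji}} F) du₁ ⋯ du_{2n}`,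
that is, `μ_{2n} ∘ S_{2n}`. -/
def simplexFunctional (n : ℕ) : Tens n (2 * n + 1) →ₗ[ℂ] ℂ where
  toFun F := ∫ u in openSimplex (2 * n), integrand n F u
  map_add' F G := by
    rw [← MeasureTheory.integral_add (integrableOn_integrand n F) (integrableOn_integrand n G)]
    refine MeasureTheory.integral_congr_ae (Filter.Eventually.of_forall fun u => ?_)
    simp only [integrand, locExp_add (lowers_exponent n u).locNilp, map_add]
  map_smul' c F := by
    rw [RingHom.id_apply, ← MeasureTheory.integral_smul]
    refine MeasureTheory.integral_congr_ae (Filter.Eventually.of_forall fun u => ?_)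
    simp only [integrand, locExp_smul (lowers_exponent n u).locNilp,
      MvPolynomial.constantCoeff_smul]

/-- The multilinear functional `μ_{2n} ∘ S_{2n} ∘ π_{2n}`. -/
def preTau (n : ℕ) : MultilinearMap ℂ (fun _ : Fin (2 * n + 1) => Weyl n) ℂ :=
  ((simplexFunctional n).comp (piOp n)).compMultilinearMap
    ((tens n (2 * n + 1)).compLinearMap fun _ => Weyl.toPoly.toLinearMap)

theorem list_prod_apply_eq_zero {V : Type*} [AddCommGroup V] [Module ℂ V]
    (l : List (Module.End ℂ V)) (hl : ∀ s ∈ l, ∀ t ∈ l, Commute s t) (t : Module.End ℂ V)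
    (ht : t ∈ l) (x : V) (hx : t x = 0) : l.prod x = 0 := by
  have : ∀ l : List (Module.End ℂ V), (∀ s ∈ l, Commute s t) → t ∈ l → l.prod x = 0 := by
    intro l
    induction l with
    | nil => intro _ h; simp at h
    | cons s l ih =>
      intro h hm
      rw [List.prod_cons]
      rcases List.mem_cons.1 hm with rfl | hm
      · have hc : Commute t l.prod :=
          Commute.list_prod_right _ _ fun s hs => (h s (List.mem_cons_of_mem _ hs)).symm
        rw [hc.eq, Module.End.mul_apply, hx, map_zero]
      · rw [Module.End.mul_apply, ih (fun s hs => h s (List.mem_cons_of_mem _ hs)) hm, map_zero]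
  exact this l (fun s hs => hl s hs t ht) ht

theorem preTau_mem (n : ℕ) : preTau n ∈ Cochain (Weyl n) (2 * n) := by
  intro a i h
  have hpi : piOp n (tens n (2 * n + 1) fun i => Weyl.toPoly (a i)) = 0 := by
    rw [piOp, LinearMap.sum_apply]
    refine Finset.sum_eq_zero fun σ _ => ?_
    rw [LinearMap.smul_apply, list_prod_apply_eq_zero _ _ (slotD i.succ (σ i)), smul_zero]
    · simp
    · exact slotD_tens_eq_zero _ _ (by rw [h, Weyl.toPoly_one]) _
    · intro s hs t ht
      obtain ⟨i, rfl⟩ := (List.mem_ofFn' _ _).1 hs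
      obtain ⟨j, rfl⟩ := (List.mem_ofFn' _ _).1 ht
      exact slotD_commute _ _ _ _
  change simplexFunctional n (piOp n (tens n (2 * n + 1) fun i => Weyl.toPoly (a i))) = 0
  rw [hpi, map_zero]

/-- The Feigin–Felder–Shoikhet cochain `τ_{2n} = μ_{2n} ∘ S_{2n} ∘ π_{2n}`. -/
def tau (n : ℕ) : Cochain (Weyl n) (2 * n) := ⟨preTau n, preTau_mem n⟩

/-- The cyclic cochain `τ_w = e^{u ι_ω} τ_{2n} ⊗ w`. -/
def tauW (n : ℕ) {W : Type*} [AddCommGroup W] [Module ℂ W] [Module (Polynomial ℂ) W]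
    [IsScalarTower ℂ (Polynomial ℂ) W] (w : W) : Cyc (Weyl n) W :=
  locExp (uOp W (iotaOmega n)) (ofDeg (2 * n) (tau n) ⊗ₜ[ℂ] w)

/-- Evaluation of cochains on the Hochschild chain `1 ⊗ p₁ ∧ q₁ ∧ ⋯ ∧ p_n ∧ q_n`, where
`v₁ ∧ ⋯ ∧ v_k = ∑_σ sgn(σ) v_{σ(1)} ⊗ ⋯ ⊗ v_{σ(k)}`; cochains of degree other than `2n` are sent
to zero. -/
def evalVol (n : ℕ) : Cochains (Weyl n) →ₗ[ℂ] ℂ :=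
  (∑ σ : Equiv.Perm (Fin (2 * n)), ((Equiv.Perm.sign σ : ℤ) : ℂ) •
    evalAt (A := Weyl n) (Fin.cons 1 fun i => Weyl.y (σ i))).comp
    (DirectSum.component ℂ ℕ (fun k => Cochain (Weyl n) k) (2 * n))

/-- Evaluation of cyclic cochains on `1 ⊗ p₁ ∧ q₁ ∧ ⋯ ∧ p_n ∧ q_n`, with values in `W`. -/
def evalVolW (n : ℕ) (W : Type*) [AddCommGroup W] [Module ℂ W] : Cyc (Weyl n) W →ₗ[ℂ] W :=
  (TensorProduct.lid ℂ W).toLinearMap.comp ((evalVol n).rTensor W)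

end WeylCyclic

end

open scoped TensorProduct

noncomputable section

namespace WeylCyclic

/-! ### Symbols of constant coefficient differential operators -/

/-! Everything is translated into integrals over points on a circle and the algebra of alternating
forms. A constant coefficient operator on tensor slots is encoded by its symbol, a polynomial in the
vectors `row i` of partial derivatives in slot `i`. The exponent of `tau` becomes a quadratic symbol
whose coefficients are the values of `t - 1/2` at differences of the points `0 = u₀ < u₁ < ⋯` of the
circle, and the determinant becomes the volume form evaluated on the rows `1, …, 2n`. `Rep ψ φ` says
that a cochain `φ` arises in this way from an alternating form `ψ`. Put `t = ∑ row i`, the sum over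
all slots including slot `0`.

The operators on `φ` turn into operations on `ψ`. The factor `e^{α/2}` of a Moyal product is the
one-sided limit of the exponential when two neighbouring points collide (`bern_predAbove`,
`bern_wrap`). Hence the faces in `dφ` are integrals over the walls of a simplex, and Stokes' theorem
turns them into minus the integral of the symbol `ω(·, t) ∧ ψ` (`Rep.hochD`). The Connes operator
removes the base point and sums over rotations; translation invariance on the circle brings slot `0`
back to the origin, so `B` evaluates `ψ` on the rows `0, …, k` (`Rep.connesB`). Inserting a
coordinate contracts `ψ` with a basis vector (`Rep.contr_y`). Inserting a quadratic polynomial gives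
a sum of terms, each with one factor `t - 1/2` in the position of the inserted point, and this
factor integrates to zero over the circle; so `ι_a` vanishes on all represented cochains for `a` in
`sp n` (`Rep.contr_sp`).

The cocycle property is then a Lefschetz type commutation relation: the commutator of the
contraction with the bivector `ω` and the product with `ω(·, t)` is the contraction with `t`
(`NForm.wedge_iom`). The product with the volume form is zero for degree reasons (`volForm_wedge`),
so by induction the product with the `(j+1)`-st contraction of the volume form is `j + 1` times the
contraction of the `j`-th one with `t`. On rows `1, …, k`, contraction with `t` is the same as
adjoining `row 0` (`form_sum_row`), which is the form of `B`. Hence `d ι_ω^{j+1} τ = -(j+1) B ι_ω^j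
τ` (`dTot_iotaOmega_pow_succ`), and the exponential series telescopes under `d + uB`.

For nontriviality, evaluation on the volume chain kills the images of `d` and `B`: commutators of
coordinates are scalars, so the antisymmetrized chain is a Hochschild cycle, and normalization takes
care of `B`. The value of `τ_w` on this chain is `w`, so `w ≠ 0` excludes a coboundary. -/

theorem isMulCommutative_adjoin_slotD (n k : ℕ) : IsMulCommutative (Algebra.adjoin ℂ
    (Set.range fun v : Fin k × Fin (2 * n) => slotD (n := n) v.1 v.2)) :=
  Algebra.isMulCommutative_adjoin ℂ <| by
    rintro _ ⟨v, rfl⟩ _ ⟨w, rfl⟩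
    exact slotD_commute _ _ _ _

/-- The differential operator with constant coefficients with a given symbol. -/
def sym (n k : ℕ) : Tens n k →ₐ[ℂ] Module.End ℂ (Tens n k) :=
  -- Polynomials can only be evaluated in a commutative algebra, so the evaluation takes place in
  -- the subalgebra generated by the partial derivatives.
  letI : CommRing (Algebra.adjoin ℂ
      (Set.range fun v : Fin k × Fin (2 * n) => slotD (n := n) v.1 v.2)) :=
    { (inferInstance : Ring (Algebra.adjoin ℂ
      (Set.range fun v : Fin k × Fin (2 * n) => slotD (n := n) v.1 v.2))) with
      mul_comm := (isMulCommutative_adjoin_slotD n k).is_comm.comm }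
  (Algebra.adjoin ℂ
    (Set.range fun v : Fin k × Fin (2 * n) => slotD (n := n) v.1 v.2)).val.comp
    (MvPolynomial.aeval fun v => ⟨slotD v.1 v.2, Algebra.subset_adjoin ⟨v, rfl⟩⟩)

theorem sym_X {n k : ℕ} (v : Fin k × Fin (2 * n)) :
    sym n k (MvPolynomial.X v) = slotD v.1 v.2 := by
  simp [sym]

theorem sym_C {n k : ℕ} (c : ℂ) (F : Tens n k) : sym n k (MvPolynomial.C c) F = c • F := by
  rw [← MvPolynomial.algebraMap_eq, AlgHom.commutes, Module.algebraMap_end_apply]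

theorem sym_mul_apply {n k : ℕ} (P Q F : Tens n k) :
    sym n k (P * Q) F = sym n k P (sym n k Q F) := by
  rw [map_mul, Module.End.mul_apply]

theorem sym_commute {n k : ℕ} (P Q : Tens n k) : Commute (sym n k P) (sym n k Q) := by
  rw [commute_iff_eq, ← map_mul, ← map_mul, mul_comm P Q]

/-- The Heisenberg relation: commuting `P(∂)` past the variable `X_v` differentiates the symbol. -/
theorem sym_X_mul {n k : ℕ} (P F : Tens n k) (v : Fin k × Fin (2 * n)) :
    sym n k P (MvPolynomial.X v * F) =
      MvPolynomial.X v * sym n k P F + sym n k (MvPolynomial.pderiv v P) F := by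
  classical
  induction P using MvPolynomial.induction_on generalizing F with
  | C a => simp
  | add p q hp hq => simp only [map_add, LinearMap.add_apply, hp, hq]; ring
  | mul_X p w hp =>
    rw [sym_mul_apply, sym_mul_apply, sym_X, slotD_apply, slotD_apply, MvPolynomial.pderiv_mul,
      map_add, hp, MvPolynomial.pderiv_mul, map_add, LinearMap.add_apply, sym_mul_apply,
      sym_mul_apply, sym_X, slotD_apply]
    have : sym n k p (MvPolynomial.pderiv (w.1, w.2) (MvPolynomial.X v) * F) =
        sym n k p (sym n k (MvPolynomial.pderiv v (MvPolynomial.X w)) F) := by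
      rw [MvPolynomial.pderiv_X, MvPolynomial.pderiv_X]
      by_cases h : v = w
      · subst h; simp
      · simp [h, Ne.symm h]
    rw [this]
    ring

/-- The symplectic form on vectors with entries in a commutative ring. -/
def om {n : ℕ} {S : Type*} [CommRing S] (v w : Fin (2 * n) → S) : S :=
  ∑ j : Fin n, (v (pIdx j) * w (qIdx j) - v (qIdx j) * w (pIdx j))

/-- The vector of symbols of the partial derivatives in the `i`-th slot. -/
def row {n k : ℕ} (i : Fin k) : Fin (2 * n) → Tens n k := fun β => MvPolynomial.X (i, β)

theorem sym_om_row {n k : ℕ} (r s : Fin k) : sym n k (om (row r) (row s)) = alpha r s := by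
  simp [om, row, alpha, sym_X]

theorem om_neg {n : ℕ} {S : Type*} [CommRing S] (v w : Fin (2 * n) → S) : om v w = - om w v := by
  rw [om, om, ← Finset.sum_neg_distrib]
  exact Finset.sum_congr rfl fun j _ => by ring

theorem om_self {n : ℕ} {S : Type*} [CommRing S] (v : Fin (2 * n) → S) : om v v = 0 := by
  rw [om]
  exact Finset.sum_eq_zero fun j _ => by ring

theorem om_sum_right {n : ℕ} {S ι : Type*} [CommRing S] (s : Finset ι) (v : Fin (2 * n) → S)
    (w : ι → Fin (2 * n) → S) : om v (∑ i ∈ s, w i) = ∑ i ∈ s, om v (w i) := by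
  simp only [om, Finset.sum_apply, Finset.mul_sum, ← Finset.sum_sub_distrib]
  exact Finset.sum_comm

theorem om_sum_left {n : ℕ} {S ι : Type*} [CommRing S] (s : Finset ι) (v : Fin (2 * n) → S)
    (w : ι → Fin (2 * n) → S) : om (∑ i ∈ s, w i) v = ∑ i ∈ s, om (w i) v := by
  rw [om_neg, om_sum_right, ← Finset.sum_neg_distrib]
  exact Finset.sum_congr rfl fun i _ => (om_neg _ _).symm

theorem map_om {n : ℕ} {S S' : Type*} [CommRing S] [CommRing S'] (f : S →+* S')
    (v w : Fin (2 * n) → S) : f (om v w) = om (fun β => f (v β)) (fun β => f (w β)) := by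
  simp [om]

/-! ### Exponentials of quadratic symbols, evaluated at the origin -/

/-- The quadratic symbol `½ ∑ c_{ij} α_{ij}`. -/
def quad {n k : ℕ} (c : Fin k → Fin k → ℝ) : Tens n k :=
  ∑ i, ∑ j, MvPolynomial.C (c i j / 2 : ℂ) * om (row i) (row j)

theorem quad_add {n k : ℕ} (c c' : Fin k → Fin k → ℝ) :
    quad (n := n) (c + c') = quad c + quad c' := by
  simp only [quad, ← Finset.sum_add_distrib, Pi.add_apply, Complex.ofReal_add, add_div, map_add,
    add_mul]

theorem quad_smul {n k : ℕ} (t : ℝ) (c : Fin k → Fin k → ℝ) :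
    quad (n := n) (t • c) = MvPolynomial.C (t : ℂ) * quad c := by
  simp only [quad, Finset.mul_sum, Pi.smul_apply, smul_eq_mul, Complex.ofReal_mul, mul_div_assoc,
    map_mul, mul_assoc]

theorem sym_C_mul {n k : ℕ} (c : ℂ) (P : Tens n k) :
    sym n k (MvPolynomial.C c * P) = c • sym n k P := by
  rw [← MvPolynomial.smul_eq_C_mul, map_smul]

theorem sym_quad {n k : ℕ} (c : Fin k → Fin k → ℝ) :
    sym n k (quad c) = ∑ i, ∑ j, (c i j / 2 : ℂ) • alpha i j := by
  simp only [quad, map_sum, sym_C_mul, sym_om_row]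

theorem lowers_sym_quad {n k : ℕ} (c : Fin k → Fin k → ℝ) : Lowers (sym n k (quad c)) := by
  rw [sym_quad]
  exact Lowers.sum _ fun _ _ => Lowers.sum _ fun _ _ => (lowers_alpha _ _).smul _

theorem locNilp_sym_quad {n k : ℕ} (c : Fin k → Fin k → ℝ) : LocNilp (sym n k (quad c)) :=
  (lowers_sym_quad c).locNilp

/-- The value at the origin of `e^{½ ∑ c_{ij} α_{ij}} P(∂) F`. -/
def J {n k : ℕ} (c : Fin k → Fin k → ℝ) (P F : Tens n k) : ℂ :=
  MvPolynomial.constantCoeff (locExp (sym n k (quad c)) (sym n k P F))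

theorem locExp_sym_comm {n k : ℕ} (c : Fin k → Fin k → ℝ) (P F : Tens n k) :
    locExp (sym n k (quad c)) (sym n k P F) = sym n k P (locExp (sym n k (quad c)) F) :=
  locExp_intertwine (locNilp_sym_quad c) (fun x => by
    rw [← Module.End.mul_apply, ← Module.End.mul_apply, (sym_commute _ _).eq]) F

theorem locExp_sym_quad_add {n k : ℕ} (c c' : Fin k → Fin k → ℝ) (F : Tens n k) :
    locExp (sym n k (quad (c + c'))) F =
      locExp (sym n k (quad c)) (locExp (sym n k (quad c')) F) := by
  rw [quad_add, map_add, locExp_add_op (locNilp_sym_quad c) (locNilp_sym_quad c')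
    (sym_commute _ _)]

theorem J_add_left {n k : ℕ} (c : Fin k → Fin k → ℝ) (P Q F : Tens n k) :
    J c (P + Q) F = J c P F + J c Q F := by
  rw [J, map_add, LinearMap.add_apply, locExp_add (locNilp_sym_quad c), map_add]; rfl

theorem J_C_mul {n k : ℕ} (c : Fin k → Fin k → ℝ) (a : ℂ) (P F : Tens n k) :
    J c (MvPolynomial.C a * P) F = a * J c P F := by
  rw [J, sym_C_mul, LinearMap.smul_apply, locExp_smul (locNilp_sym_quad c),
    MvPolynomial.constantCoeff_smul, smul_eq_mul]; rfl

/-- `J` as a linear functional of the symbol. -/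
def JLin {n k : ℕ} (c : Fin k → Fin k → ℝ) (F : Tens n k) : Tens n k →ₗ[ℂ] ℂ where
  toFun P := J c P F
  map_add' P Q := J_add_left c P Q F
  map_smul' a P := by rw [MvPolynomial.smul_eq_C_mul, J_C_mul]; rfl

theorem J_sum {n k : ℕ} {ι : Type*} (s : Finset ι) (c : Fin k → Fin k → ℝ)
    (P : ι → Tens n k) (F : Tens n k) : J c (∑ i ∈ s, P i) F = ∑ i ∈ s, J c (P i) F :=
  map_sum (JLin c F) P s

theorem J_zero {n k : ℕ} (c : Fin k → Fin k → ℝ) (F : Tens n k) : J c 0 F = 0 :=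
  map_zero (JLin c F)

/-- Constant coefficient operators commute, so part of the exponential can be moved onto the
argument. This is how the Moyal exponential is absorbed into the matrix `c`. -/
theorem J_add_quad {n k : ℕ} (c c' : Fin k → Fin k → ℝ) (P F : Tens n k) :
    J (c + c') P F = J c P (locExp (sym n k (quad c')) F) := by
  rw [J, J, locExp_sym_quad_add, locExp_sym_comm c']

/-- The length of the exponential series is bounded by the degree of `P(∂) F`, uniformly in `c`. So
`J` is polynomial in `c`, and continuity and derivatives can be read off from a finite sum. -/
theorem J_eq_sum {n k : ℕ} (P F : Tens n k) : ∃ N₀, ∀ N ≥ N₀, ∀ c : Fin k → Fin k → ℝ,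
    J c P F = ∑ j ∈ Finset.range N, ((Nat.factorial j : ℂ)⁻¹) *
      MvPolynomial.constantCoeff (sym n k (quad c ^ j * P) F) := by
  refine ⟨(sym n k P F).totalDegree + 1, fun N hN c => ?_⟩
  rw [J, locExp_eq_sum ((lowers_sym_quad c).pow_eq_zero N _ hN), map_sum]
  refine Finset.sum_congr rfl fun j _ => ?_
  rw [MvPolynomial.constantCoeff_smul, smul_eq_mul, sym_mul_apply, map_pow]

theorem continuous_J {n k : ℕ} (P F : Tens n k) :
    Continuous fun c : Fin k → Fin k → ℝ => J c P F := by
  obtain ⟨N, hN⟩ := J_eq_sum P F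
  simp only [hN N le_rfl]
  refine continuous_finsetSum _ fun j hj => continuous_const.mul ?_
  clear hN hj
  induction j generalizing P with
  | zero => simpa using continuous_const
  | succ j ih =>
    have : (fun c : Fin k → Fin k → ℝ =>
        MvPolynomial.constantCoeff (sym n k (quad c ^ (j + 1) * P) F)) =
        fun c => ∑ r, ∑ s, (c r s / 2 : ℂ) * MvPolynomial.constantCoeff
          (sym n k (quad c ^ j * (om (row r) (row s) * P)) F) := by
      funext c
      have h : quad c ^ (j + 1) * P = ∑ r, ∑ s, MvPolynomial.C (c r s / 2 : ℂ) *
          (quad c ^ j * (om (row r) (row s) * P)) := by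
        rw [pow_succ]
        nth_rewrite 2 [quad]
        simp only [Finset.mul_sum, Finset.sum_mul]
        exact Finset.sum_congr rfl fun _ _ => Finset.sum_congr rfl fun _ _ => by ring
      rw [h]
      simp only [map_sum, sym_C_mul, LinearMap.sum_apply, LinearMap.smul_apply,
        MvPolynomial.constantCoeff_smul, smul_eq_mul]
    rw [this]
    refine continuous_finsetSum _ fun r _ => continuous_finsetSum _ fun s _ => ?_
    exact ((Complex.continuous_ofReal.comp (continuous_apply_apply r s)).div_const 2).mul (ih _)

theorem pderiv_pow_mul {σ : Type*} (v : σ) (q P : MvPolynomial σ ℂ) (j : ℕ) :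
    MvPolynomial.pderiv v (q ^ j * P) = q ^ j * MvPolynomial.pderiv v P +
      MvPolynomial.C (j : ℂ) * (q ^ (j - 1) * (MvPolynomial.pderiv v q * P)) := by
  rw [MvPolynomial.pderiv_mul, MvPolynomial.pderiv_pow, map_natCast]
  ring

/-- A factor `X_v` of the argument acts as a derivation on the symbol `e^{quad c} P`. -/
theorem J_X_mul {n k : ℕ} (c : Fin k → Fin k → ℝ) (P F : Tens n k) (v : Fin k × Fin (2 * n)) :
    J c P (MvPolynomial.X v * F) =
      J c (MvPolynomial.pderiv v P + MvPolynomial.pderiv v (quad c) * P) F := by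
  rw [J_add_left]
  obtain ⟨N₁, h₁⟩ := J_eq_sum P (MvPolynomial.X v * F)
  obtain ⟨N₂, h₂⟩ := J_eq_sum (MvPolynomial.pderiv v P) F
  obtain ⟨N₃, h₃⟩ := J_eq_sum (MvPolynomial.pderiv v (quad c) * P) F
  set N := max N₁ (max N₂ N₃)
  -- Differentiating `q^j / j!` gives `q' q^{j-1} / (j-1)!`, so the sum containing `q'` has one term
  -- fewer.
  rw [h₁ (N + 1) (by omega), h₂ (N + 1) (by omega), h₃ N (by omega)]
  have key : ∀ j : ℕ, MvPolynomial.constantCoeff (sym n k (quad c ^ j * P) (MvPolynomial.X v * F)) =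
      MvPolynomial.constantCoeff (sym n k (quad c ^ j * MvPolynomial.pderiv v P) F) +
      j * MvPolynomial.constantCoeff
        (sym n k (quad c ^ (j - 1) * (MvPolynomial.pderiv v (quad c) * P)) F) := by
    intro j
    rw [sym_X_mul, map_add, map_mul, MvPolynomial.constantCoeff_X, zero_mul, zero_add,
      pderiv_pow_mul, map_add, LinearMap.add_apply, map_add, sym_C_mul, LinearMap.smul_apply,
      MvPolynomial.constantCoeff_smul, smul_eq_mul]
  simp only [key, mul_add, Finset.sum_add_distrib]
  congr 1
  rw [Finset.sum_range_succ']
  simp only [CharP.cast_eq_zero, zero_mul, mul_zero, add_zero, Nat.add_sub_cancel]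
  refine Finset.sum_congr rfl fun j _ => ?_
  rw [← mul_assoc]
  congr 1
  rw [Nat.factorial_succ, Nat.cast_mul]
  have h1 : ((j + 1 : ℕ) : ℂ) ≠ 0 := by exact_mod_cast Nat.succ_ne_zero j
  have h2 : ((j.factorial : ℕ) : ℂ) ≠ 0 := by exact_mod_cast Nat.factorial_ne_zero _
  field_simp

/-- Along an affine path of matrices, the exponential at `t₀` can be split off into `G`. What
remains is a polynomial in `t - t₀` whose linear coefficient is the claimed derivative. -/
theorem hasDerivAt_J {n k : ℕ} (P F : Tens n k) (c : ℝ → Fin k → Fin k → ℝ)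
    (c' : Fin k → Fin k → ℝ) (t₀ : ℝ) (hc : ∀ t, c t = (t - t₀) • c' + c t₀) :
    HasDerivAt (fun t => J (c t) P F) (J (c t₀) (quad c' * P) F) t₀ := by
  set G := sym n k P (locExp (sym n k (quad (c t₀))) F) with hG
  obtain ⟨N, hN⟩ := J_eq_sum (1 : Tens n k) G
  have h1 : ∀ t, J (c t) P F = ∑ j ∈ Finset.range (N + 2), ((t - t₀ : ℝ) : ℂ) ^ j *
      (((Nat.factorial j : ℂ)⁻¹) *
        MvPolynomial.constantCoeff (sym n k (quad c' ^ j) G)) := by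
    intro t
    have : J (c t) P F = J ((t - t₀) • c') 1 G := by
      rw [hc t, J_add_quad, J, J, locExp_sym_comm, hG, map_one, Module.End.one_apply,
        locExp_sym_comm]
    rw [this, hN (N + 2) (by omega)]
    refine Finset.sum_congr rfl fun j _ => ?_
    rw [mul_one, quad_smul, mul_pow, ← map_pow, sym_C_mul, LinearMap.smul_apply,
      MvPolynomial.constantCoeff_smul, smul_eq_mul]
    ring
  have h2 : J (c t₀) (quad c' * P) F = MvPolynomial.constantCoeff (sym n k (quad c') G) := by
    rw [J, locExp_sym_comm, sym_mul_apply, hG]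
  rw [h2]
  simp only [h1]
  -- The constant and the linear term are split off; all others have a factor `(t - t₀)²`. Taking `N
  -- + 2` terms guarantees that both are present.
  rw [show N + 2 = (N + 1) + 1 from rfl]
  simp only [Finset.sum_range_succ' _ (N + 1)]
  simp only [Finset.sum_range_succ' _ N]
  have hd : HasDerivAt (fun t : ℝ => ((t - t₀ : ℝ) : ℂ)) 1 t₀ := by
    simpa using ((hasDerivAt_id t₀).sub_const t₀).ofReal_comp
  have hs : HasDerivAt (fun t : ℝ => ∑ j ∈ Finset.range N, ((t - t₀ : ℝ) : ℂ) ^ (j + 1 + 1) *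
      (((Nat.factorial (j + 1 + 1) : ℂ)⁻¹) *
        MvPolynomial.constantCoeff (sym n k (quad c' ^ (j + 1 + 1)) G))) 0 t₀ := by
    have := HasDerivAt.fun_sum (u := Finset.range N) fun j _ =>
      (hd.fun_pow (j + 1 + 1)).mul_const (((Nat.factorial (j + 1 + 1) : ℂ)⁻¹) *
        MvPolynomial.constantCoeff (sym n k (quad c' ^ (j + 1 + 1)) G))
    simpa using this
  have := (hs.add ((hd.fun_pow (0 + 1)).mul_const (((Nat.factorial (0 + 1) : ℂ)⁻¹) *
        MvPolynomial.constantCoeff (sym n k (quad c' ^ (0 + 1)) G)))).add_const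
        (((t₀ - t₀ : ℝ) : ℂ) ^ 0 * (((Nat.factorial 0 : ℂ)⁻¹) *
        MvPolynomial.constantCoeff (sym n k (quad c' ^ 0) G)))
  simpa using this

/-! ### Symbols under relabelling of slots -/

/-- The action of a relabelling on symbols. -/
def pull (n : ℕ) {k l : ℕ} (f : Fin k → Fin l) : Tens n l →ₐ[ℂ] Tens n k :=
  MvPolynomial.aeval fun v => ∑ i, if f i = v.1 then MvPolynomial.X (i, v.2) else 0

theorem pull_X {n k l : ℕ} (f : Fin k → Fin l) (v : Fin l × Fin (2 * n)) :
    pull n f (MvPolynomial.X v) = ∑ i, if f i = v.1 then MvPolynomial.X (i, v.2) else 0 := by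
  rw [pull, MvPolynomial.aeval_X]

theorem pull_row {n k l : ℕ} (f : Fin k → Fin l) (j : Fin l) :
    (fun β => pull n f (row j β)) = ∑ i, if f i = j then row i else 0 := by
  funext β
  rw [row, pull_X, Finset.sum_apply]
  refine Finset.sum_congr rfl fun i _ => ?_
  split_ifs <;> rfl

/-- The chain rule: a derivative in a merged slot is the sum of the derivatives in the slots that
were merged, and `pull` makes this substitution in the symbol. -/
theorem sym_relabel {n k l : ℕ} (f : Fin k → Fin l) (P : Tens n l) (F : Tens n k) :
    sym n l P (relabel n f F) = relabel n f (sym n k (pull n f P) F) := by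
  induction P using MvPolynomial.induction_on generalizing F with
  | C a => rw [sym_C, ← MvPolynomial.algebraMap_eq, AlgHom.commutes, MvPolynomial.algebraMap_eq,
      sym_C, map_smul]
  | add p q hp hq => simp only [map_add, LinearMap.add_apply, hp, hq]
  | mul_X p w hp =>
    rw [sym_mul_apply, sym_X, slotD_relabel, map_mul, sym_mul_apply, ← hp]
    congr 1
    rw [pull_X, map_sum, LinearMap.sum_apply, map_sum]
    refine Finset.sum_congr rfl fun i _ => ?_
    split_ifs
    · rw [sym_X]
    · simp

theorem pull_quad {n k l : ℕ} (f : Fin k → Fin l) (c : Fin l → Fin l → ℝ) :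
    pull n f (quad c) = quad fun i j => c (f i) (f j) := by
  have h : ∀ r s : Fin l, pull n f (om (row r) (row s)) =
      ∑ i, ∑ j, if f i = r ∧ f j = s then om (row i) (row j) else 0 := by
    intro r s
    rw [show pull n f (om (row r) (row s)) = (pull n f : Tens n l →+* Tens n k)
      (om (row r) (row s)) from rfl, map_om]
    change om (fun β => pull n f (row r β)) (fun β => pull n f (row s β)) = _
    rw [pull_row, pull_row, om_sum_left]
    refine Finset.sum_congr rfl fun i _ => ?_
    rw [om_sum_right]
    refine Finset.sum_congr rfl fun j _ => ?_
    by_cases h1 : f i = r <;> by_cases h2 : f j = s <;> simp [h1, h2, om]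
  have hC : ∀ a, pull n f (MvPolynomial.C a) = MvPolynomial.C a := fun a =>
    (pull n f).commutes a
  simp only [quad, map_sum, map_mul, hC, h, Finset.mul_sum]
  rw [← Finset.sum_product']
  simp only [← Finset.sum_product' (s := Finset.univ (α := Fin k)) (t := Finset.univ (α := Fin k))]
  rw [Finset.sum_comm]
  refine Finset.sum_congr rfl fun p _ => ?_
  rw [Finset.sum_eq_single (f p.1, f p.2)]
  · simp
  · rintro ⟨r, s⟩ _ hrs
    rw [if_neg, mul_zero]
    rintro ⟨h1, h2⟩
    exact hrs (Prod.ext h1.symm h2.symm)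
  · intro h; exact absurd (Finset.mem_univ _) h

theorem constantCoeff_relabel {n k l : ℕ} (f : Fin k → Fin l) (F : Tens n k) :
    MvPolynomial.constantCoeff (relabel n f F) = MvPolynomial.constantCoeff F :=
  MvPolynomial.constantCoeff_rename _ _

theorem J_relabel {n k l : ℕ} (f : Fin k → Fin l) (c : Fin l → Fin l → ℝ) (P : Tens n l)
    (F : Tens n k) :
    J c P (relabel n f F) = J (fun i j => c (f i) (f j)) (pull n f P) F := by
  rw [J, sym_relabel]
  have := locExp_intertwine (S := sym n l (quad c)) (M := (relabel n f).toLinearMap)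
    (locNilp_sym_quad fun i j => c (f i) (f j)) (fun x => by
      rw [← pull_quad f c]; exact sym_relabel f _ x) (sym n k (pull n f P) F)
  rw [AlgHom.toLinearMap_apply, AlgHom.toLinearMap_apply] at this
  rw [this, constantCoeff_relabel]
  rfl

/-- The matrix of the quadratic symbol `½ α_{rs}`. -/
def halfMat {k : ℕ} (r s : Fin k) : Fin k → Fin k → ℝ := fun i j =>
  (if i = r ∧ j = s then 1 / 2 else 0) - if i = s ∧ j = r then 1 / 2 else 0

theorem quad_halfMat {n k : ℕ} (r s : Fin k) :
    quad (n := n) (halfMat r s) = MvPolynomial.C (1 / 2) * om (row r) (row s) := by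
  -- Each entry `1/2` is halved once more in `quad`; the antisymmetry of `om` then adds the two
  -- quarters.
  have h : ∀ r s : Fin k, ∑ i, ∑ j, MvPolynomial.C
      (((if i = r ∧ j = s then 1 / 2 else 0 : ℝ) : ℂ) / 2) * om (row (n := n) i) (row j) =
        MvPolynomial.C (1 / 4) * om (row r) (row s) := by
    intro r s
    rw [Finset.sum_eq_single r, Finset.sum_eq_single s]
    · norm_num
    · intro j _ hj; simp [hj]
    · intro h; exact absurd (Finset.mem_univ _) h
    · intro j _ hj; simp [hj]
    · intro h; exact absurd (Finset.mem_univ _) h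
  simp only [quad, halfMat, Complex.ofReal_sub, sub_div, map_sub, sub_mul, Finset.sum_sub_distrib,
    h]
  rw [om_neg (row s), mul_neg, sub_neg_eq_add, ← add_mul, ← map_add]
  norm_num

theorem J_locExp_half {n k : ℕ} (c : Fin k → Fin k → ℝ) (P F : Tens n k) (r s : Fin k) :
    J c P (locExp ((1 / 2 : ℂ) • alpha r s) F) = J (c + halfMat r s) P F := by
  rw [J_add_quad, quad_halfMat, sym_C_mul, sym_om_row]

/-! ### Integration over simplices -/

/-- The fibres of the simplex under forgetting one coordinate are intervals: with the conventions
`u₀ = 0` and `1` at the far end, the neighbours of the inserted `t` are `Fin.cons 0 v i` on the left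
and `Fin.snoc v 1 i` on the right. -/
theorem insertNth_mem_openSimplex {m : ℕ} (i : Fin (m + 1)) (t : ℝ) (v : Fin m → ℝ) :
    (i.insertNth t v : Fin (m + 1) → ℝ) ∈ openSimplex (m + 1) ↔
      v ∈ openSimplex m ∧ (Fin.cons 0 v : Fin (m + 1) → ℝ) i < t ∧
        t < (Fin.snoc v 1 : Fin (m + 1) → ℝ) i := by
  constructor
  · rintro ⟨h1, h2⟩
    refine ⟨⟨fun a b hab => ?_, fun a => ?_⟩, ?_, ?_⟩
    · simpa using h1 ((Fin.strictMono_succAbove i) hab)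
    · simpa using h2 (i.succAbove a)
    · refine Fin.cases ?_ (fun j => ?_) i (motive := fun i =>
        StrictMono (i.insertNth t v : Fin (m + 1) → ℝ) →
        (∀ l, 0 < (i.insertNth t v : Fin (m + 1) → ℝ) l ∧
          (i.insertNth t v : Fin (m + 1) → ℝ) l < 1) →
          (Fin.cons 0 v : Fin (m + 1) → ℝ) i < t) h1 h2
      · intro _ h2
        simpa using (h2 0).1
      · intro h1 _
        have := h1 (Fin.castSucc_lt_succ (i := j))
        have e : j.succ.succAbove j = j.castSucc := Fin.succAbove_succ_self j
        rwa [Fin.insertNth_apply_same, ← e, Fin.insertNth_apply_succAbove] at this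
    · refine Fin.lastCases ?_ (fun j => ?_) i (motive := fun i =>
        StrictMono (i.insertNth t v : Fin (m + 1) → ℝ) →
        (∀ l, 0 < (i.insertNth t v : Fin (m + 1) → ℝ) l ∧
          (i.insertNth t v : Fin (m + 1) → ℝ) l < 1) →
          t < (Fin.snoc v 1 : Fin (m + 1) → ℝ) i) h1 h2
      · intro _ h2
        simpa using (h2 (Fin.last m)).2
      · intro h1 _
        have := h1 (Fin.castSucc_lt_succ (i := j))
        have e : j.castSucc.succAbove j = j.succ := Fin.succAbove_castSucc_self j
        rw [Fin.snoc_castSucc]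
        rwa [Fin.insertNth_apply_same, ← e, Fin.insertNth_apply_succAbove] at this
  · rintro ⟨⟨h1, h2⟩, h3, h4⟩
    have hlow : ∀ j : Fin m, j.castSucc < i → v j < t := by
      intro j hj
      refine lt_of_le_of_lt ?_ h3
      obtain ⟨i', rfl⟩ := Fin.eq_succ_of_ne_zero (Fin.ne_zero_of_lt hj)
      rw [Fin.cons_succ]
      exact h1.monotone (Fin.castSucc_lt_succ_iff.1 hj)
    have hhigh : ∀ j : Fin m, i ≤ j.castSucc → t < v j := by
      intro j hj
      refine lt_of_lt_of_le h4 ?_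
      obtain ⟨i', rfl⟩ := Fin.exists_castSucc_eq.2
        (lt_of_le_of_lt hj (Fin.castSucc_lt_last j)).ne
      rw [Fin.snoc_castSucc]
      exact h1.monotone (by simpa using hj)
    have h0 : 0 < t := by
      refine lt_of_le_of_lt ?_ h3
      refine Fin.cases ?_ (fun j => ?_) i
      · simp
      · simpa using (h2 j).1.le
    have h5 : t < 1 := by
      refine lt_of_lt_of_le h4 ?_
      refine Fin.lastCases ?_ (fun j => ?_) i
      · simp
      · simpa using (h2 j).2.le
    refine ⟨fun a b hab => ?_, fun a => ?_⟩
    · rcases Fin.eq_self_or_eq_succAbove i a with ha | ⟨a', ha⟩ <;>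
      rcases Fin.eq_self_or_eq_succAbove i b with hb | ⟨b', hb⟩ <;> rw [ha, hb] at hab ⊢
      · exact absurd hab (lt_irrefl _)
      · rw [Fin.insertNth_apply_same, Fin.insertNth_apply_succAbove]
        exact hhigh _ (Fin.lt_succAbove_iff_le_castSucc _ _ |>.1 hab)
      · rw [Fin.insertNth_apply_same, Fin.insertNth_apply_succAbove]
        exact hlow _ (Fin.succAbove_lt_iff_castSucc_lt _ _ |>.1 hab)
      · rw [Fin.insertNth_apply_succAbove, Fin.insertNth_apply_succAbove]
        exact h1 ((Fin.strictMono_succAbove i).lt_iff_lt.1 hab)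
    · rcases Fin.eq_self_or_eq_succAbove i a with rfl | ⟨a', rfl⟩
      · rw [Fin.insertNth_apply_same]; exact ⟨h0, h5⟩
      · rw [Fin.insertNth_apply_succAbove]; exact h2 a'

theorem integrableOn_openSimplex {m : ℕ} {f : (Fin m → ℝ) → ℂ} (hf : Continuous f) :
    MeasureTheory.IntegrableOn f (openSimplex m) := by
  refine (hf.continuousOn.integrableOn_compact
    (isCompact_univ_pi fun _ => isCompact_Icc (a := (0 : ℝ)) (b := 1))).mono_set ?_
  intro u hu i _
  exact ⟨(hu.2 i).1.le, (hu.2 i).2.le⟩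

theorem measurableSet_openSimplex (m : ℕ) : MeasurableSet (openSimplex m) := by
  have : openSimplex m = (⋂ i, ⋂ j, {u : Fin m → ℝ | i < j → u i < u j}) ∩
      ⋂ i, {u : Fin m → ℝ | 0 < u i ∧ u i < 1} := by
    ext u
    simp only [openSimplex, Set.mem_ofPred_eq, Set.mem_inter_iff, Set.mem_iInter, StrictMono]
  rw [this]
  refine (MeasurableSet.iInter fun i => MeasurableSet.iInter fun j => ?_).inter
    (MeasurableSet.iInter fun i => ?_)
  · by_cases h : i < j
    · simpa [h] using measurableSet_lt (measurable_pi_apply i) (measurable_pi_apply j)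
    · simp [h]
  · exact (measurableSet_lt measurable_const (measurable_pi_apply i)).inter
      (measurableSet_lt (measurable_pi_apply i) measurable_const)

/-- Integration of a partial derivative over the simplex. -/
theorem integral_openSimplex_deriv {m : ℕ} (i : Fin (m + 1)) (F F' : (Fin (m + 1) → ℝ) → ℂ)
    (hF' : Continuous F')
    (hF : ∀ v x, HasDerivAt (fun t : ℝ => F (i.insertNth t v)) (F' (i.insertNth x v)) x) :
    ∫ u in openSimplex (m + 1), F' u = ∫ v in openSimplex m,
      (F (i.insertNth ((Fin.snoc v 1 : Fin (m + 1) → ℝ) i) v) -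
        F (i.insertNth ((Fin.cons 0 v : Fin (m + 1) → ℝ) i) v)) := by
  -- Fubini with the `i`-th coordinate as inner variable, followed by the fundamental theorem of
  -- calculus on each fibre.
  let e := MeasurableEquiv.piFinSuccAbove (fun _ : Fin (m + 1) => ℝ) i
  have he : MeasureTheory.MeasurePreserving e.symm :=
    (MeasureTheory.volume_preserving_piFinSuccAbove (fun _ : Fin (m + 1) => ℝ) i).symm
  have hes : ∀ p : ℝ × (Fin m → ℝ), e.symm p = i.insertNth p.1 p.2 := fun p => rfl
  rw [← he.setIntegral_preimage_emb e.symm.measurableEmbedding]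
  have hms : MeasurableSet (e.symm ⁻¹' openSimplex (m + 1)) :=
    e.symm.measurable (measurableSet_openSimplex _)
  have hint : MeasureTheory.IntegrableOn (fun p => F' (e.symm p)) (e.symm ⁻¹' openSimplex (m + 1))
      (MeasureTheory.volume.prod MeasureTheory.volume) :=
    (he.integrableOn_comp_preimage e.symm.measurableEmbedding).2 (integrableOn_openSimplex hF')
  rw [← MeasureTheory.integral_indicator hms, MeasureTheory.Measure.volume_eq_prod,
    MeasureTheory.integral_prod_symm _ ((MeasureTheory.integrable_indicator_iff hms).2 hint),
    ← MeasureTheory.integral_indicator (measurableSet_openSimplex m)]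
  refine MeasureTheory.integral_congr_ae (Filter.Eventually.of_forall fun v => ?_)
  by_cases hv : v ∈ openSimplex m
  · rw [Set.indicator_of_mem hv]
    set lo := (Fin.cons 0 v : Fin (m + 1) → ℝ) i with hlo
    set hi := (Fin.snoc v 1 : Fin (m + 1) → ℝ) i with hhi
    have hle : lo ≤ hi := by
      rw [hlo, hhi]
      refine Fin.cases ?_ (fun j => ?_) i
      · refine Fin.lastCases ?_ (fun j => ?_) (0 : Fin (m + 1))
          (motive := fun x => (Fin.cons 0 v : Fin (m + 1) → ℝ) 0 ≤
            (Fin.snoc v 1 : Fin (m + 1) → ℝ) x)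
        · simp
        · simpa using (hv.2 j).1.le
      · rw [Fin.cons_succ]
        refine Fin.lastCases ?_ (fun l => ?_) j.succ
          (motive := fun x => j.succ = x → v j ≤ (Fin.snoc v 1 : Fin (m + 1) → ℝ) x) rfl
        · intro _; simpa using (hv.2 j).2.le
        · intro h
          rw [Fin.snoc_castSucc]
          refine hv.1.monotone ?_
          have := congrArg Fin.val h
          simp at this
          exact Fin.le_def.2 (by omega)
    have h1 : (fun t =>
        (e.symm ⁻¹' openSimplex (m + 1)).indicator (fun p => F' (e.symm p)) (t, v)) =
        (Set.Ioo lo hi).indicator fun t => F' (i.insertNth t v) := by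
      funext t
      have : (t, v) ∈ e.symm ⁻¹' openSimplex (m + 1) ↔ t ∈ Set.Ioo lo hi := by
        rw [Set.mem_preimage, hes, insertNth_mem_openSimplex]
        exact and_iff_right hv
      by_cases ht : t ∈ Set.Ioo lo hi
      · rw [Set.indicator_of_mem ht, Set.indicator_of_mem (this.2 ht), hes]
      · rw [Set.indicator_of_notMem ht, Set.indicator_of_notMem (fun h => ht (this.1 h))]
    have hcont : Continuous fun t : ℝ => F' (i.insertNth t v) :=
      hF'.comp (Continuous.finInsertNth (A := fun _ => ℝ) i continuous_id continuous_const)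
    dsimp only
    rw [h1, MeasureTheory.integral_indicator measurableSet_Ioo,
      ← MeasureTheory.integral_Ioc_eq_integral_Ioo, ← intervalIntegral.integral_of_le hle,
      intervalIntegral.integral_eq_sub_of_hasDerivAt (fun x _ => hF v x)
        (hcont.intervalIntegrable _ _)]
  · rw [Set.indicator_of_notMem hv]
    refine MeasureTheory.integral_eq_zero_of_ae (Filter.Eventually.of_forall fun t => ?_)
    refine Set.indicator_of_notMem (fun h => hv ?_) _
    rw [Set.mem_preimage, hes, insertNth_mem_openSimplex] at h
    exact h.1

/-- Together with `insertNth_succ_self`: the upper end of the fibre in one coordinate and the lower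
end of the fibre in the next one are the same wall, where the value `v j` is repeated. -/
theorem insertNth_castSucc_self {m : ℕ} {α : Type*} (v : Fin m → α) (j : Fin m) :
    (j.castSucc.insertNth (v j) v : Fin (m + 1) → α) = v ∘ j.predAbove := by
  rw [Fin.insertNth_eq_iff]
  refine ⟨by simp, funext fun l => ?_⟩
  simp [Fin.removeNth]

theorem insertNth_succ_self {m : ℕ} {α : Type*} (v : Fin m → α) (j : Fin m) :
    (j.succ.insertNth (v j) v : Fin (m + 1) → α) = v ∘ j.predAbove := by
  rw [Fin.insertNth_eq_iff]
  refine ⟨by simp, funext fun l => ?_⟩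
  rw [Fin.removeNth, Function.comp_apply]
  congr 1
  ext
  rcases lt_or_ge l.castSucc j.succ with h | h
  · rw [Fin.succAbove_of_castSucc_lt _ _ h, Fin.predAbove_castSucc_of_le _ _
      (Fin.castSucc_lt_succ_iff.1 h)]
  · rw [Fin.succAbove_of_le_castSucc _ _ h, Fin.predAbove_succ_of_le _ _
      (Fin.succ_le_castSucc_iff.1 h).le]

theorem continuous_insertNth_const {m : ℕ} (i : Fin (m + 1)) {f : (Fin m → ℝ) → ℝ}
    (hf : Continuous f) : Continuous fun v => (i.insertNth (f v) v : Fin (m + 1) → ℝ) :=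
  Continuous.finInsertNth (A := fun _ => ℝ) i hf continuous_id

/-- Stokes' theorem for the simplex, with the two contributions of each wall collected. -/
theorem sum_integral_openSimplex_deriv {m : ℕ} (F F' : Fin (m + 1) → (Fin (m + 1) → ℝ) → ℂ)
    (hFc : ∀ i, Continuous (F i)) (hF' : ∀ i, Continuous (F' i))
    (hF : ∀ i v x, HasDerivAt (fun t : ℝ => F i (i.insertNth t v)) (F' i (i.insertNth x v)) x) :
    ∑ i, ∫ u in openSimplex (m + 1), F' i u = ∫ v in openSimplex m,
      (F (Fin.last m) (Fin.snoc v 1) - F 0 (Fin.cons 0 v) +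
        ∑ j : Fin m, (F j.castSucc (v ∘ j.predAbove) - F j.succ (v ∘ j.predAbove))) := by
  have hlo : ∀ i : Fin (m + 1),
      Continuous fun v : Fin m → ℝ => (Fin.cons 0 v : Fin (m + 1) → ℝ) i := by
    intro i
    refine Fin.cases ?_ (fun i => ?_) i
    · simpa using continuous_const
    · simpa using continuous_apply i
  have hhi : ∀ i : Fin (m + 1),
      Continuous fun v : Fin m → ℝ => (Fin.snoc v 1 : Fin (m + 1) → ℝ) i := by
    intro i
    refine Fin.lastCases ?_ (fun i => ?_) i
    · simpa using continuous_const
    · simpa using continuous_apply i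
  rw [Finset.sum_congr rfl fun i _ => integral_openSimplex_deriv i (F i) (F' i) (hF' i) (hF i),
    ← MeasureTheory.integral_finsetSum]
  · refine MeasureTheory.integral_congr_ae (Filter.Eventually.of_forall fun v => ?_)
    dsimp only
    rw [Finset.sum_sub_distrib, Fin.sum_univ_castSucc, Fin.sum_univ_succ, Finset.sum_sub_distrib]
    simp only [Fin.snoc_castSucc, Fin.cons_succ, insertNth_castSucc_self, insertNth_succ_self,
      Fin.snoc_last, Fin.cons_zero, Fin.insertNth_last', Fin.insertNth_zero']
    ring
  · intro i _
    exact integrableOn_openSimplex (((hFc i).comp (continuous_insertNth_const i (hhi i))).sub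
      ((hFc i).comp (continuous_insertNth_const i (hlo i))))

/-! ### Tensors with a Moyal product in one slot -/

theorem slotD_prod_eq_zero {n k : ℕ} (s : Finset (Fin k)) (a : Fin k → Poly n) (i : Fin k)
    (h : i ∉ s) (β : Fin (2 * n)) :
    slotD i β (∏ j ∈ s, MvPolynomial.rename (Prod.mk j) (a j)) = 0 := by
  refine Finset.prod_induction (fun j => MvPolynomial.rename (Prod.mk j) (a j))
    (fun x => slotD i β x = 0) ?_ ?_ ?_
  · intro x y hx hy
    rw [slotD_apply] at hx hy ⊢
    rw [MvPolynomial.pderiv_mul, hx, hy, zero_mul, mul_zero, add_zero]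
  · exact MvPolynomial.pderiv_one
  · intro j hj
    exact slotD_rename_of_ne (fun e => h (by rwa [← e])) β _

/-- The operator `alpha r s` does not see the product `G` of the factors outside slots `r` and `s`.
So multiplication by `G` carries the two-factor exponential defining the Moyal product into the big
tensor power, and relabelling then multiplies slots `r` and `s` together. The hypotheses say that
`f` merges exactly these two slots into `t` and is bijective on the others. -/
theorem tens_merge {n k l : ℕ} (f : Fin k → Fin l) {r s : Fin k} (hrs : r ≠ s) {t : Fin l}
    (hr : f r = t) (hs : f s = t) (hne : ∀ i, i ≠ r → i ≠ s → f i ≠ t)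
    (hinj : ∀ i j, i ≠ r → i ≠ s → j ≠ r → j ≠ s → f i = f j → i = j)
    (hsurj : ∀ j, j ≠ t → ∃ i, i ≠ r ∧ i ≠ s ∧ f i = j) (a : Fin k → Poly n) (b : Fin l → Poly n)
    (hb : ∀ i, i ≠ r → i ≠ s → b (f i) = a i) (hbt : b t = moyal (a r) (a s)) :
    tens n l b = relabel n f (locExp ((1 / 2 : ℂ) • alpha r s) (tens n k a)) := by
  set A : Finset (Fin k) := (Finset.univ.erase r).erase s with hA
  have memA : ∀ i, i ∈ A ↔ i ≠ r ∧ i ≠ s := by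
    intro i; simp [hA, and_comm]
  set G : Tens n k := ∏ i ∈ A, MvPolynomial.rename (Prod.mk i) (a i) with hG
  let M : Tens n 2 →ₗ[ℂ] Tens n k := (LinearMap.mulLeft ℂ G).comp (relabel n ![r, s]).toLinearMap
  have hM : ∀ x, M x = G * relabel n ![r, s] x := fun x => rfl
  have hr0 : ∀ β x, slotD r β (M x) = M (slotD 0 β x) := by
    intro β x
    have h1 := slotD_relabel ![r, s] r β x
    have h2 := slotD_prod_eq_zero A a r (by simp [memA]) β
    rw [Fin.sum_univ_two] at h1
    simp only [Matrix.cons_val_zero, Matrix.cons_val_one, if_true, hrs.symm, if_false,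
      add_zero] at h1
    rw [hM, hM, ← h1, slotD_apply, slotD_apply, MvPolynomial.pderiv_mul, hG]
    rw [slotD_apply] at h2
    rw [h2, zero_mul, zero_add]
  have hs0 : ∀ β x, slotD s β (M x) = M (slotD 1 β x) := by
    intro β x
    have h1 := slotD_relabel ![r, s] s β x
    have h2 := slotD_prod_eq_zero A a s (by simp [memA]) β
    rw [Fin.sum_univ_two] at h1
    simp only [Matrix.cons_val_zero, Matrix.cons_val_one, if_true, hrs, if_false, zero_add] at h1
    rw [hM, hM, ← h1, slotD_apply, slotD_apply, MvPolynomial.pderiv_mul, hG]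
    rw [slotD_apply] at h2
    rw [h2, zero_mul, zero_add]
  have hα : ∀ x, ((1 / 2 : ℂ) • alpha (n := n) r s) (M x) =
      M (((1 / 2 : ℂ) • alpha (n := n) (0 : Fin 2) 1) x) := by
    intro x
    rw [LinearMap.smul_apply, LinearMap.smul_apply, map_smul]
    congr 1
    simp only [alpha, LinearMap.sum_apply, LinearMap.sub_apply, Module.End.mul_apply, hr0, hs0,
      map_sum, map_sub]
  have hta : tens n k a = M (tens n 2 ![a r, a s]) := by
    rw [hM, tens_apply, tens_apply, Fin.prod_univ_two, map_mul, relabel_rename, relabel_rename,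
      ← Finset.mul_prod_erase _ _ (Finset.mem_univ r),
      ← Finset.mul_prod_erase (Finset.univ.erase r) _
        (Finset.mem_erase.2 ⟨hrs.symm, Finset.mem_univ s⟩)]
    simp only [Matrix.cons_val_zero, Matrix.cons_val_one]
    rw [hG, hA]
    ring
  have hf : f ∘ ![r, s] = fun _ => t := by
    funext i; fin_cases i
    · exact hr
    · exact hs
  rw [hta, locExp_intertwine (lowers_half_alpha _ _ _).locNilp hα, hM, map_mul, relabel_relabel,
    hf, ← rename_mulSlots, hG, map_prod]
  change _ = _ * MvPolynomial.rename (Prod.mk t) (moyal (a r) (a s))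
  rw [← hbt, tens_apply, ← Finset.mul_prod_erase _ _ (Finset.mem_univ t)]
  refine (mul_comm _ _).trans ?_
  congr 1
  refine (Finset.prod_bij (fun i _ => f i) ?_ ?_ ?_ ?_).symm
  · intro i hi
    exact Finset.mem_erase.2 ⟨hne i ((memA i).1 hi).1 ((memA i).1 hi).2, Finset.mem_univ _⟩
  · intro i hi j hj h
    exact hinj i j ((memA i).1 hi).1 ((memA i).1 hi).2 ((memA j).1 hj).1 ((memA j).1 hj).2 h
  · intro j hj
    obtain ⟨i, h1, h2, h3⟩ := hsurj j (Finset.mem_erase.1 hj).1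
    exact ⟨i, (memA i).2 ⟨h1, h2⟩, h3⟩
  · intro i hi
    rw [relabel_rename, hb i ((memA i).1 hi).1 ((memA i).1 hi).2]

/-- The pure tensor of a tuple of elements of the Weyl algebra. -/
def wt {n k : ℕ} (a : Fin k → Weyl n) : Tens n k := tens n k fun i => Weyl.toPoly (a i)

theorem wt_innerFace {n k : ℕ} (j : Fin (k + 1)) (a : Fin (k + 2) → Weyl n) :
    wt (innerFace j a) = relabel n j.predAbove
      (locExp ((1 / 2 : ℂ) • alpha j.castSucc j.succ) (wt a)) := by
  have hlow : ∀ i : Fin (k + 2), (i : ℕ) < j → (j.predAbove i : ℕ) = i := by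
    intro i hi
    rw [Fin.predAbove_of_le_castSucc _ _ (Fin.le_def.2 (by simpa using hi.le))]; rfl
  have hhigh : ∀ i : Fin (k + 2), (j : ℕ) + 1 < i → (j.predAbove i : ℕ) = i - 1 := by
    intro i hi
    rw [Fin.predAbove_of_castSucc_lt _ _ (Fin.lt_def.2 (by simp; omega))]; rfl
  have hcase : ∀ i : Fin (k + 2), i ≠ j.castSucc → i ≠ j.succ →
      ((i : ℕ) < j ∧ (j.predAbove i : ℕ) = i) ∨
      ((j : ℕ) + 1 < i ∧ (j.predAbove i : ℕ) = i - 1) := by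
    intro i h1 h2
    have h1' : (i : ℕ) ≠ j := fun h => h1 (Fin.ext h)
    have h2' : (i : ℕ) ≠ j + 1 := fun h => h2 (Fin.ext h)
    rcases lt_or_gt_of_ne h1' with h | h
    · exact Or.inl ⟨h, hlow i h⟩
    · exact Or.inr ⟨by omega, hhigh i (by omega)⟩
  -- Slots `j` and `j + 1` merge into slot `j`; earlier slots keep their index and later ones move
  -- down by one.
  refine tens_merge j.predAbove (t := j) (Fin.castSucc_lt_succ).ne (by simp) (by simp) ?_ ?_ ?_ _ _
    ?_ ?_
  · intro i h1 h2 h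
    have := congrArg Fin.val h
    rcases hcase i h1 h2 with ⟨h3, h4⟩ | ⟨h3, h4⟩ <;> omega
  · intro i i' h1 h2 h1' h2' h
    have := congrArg Fin.val h
    ext
    rcases hcase i h1 h2 with ⟨h3, h4⟩ | ⟨h3, h4⟩ <;>
    rcases hcase i' h1' h2' with ⟨h5, h6⟩ | ⟨h5, h6⟩ <;> omega
  · intro l hl
    have hl' : (l : ℕ) ≠ j := fun h => hl (Fin.ext h)
    rcases lt_or_gt_of_ne hl' with h | h
    · exact ⟨l.castSucc, fun e => hl' (by simpa using congrArg Fin.val e),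
        fun e => absurd (congrArg Fin.val e) (by simp; omega), Fin.ext (hlow _ (by simpa using h))⟩
    · exact ⟨l.succ, fun e => absurd (congrArg Fin.val e) (by simp; omega),
        fun e => hl' (by simpa using congrArg Fin.val e),
        Fin.ext ((hhigh _ (by simpa using h)).trans (by simp))⟩
  · intro i h1 h2
    congr 1
    rw [innerFace_apply]
    rcases hcase i h1 h2 with ⟨h3, h4⟩ | ⟨h3, h4⟩
    · rw [if_pos (by omega)]; congr 1; exact Fin.ext (by simpa using h4)
    · rw [if_neg (by omega), if_neg (by omega)]; congr 1; exact Fin.ext (by simp [h4]; omega)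
  · rw [innerFace_apply, if_neg (lt_irrefl _), if_pos rfl, Weyl.toPoly_mul]

/-- The map merging the last slot with the first one. -/
def wrap (k : ℕ) : Fin (k + 2) → Fin (k + 1) := Fin.snoc id 0

theorem wrap_castSucc {k : ℕ} (i : Fin (k + 1)) : wrap k i.castSucc = i := by
  simp [wrap]

theorem wrap_last (k : ℕ) : wrap k (Fin.last (k + 1)) = 0 := by
  simp [wrap]

theorem wt_lastFace {n k : ℕ} (a : Fin (k + 2) → Weyl n) :
    wt (lastFace a) = relabel n (wrap k)
      (locExp ((1 / 2 : ℂ) • alpha (Fin.last (k + 1)) 0) (wt a)) := by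
  have hcase : ∀ i : Fin (k + 2), i ≠ Fin.last (k + 1) → i ≠ 0 →
      ∃ i' : Fin (k + 1), i = i'.castSucc ∧ i' ≠ 0 := by
    intro i h1 h2
    obtain ⟨i', rfl⟩ := Fin.exists_castSucc_eq.2 h1
    exact ⟨i', rfl, fun h => h2 (by rw [h]; rfl)⟩
  refine tens_merge (wrap k) (t := 0) (Fin.last_pos).ne' (wrap_last k) (wrap_castSucc 0) ?_ ?_ ?_
    _ _ ?_ ?_
  · intro i h1 h2
    obtain ⟨i', rfl, h⟩ := hcase i h1 h2
    rwa [wrap_castSucc]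
  · intro i j h1 h2 h3 h4 h
    obtain ⟨i', rfl, _⟩ := hcase i h1 h2
    obtain ⟨j', rfl, _⟩ := hcase j h3 h4
    rw [wrap_castSucc, wrap_castSucc] at h
    rw [h]
  · intro j hj
    exact ⟨j.castSucc, (Fin.castSucc_lt_last j).ne, fun h => hj (Fin.castSucc_eq_zero_iff.1 h),
      wrap_castSucc j⟩
  · intro i h1 h2
    obtain ⟨i', rfl, h⟩ := hcase i h1 h2
    rw [wrap_castSucc, lastFace, Function.update_of_ne h]
  · rw [lastFace, Function.update_self, Weyl.toPoly_mul]

/-! ### The Bernoulli function on the circle -/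

/-- The matrix of the values of the Bernoulli polynomial `t - 1/2` at differences of points on the
circle. -/
def bern {k : ℕ} (u : Fin k → ℝ) : Fin k → Fin k → ℝ := fun i j =>
  u i - u j - if j < i then 1 / 2 else if i < j then - (1 / 2) else 0

theorem continuous_bern (k : ℕ) : Continuous (bern (k := k)) := by
  refine continuous_pi fun i => continuous_pi fun j => ?_
  exact ((continuous_apply i).sub (continuous_apply j)).sub continuous_const

theorem alpha_antisymm {n k : ℕ} (r s : Fin k) : alpha (n := n) r s = - alpha s r := by
  rw [← sym_om_row, om_neg, map_neg, sym_om_row]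

/-- `quad` sums over ordered pairs with weight `1/2`. Since `bern` and `alpha` are both
antisymmetric, the two orderings of a pair contribute equally. -/
theorem exponent_eq (n : ℕ) (u : Fin (2 * n) → ℝ) :
    exponent n u = sym n _ (quad (bern (Fin.cons 0 u))) := by
  rw [sym_quad, exponent]
  set w : Fin (2 * n + 1) → ℝ := Fin.cons 0 u
  have h1 : ∀ i j : Fin (2 * n + 1), (bern w i j / 2 : ℂ) • alpha (n := n) i j =
      (if j < i then ((w i - w j - 1 / 2 : ℝ) / 2 : ℂ) • alpha i j else 0) +
      (if i < j then ((w j - w i - 1 / 2 : ℝ) / 2 : ℂ) • alpha j i else 0) := by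
    intro i j
    rcases lt_trichotomy i j with h | rfl | h
    · rw [if_neg h.not_gt, if_pos h, zero_add, bern, if_neg h.not_gt, if_pos h, alpha_antisymm i j,
        smul_neg, ← neg_smul]
      congr 1
      push_cast
      ring
    · simp [bern]
    · rw [if_neg h.not_gt, if_pos h, add_zero, bern, if_pos h]
  simp only [h1, Finset.sum_add_distrib]
  rw [Finset.sum_comm]
  rw [← Finset.sum_add_distrib]
  refine Finset.sum_congr rfl fun i _ => ?_
  rw [← Finset.sum_add_distrib, ← Finset.sum_filter_add_sum_filter_not Finset.univ (fun j => i < j)]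
  rw [Finset.sum_eq_zero (s := {x | ¬ i < x}), add_zero]
  · refine Finset.sum_congr ?_ fun j hj => ?_
    · ext; simp
    · have hj' : i < j := by simpa using hj
      rw [if_pos hj', ← add_smul]
      congr 1
      push_cast
      ring
  · intro j hj
    have hj' : ¬ i < j := by simpa using hj
    rw [if_neg hj', add_zero]

theorem piOp_eq (n : ℕ) : piOp n = sym n _
    (Matrix.detRowAlternating fun i : Fin (2 * n) => row (n := n) i.succ) := by
  rw [Matrix.detRowAlternating, piOp]
  change _ = sym n _ (Matrix.det (Matrix.of fun i : Fin (2 * n) => row (n := n) i.succ))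
  -- In `piOp` the permutation acts on the column index of slot `i`, hence the transpose.
  rw [← Matrix.det_transpose, Matrix.det_apply, map_sum]
  refine Finset.sum_congr rfl fun σ _ => ?_
  have : sym n _ (∏ i : Fin (2 * n), row (n := n) i.succ (σ i)) =
      (List.ofFn fun i : Fin (2 * n) => slotD (n := n) i.succ (σ i)).prod := by
    rw [← List.prod_ofFn, map_list_prod, List.map_ofFn]
    congr 2
    funext i
    exact sym_X _
  rw [← this, Units.smul_def, map_zsmul]
  exact Int.cast_smul_eq_zsmul ℂ _ (sym n _ (∏ i : Fin (2 * n), row (n := n) i.succ (σ i)))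

/-! ### Cochains attached to alternating forms -/

/-- An alternating `k`-form in `2n` variables, defined over all commutative rings compatibly with
ring homomorphisms. -/
structure NForm (n k : ℕ) where
  /-- The form over a given commutative ring. -/
  form : ∀ (S : Type) [CommRing S], (Fin (2 * n) → S) [⋀^Fin k]→ₗ[S] S
  map_form : ∀ {S S' : Type} [CommRing S] [CommRing S'] (f : S →+* S')
    (v : Fin k → Fin (2 * n) → S), f (form S v) = form S' fun i β => f (v i β)

/-- The matrix of the exponent for the points `0, u₁, …, u_k` on the circle. -/
def circ {k : ℕ} (u : Fin k → ℝ) : Fin (k + 1) → Fin (k + 1) → ℝ := bern (Fin.cons 0 u)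

/-- The cochain `φ` is given by integration over the simplex of the exponential of `circ`, applied
to the differential operator given by the alternating form `ψ`. -/
def Rep {n k : ℕ} (ψ : NForm n k) (φ : Cochain (Weyl n) k) : Prop :=
  ∀ a : Fin (k + 1) → Weyl n, φ.1 a =
    ∫ u in openSimplex k, J (circ u) (ψ.form _ fun i => row i.succ) (wt a)

/-- The determinant, as a form. -/
def volForm (n : ℕ) : NForm n (2 * n) where
  form _ _ := Matrix.detRowAlternating
  map_form f v := RingHom.map_det f v

theorem rep_tau (n : ℕ) : Rep (volForm n) (tau n) := by
  intro a
  change simplexFunctional n (piOp n (wt a)) = _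
  refine MeasureTheory.integral_congr_ae (Filter.Eventually.of_forall fun u => ?_)
  dsimp only
  rw [integrand, exponent_eq, piOp_eq]
  rfl

theorem continuous_circ (k : ℕ) : Continuous (circ (k := k)) := by
  refine (continuous_bern _).comp (continuous_pi fun i => ?_)
  refine Fin.cases ?_ (fun i => ?_) i
  · simpa using continuous_const
  · simpa using continuous_apply i

theorem continuous_J_circ {n k : ℕ} (P F : Tens n (k + 1)) :
    Continuous fun u : Fin k → ℝ => J (circ u) P F :=
  (continuous_J P F).comp (continuous_circ k)

/-- This is why forms are defined over all rings at once: substitutions in the symbol become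
naturality along ring homomorphisms. -/
theorem NForm.pull_form {n k l m : ℕ} (ψ : NForm n k) (f : Fin l → Fin m)
    (v : Fin k → Fin (2 * n) → Tens n m) :
    pull n f (ψ.form _ v) = ψ.form _ fun i β => pull n f (v i β) :=
  ψ.map_form (pull n f : Tens n m →+* Tens n l) v

/-! ### The Hochschild differential as a boundary integral -/

/-- The derivative of `bern` with respect to the position of the `p`-th point. -/
def dmat {k : ℕ} (p : Fin k) : Fin k → Fin k → ℝ := fun a b =>
  (if a = p then 1 else 0) - if b = p then 1 else 0

/-- Moving point `p` changes its difference to every other point at the same rate, so `row p` is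
paired with the sum of all rows; including `j = p` is harmless because `om` is alternating. -/
theorem quad_dmat {n k : ℕ} (p : Fin k) :
    quad (n := n) (dmat p) = om (row p) (∑ j, row j) := by
  have h1 : ∀ a b : Fin k, MvPolynomial.C ((dmat p a b : ℂ) / 2) * om (row (n := n) a) (row b) =
      (if a = p then MvPolynomial.C (1 / 2) * om (row a) (row b) else 0) -
      (if b = p then MvPolynomial.C (1 / 2) * om (row a) (row b) else 0) := by
    intro a b
    by_cases ha : a = p <;> by_cases hb : b = p <;> simp [dmat, ha, hb, neg_div]
  simp only [quad, h1, Finset.sum_sub_distrib, Finset.sum_ite_eq', Finset.mem_univ, if_true]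
  rw [Finset.sum_comm]
  simp only [Finset.sum_ite_eq', Finset.mem_univ, if_true, ← Finset.mul_sum]
  rw [← om_sum_right, ← om_sum_left, om_neg (∑ i, row i), mul_neg, sub_neg_eq_add, ← add_mul,
    ← map_add]
  norm_num

theorem bern_affine {k : ℕ} (w : ℝ → Fin k → ℝ) (p : Fin k) (x : ℝ)
    (hw : ∀ t a, w t a = (if a = p then t - x else 0) + w x a) (t : ℝ) :
    bern (w t) = (t - x) • dmat p + bern (w x) := by
  funext a b
  simp only [bern, hw t a, hw t b, dmat, Pi.add_apply, Pi.smul_apply, smul_eq_mul, mul_sub,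
    mul_ite, mul_one, mul_zero]
  ring

theorem insertNth_affine {k : ℕ} (i : Fin (k + 1)) (v : Fin k → ℝ) (x t : ℝ) (a : Fin (k + 1)) :
    (i.insertNth t v : Fin (k + 1) → ℝ) a =
      (if a = i then t - x else 0) + (i.insertNth x v : Fin (k + 1) → ℝ) a := by
  rcases Fin.eq_self_or_eq_succAbove i a with rfl | ⟨a', rfl⟩
  · simp
  · simp [Fin.succAbove_ne]

theorem hasDerivAt_J_circ {n k : ℕ} (P F : Tens n (k + 2)) (i : Fin (k + 1)) (v : Fin k → ℝ)
    (x : ℝ) : HasDerivAt (fun t : ℝ => J (circ (i.insertNth t v)) P F)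
      (J (circ (i.insertNth x v)) (om (row i.succ) (∑ j, row j) * P) F) x := by
  rw [← quad_dmat]
  refine hasDerivAt_J P F (fun t => circ (i.insertNth t v)) _ x fun t => ?_
  refine bern_affine (fun t => Fin.cons 0 (i.insertNth t v)) i.succ x (fun t a => ?_) t
  refine Fin.cases ?_ (fun a => ?_) a
  · simp [(Fin.succ_ne_zero i).symm]
  · simpa using insertNth_affine i v x t a

theorem bern_comp_strictMono {k l : ℕ} (w : Fin l → ℝ) {f : Fin k → Fin l} (hf : StrictMono f) :
    (fun i j => bern w (f i) (f j)) = bern (w ∘ f) := by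
  funext i j
  simp [bern, hf.lt_iff_lt]

/-- The jump in `bern` depends on the order of the indices and not on the values. Hence two points
at the same place still have the one-sided limit `±1/2`, which is the coefficient in the Moyal
exponential. -/
theorem bern_predAbove {k : ℕ} (w : Fin (k + 1) → ℝ) (p : Fin (k + 1)) :
    (fun i j => bern w (p.predAbove i) (p.predAbove j)) + halfMat p.castSucc p.succ =
      bern (w ∘ p.predAbove) := by
  have key : ∀ i : Fin (k + 2), (p.predAbove i : ℕ) = if (i : ℕ) ≤ p then (i : ℕ) else i - 1 := by
    intro i
    split_ifs with h
    · rw [Fin.predAbove_of_le_castSucc _ _ (Fin.le_def.2 (by simpa using h))]; rfl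
    · rw [Fin.predAbove_of_castSucc_lt _ _ (Fin.lt_def.2 (by simpa using h))]; rfl
  funext i j
  simp only [Pi.add_apply, bern, halfMat, Function.comp_apply, Fin.lt_def, key, Fin.ext_iff,
    Fin.val_castSucc, Fin.val_succ]
  split_ifs <;> first | omega | (norm_num; done) | ring

/-- The collision across the base point of the circle: the last point at `1` meets the point at `0`
from the other side, and `1 - 0 - 1/2 = 1/2`. -/
theorem bern_wrap {k : ℕ} (w : Fin (k + 1) → ℝ) (h0 : w 0 = 0) :
    (fun i j => bern w (wrap k i) (wrap k j)) + halfMat (Fin.last (k + 1)) 0 =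
      bern (Fin.snoc w 1 : Fin (k + 2) → ℝ) := by
  funext i j
  have hz' : ∀ a : Fin (k + 1), a.castSucc = (0 : Fin (k + 2)) ↔ a = 0 := fun a => by
    rw [← Fin.castSucc_zero, Fin.castSucc_inj]
  have hl : ∀ a : Fin (k + 1), Fin.last (k + 1) ≠ a.castSucc := fun a =>
    (Fin.castSucc_lt_last a).ne'
  have hl' : ∀ a : Fin (k + 1), ¬ Fin.last (k + 1) < a.castSucc := fun a =>
    (Fin.castSucc_lt_last a).not_gt
  have hp : ∀ a : Fin (k + 1), a ≠ 0 → 0 < a := fun a h => Fin.pos_iff_ne_zero.2 h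
  refine Fin.lastCases ?_ (fun i => ?_) i <;> refine Fin.lastCases ?_ (fun j => ?_) j
  · simp [bern, halfMat]
  · simp only [Pi.add_apply, wrap_last, wrap_castSucc, bern, halfMat, Fin.snoc_last,
      Fin.snoc_castSucc, Fin.castSucc_lt_last, hl', hz', if_true, true_and, if_false, h0]
    by_cases hj : j = 0
    · subst hj; simp [h0]; norm_num
    · simp [hj, hp j hj]; ring
  · simp only [Pi.add_apply, wrap_last, wrap_castSucc, bern, halfMat, Fin.snoc_last,
      Fin.snoc_castSucc, Fin.castSucc_lt_last, hl', hz', if_true, and_true, if_false, h0]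
    by_cases hi : i = 0
    · subst hi; simp [h0]; norm_num
    · simp [hi, hp i hi]; ring
  · simp [bern, halfMat, (hl _).symm, wrap_castSucc]

theorem pull_row_predAbove {n k : ℕ} (p l : Fin (k + 1)) :
    (fun β => pull n p.predAbove (row l β)) =
      (if p = l then row p.castSucc else 0) + row (p.castSucc.succAbove l) := by
  rw [pull_row, Fin.sum_univ_succAbove _ p.castSucc]
  simp

theorem pull_row_wrap {n k : ℕ} (l : Fin k) :
    (fun β => pull n (wrap k) (row l.succ β)) = row l.succ.castSucc := by
  rw [pull_row, Fin.sum_univ_castSucc]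
  simp [wrap_castSucc, wrap_last, (Fin.succ_ne_zero l).symm]

theorem J_wt_innerFace {n k : ℕ} (w : Fin (k + 1) → ℝ) (P : Tens n (k + 1)) (j : Fin (k + 1))
    (a : Fin (k + 2) → Weyl n) : J (bern w) P (wt (innerFace j a)) =
      J (bern (w ∘ j.predAbove)) (pull n j.predAbove P) (wt a) := by
  rw [wt_innerFace, J_relabel, J_locExp_half, bern_predAbove]

theorem J_wt_lastFace {n k : ℕ} (w : Fin (k + 1) → ℝ) (h0 : w 0 = 0) (P : Tens n (k + 1))
    (a : Fin (k + 2) → Weyl n) : J (bern w) P (wt (lastFace a)) =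
      J (bern (Fin.snoc w 1 : Fin (k + 2) → ℝ)) (pull n (wrap k) P) (wt a) := by
  rw [wt_lastFace, J_relabel, J_locExp_half, bern_wrap w h0]

/-- The exterior product of the one-form `om · t` with `ψ`. -/
def NForm.wedge {n k : ℕ} (ψ : NForm n k) {S : Type} [CommRing S] (t : Fin (2 * n) → S)
    (v : Fin (k + 1) → Fin (2 * n) → S) : S :=
  ∑ i : Fin (k + 1), (-1) ^ (i : ℕ) * (om (v i) t * ψ.form S fun l => v (i.succAbove l))

theorem cons_predAbove_succ {k : ℕ} (v : Fin k → ℝ) (j : Fin k) :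
    (Fin.cons 0 v : Fin (k + 1) → ℝ) ∘ j.succ.predAbove = Fin.cons 0 (v ∘ j.predAbove) := by
  funext i
  refine Fin.cases ?_ (fun i => ?_) i
  · simp
  · simp [Fin.succ_predAbove_succ]

theorem cons_predAbove_zero {k : ℕ} (v : Fin k → ℝ) :
    (Fin.cons 0 v : Fin (k + 1) → ℝ) ∘ (0 : Fin (k + 1)).predAbove = Fin.cons 0 (Fin.cons 0 v) := by
  funext i
  refine Fin.cases ?_ (fun i => ?_) i
  · simp
  · simp

/-- Stokes' theorem for the symbols `M i`, the form on all rows but `row i.succ`, with signs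
`(-1)^i`. The derivative in `u_i` multiplies `M i` by `om (row i.succ) t`, which builds the exterior
product. The boundary terms are the faces: the ends `0` and `1` give the first and the last face,
and each inner wall gives an inner face. -/
theorem Rep.hochD {n k : ℕ} {ψ : NForm n k} {φ : Cochain (Weyl n) k} (h : Rep ψ φ)
    (a : Fin (k + 2) → Weyl n) : (hochD k φ).1 a = - ∫ u in openSimplex (k + 1),
      J (circ u) (ψ.wedge (∑ j, row j) fun i => row i.succ) (wt a) := by
  let M : Fin (k + 1) → Tens n (k + 2) := fun i => ψ.form _ fun l => row (i.succAbove l).succ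
  have hst := sum_integral_openSimplex_deriv
    (fun (i : Fin (k + 1)) u => (-1) ^ (i : ℕ) * J (circ u) (M i) (wt a))
    (fun i u => (-1) ^ (i : ℕ) * J (circ u) (om (row i.succ) (∑ j, row j) * M i) (wt a))
    (fun i => continuous_const.mul (continuous_J_circ _ _))
    (fun i => continuous_const.mul (continuous_J_circ _ _))
    (fun i v x => (hasDerivAt_J_circ _ _ i v x).const_mul _)
  have hC : ∀ m : ℕ, ((-1) ^ m : Tens n (k + 2)) = MvPolynomial.C ((-1) ^ m) := fun m => by simp
  have hL : ∫ u in openSimplex (k + 1),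
      J (circ u) (ψ.wedge (∑ j, row j) fun i => row i.succ) (wt a) =
      ∑ i : Fin (k + 1), ∫ u in openSimplex (k + 1),
        (-1) ^ (i : ℕ) * J (circ u) (om (row i.succ) (∑ j, row j) * M i) (wt a) := by
    rw [← MeasureTheory.integral_finsetSum]
    · refine MeasureTheory.integral_congr_ae (Filter.Eventually.of_forall fun u => ?_)
      simp only [NForm.wedge, J_sum, hC, J_C_mul, M]
    · exact fun i _ => integrableOn_openSimplex (continuous_const.mul (continuous_J_circ _ _))
  have h0 : φ.1 (innerFace 0 a) = ∫ v in openSimplex k, J (circ (Fin.cons 0 v)) (M 0) (wt a) := by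
    rw [h]
    refine MeasureTheory.integral_congr_ae (Filter.Eventually.of_forall fun v => ?_)
    simp only [circ, J_wt_innerFace, cons_predAbove_zero, NForm.pull_form]
    have e : (fun (i : Fin k) β => pull n (0 : Fin (k + 1)).predAbove (row i.succ β)) =
        fun i => row ((0 : Fin (k + 1)).succAbove i).succ := funext fun i => by
      rw [pull_row_predAbove, if_neg (Fin.succ_ne_zero i).symm]
      simp
    rw [e]
  have hl : φ.1 (lastFace a) =
      ∫ v in openSimplex k, J (circ (Fin.snoc v 1)) (M (Fin.last k)) (wt a) := by
    rw [h]
    refine MeasureTheory.integral_congr_ae (Filter.Eventually.of_forall fun v => ?_)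
    simp only [circ, J_wt_lastFace (Fin.cons 0 v) rfl, NForm.pull_form]
    have e : (fun (i : Fin k) β => pull n (wrap k) (row i.succ β)) =
        fun i => row ((Fin.last k).succAbove i).succ := funext fun i => by
      rw [pull_row_wrap]
      simp
    rw [Fin.cons_snoc_eq_snoc_cons, e]
  have hj : ∀ j : Fin k, φ.1 (innerFace j.succ a) = ∫ v in openSimplex k,
      (J (circ (v ∘ j.predAbove)) (M j.castSucc) (wt a) +
        J (circ (v ∘ j.predAbove)) (M j.succ) (wt a)) := by
    intro j
    rw [h]
    refine MeasureTheory.integral_congr_ae (Filter.Eventually.of_forall fun v => ?_)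
    simp only [circ, J_wt_innerFace, cons_predAbove_succ, NForm.pull_form]
    rw [← J_add_left]
    congr 1
    -- On an inner wall the row of the merged slot is the sum of two rows. By multilinearity the
    -- form splits into the symbols with one or the other row omitted, which are the two
    -- contributions to this wall in Stokes' theorem.
    have e1 : (fun (i : Fin k) β => pull n j.succ.predAbove (row i.succ β)) =
        Function.update (fun l => row (j.castSucc.succAbove l).succ) j
          (row j.succ.succ + row j.castSucc.succ) := by
      funext l
      rw [pull_row_predAbove]
      by_cases hl : l = j
      · subst hl
        rw [Function.update_self, if_pos rfl, Fin.succAbove_castSucc_self]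
        exact add_comm _ _
      · rw [Function.update_of_ne hl, if_neg (fun e => hl (Fin.succ_injective _ e).symm), zero_add,
          ← Fin.succ_castSucc, Fin.succ_succAbove_succ]
    have e2 : Function.update (fun l => row (n := n) (j.castSucc.succAbove l).succ) j
        (row j.succ.succ) = fun l => row (j.castSucc.succAbove l).succ := by
      rw [Function.update_eq_self_iff, Fin.succAbove_castSucc_self]
    have e3 : Function.update (fun l => row (n := n) (j.castSucc.succAbove l).succ) j
        (row j.castSucc.succ) = fun l => row (j.succ.succAbove l).succ := by
      funext l
      by_cases hl : l = j
      · subst hl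
        rw [Function.update_self, Fin.succAbove_succ_self]
      · rw [Function.update_of_ne hl]
        congr 2
        rcases lt_or_gt_of_ne hl with h | h
        · rw [Fin.succAbove_of_castSucc_lt _ _ (Fin.castSucc_lt_castSucc_iff.2 h),
            Fin.succAbove_of_castSucc_lt _ _ (Fin.castSucc_lt_succ_iff.2 h.le)]
        · rw [Fin.succAbove_of_le_castSucc _ _ (Fin.castSucc_le_castSucc_iff.2 h.le),
            Fin.succAbove_of_le_castSucc _ _ (Fin.succ_le_castSucc_iff.2 h)]
    rw [e1, AlternatingMap.map_update_add, e2, e3]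
  rw [hL, hst]
  change preD k φ.1 a = _
  rw [preD_apply, Fin.sum_univ_succ, h0, hl]
  simp only [hj]
  have hint : ∀ (c : ℂ) (f : (Fin k → ℝ) → Fin (k + 1) → ℝ) (P : Tens n (k + 2)), Continuous f →
      MeasureTheory.Integrable (fun v => c * J (circ (f v)) P (wt a))
        (MeasureTheory.volume.restrict (openSimplex k)) := fun c f P hf =>
    integrableOn_openSimplex (continuous_const.mul ((continuous_J_circ P _).comp hf))
  have c0 : Continuous fun v : Fin k → ℝ => (Fin.cons 0 v : Fin (k + 1) → ℝ) := by
    refine continuous_pi fun i => Fin.cases ?_ (fun i => ?_) i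
    · simpa using continuous_const
    · simpa using continuous_apply i
  have c1 : Continuous fun v : Fin k → ℝ => (Fin.snoc v 1 : Fin (k + 1) → ℝ) := by
    refine continuous_pi fun i => Fin.lastCases ?_ (fun i => ?_) i
    · simpa using continuous_const
    · simpa using continuous_apply i
  have cj : ∀ j : Fin k, Continuous fun v : Fin k → ℝ => v ∘ j.predAbove := fun j =>
    continuous_pi fun i => continuous_apply _
  have hint' : ∀ (f : (Fin k → ℝ) → Fin (k + 1) → ℝ) (P : Tens n (k + 2)), Continuous f →
      MeasureTheory.Integrable (fun v => J (circ (f v)) P (wt a))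
        (MeasureTheory.volume.restrict (openSimplex k)) := fun f P hf => by
    simpa using hint 1 f P hf
  have hsub : ∀ (c c' : ℂ) (f g : (Fin k → ℝ) → Fin (k + 1) → ℝ) (P Q : Tens n (k + 2)),
      Continuous f → Continuous g → MeasureTheory.Integrable
        (fun v => c * J (circ (f v)) P (wt a) - c' * J (circ (g v)) Q (wt a))
        (MeasureTheory.volume.restrict (openSimplex k)) := fun c c' f g P Q hf hg =>
    (hint c f P hf).sub (hint c' g Q hg)
  rw [MeasureTheory.integral_add (hsub _ _ _ _ _ _ c1 c0)
    (MeasureTheory.integrable_finsetSum _ fun j _ => hsub _ _ _ _ _ _ (cj j) (cj j)),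
    MeasureTheory.integral_sub (hint _ _ _ c1) (hint _ _ _ c0),
    MeasureTheory.integral_finsetSum _ fun j _ => hsub _ _ _ _ _ _ (cj j) (cj j)]
  simp only [MeasureTheory.integral_sub (hint _ _ _ (cj _)) (hint _ _ _ (cj _)),
    MeasureTheory.integral_add (hint' _ _ (cj _)) (hint' _ _ (cj _)),
    MeasureTheory.integral_const_mul, Fin.val_zero, pow_zero, one_mul, Fin.val_last, Fin.val_succ,
    Fin.val_castSucc, pow_succ]
  rw [neg_add, ← Finset.sum_neg_distrib, neg_sub, add_right_comm]
  congr 1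
  · ring
  · exact Finset.sum_congr rfl fun j _ => by ring

/-! ### The Connes operator and rotations of the circle -/

theorem bern_rotate {k : ℕ} (v : Fin k → ℝ) (x y : Fin (k + 1)) :
    bern (Fin.snoc v 1 : Fin (k + 1) → ℝ) x y =
      bern (Fin.cons 0 v : Fin (k + 1) → ℝ) (x + 1) (y + 1) := by
  have hl : ∀ a : Fin k, ¬ Fin.last k < a.castSucc := fun a => (Fin.castSucc_lt_last a).not_gt
  refine Fin.lastCases ?_ (fun x => ?_) x <;> refine Fin.lastCases ?_ (fun y => ?_) y
  · simp [bern]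
  · simp [bern, Fin.coeSucc_eq_succ, Fin.last_add_one]; ring
  · simp [bern, hl, Fin.coeSucc_eq_succ, Fin.last_add_one]; ring
  · simp [bern, Fin.coeSucc_eq_succ]

theorem snoc_sub_cons {k : ℕ} (v : Fin k → ℝ) (p : Fin (k + 1)) :
    (Fin.snoc v 1 : Fin (k + 1) → ℝ) (p - 1) - (Fin.cons 0 v : Fin (k + 1) → ℝ) p =
      if p = 0 then 1 else 0 := by
  obtain ⟨q, rfl⟩ : ∃ q, p = q + 1 := ⟨p - 1, by simp⟩
  rw [add_sub_cancel_right]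
  refine Fin.lastCases ?_ (fun q => ?_) q
  · simp [Fin.last_add_one]
  · simp [Fin.coeSucc_eq_succ]

/-- Infinitesimal translation invariance: moving all points at once changes no difference. -/
theorem sum_quad_dmat {n k : ℕ} : ∑ p : Fin k, quad (n := n) (dmat p) = 0 := by
  simp only [quad_dmat]
  rw [← om_sum_left, om_self]

theorem continuous_snoc_one (k : ℕ) :
    Continuous fun v : Fin k → ℝ => (Fin.snoc v 1 : Fin (k + 1) → ℝ) := by
  refine continuous_pi fun i => Fin.lastCases ?_ (fun i => ?_) i
  · simpa using continuous_const
  · simpa using continuous_apply i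

theorem continuous_cons_zero (k : ℕ) :
    Continuous fun v : Fin k → ℝ => (Fin.cons 0 v : Fin (k + 1) → ℝ) := by
  refine continuous_pi fun i => Fin.cases ?_ (fun i => ?_) i
  · simpa using continuous_const
  · simpa using continuous_apply i

/-- The sum of all partial derivatives of `u_κ J` is `J`, because `J` is translation invariant. In
Stokes' theorem for this sum the inner walls cancel, and only the faces with last point `1` or first
point `0` remain. By `bern_rotate` the former is again a configuration based at `0`, with the
rotation index shifted by one. -/
theorem integral_rotated {n k : ℕ} (P F : Tens n (k + 1)) (j κ : Fin (k + 1)) :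
    ∫ u in openSimplex (k + 1), J (fun a b => bern u (a - j) (b - j)) P F =
      ∫ v in openSimplex k,
        (((Fin.snoc v 1 : Fin (k + 1) → ℝ) κ : ℂ) *
            J (fun a b => bern (Fin.cons 0 v : Fin (k + 1) → ℝ) (a - (j - 1)) (b - (j - 1))) P F -
          ((Fin.cons 0 v : Fin (k + 1) → ℝ) κ : ℂ) *
            J (fun a b => bern (Fin.cons 0 v : Fin (k + 1) → ℝ) (a - j) (b - j)) P F) := by
  have hcont : Continuous fun (u : Fin (k + 1) → ℝ) (a b : Fin (k + 1)) => bern u (a - j) (b - j) :=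
    continuous_pi fun a => continuous_pi fun b =>
      (continuous_apply_apply (a - j) (b - j)).comp (continuous_bern _)
  have hκ : Continuous fun u : Fin (k + 1) → ℝ => (u κ : ℂ) :=
    Complex.continuous_ofReal.comp (continuous_apply κ)
  have hJ : ∀ Q : Tens n (k + 1), Continuous fun u : Fin (k + 1) → ℝ =>
      J (fun a b => bern u (a - j) (b - j)) Q F := fun Q => (continuous_J Q F).comp hcont
  have hF' : ∀ i : Fin (k + 1), Continuous fun u : Fin (k + 1) → ℝ =>
      (if κ = i then (1 : ℂ) else 0) * J (fun a b => bern u (a - j) (b - j)) P F +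
        (u κ : ℂ) * J (fun a b => bern u (a - j) (b - j)) (quad (dmat (i + j)) * P) F := fun i =>
    (continuous_const.mul (hJ _)).add (hκ.mul (hJ _))
  have hst := sum_integral_openSimplex_deriv
    (fun (_ : Fin (k + 1)) u => (u κ : ℂ) * J (fun a b => bern u (a - j) (b - j)) P F)
    (fun i u => (if κ = i then (1 : ℂ) else 0) * J (fun a b => bern u (a - j) (b - j)) P F +
      (u κ : ℂ) * J (fun a b => bern u (a - j) (b - j)) (quad (dmat (i + j)) * P) F)
    (fun i => hκ.mul (hJ _)) hF' (fun i v x => by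
      have h1 : HasDerivAt (fun t : ℝ => (((i.insertNth t v : Fin (k + 1) → ℝ) κ : ℝ) : ℂ))
          (if κ = i then (1 : ℂ) else 0) x := by
        rcases Fin.eq_self_or_eq_succAbove i κ with rfl | ⟨κ', rfl⟩
        · simpa using (hasDerivAt_id x).ofReal_comp
        · simpa [Fin.succAbove_ne] using hasDerivAt_const x _
      refine h1.mul ?_
      refine hasDerivAt_J P F (fun t => fun a b => bern (i.insertNth t v : Fin (k + 1) → ℝ)
        (a - j) (b - j)) (dmat (i + j)) x fun t => ?_
      have h2 := bern_affine (fun t => (i.insertNth t v : Fin (k + 1) → ℝ)) i x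
        (fun t a => insertNth_affine i v x t a) t
      funext a b
      have h3 := congrFun (congrFun h2 (a - j)) (b - j)
      rw [h3]
      simp [dmat, sub_eq_iff_eq_add])
  simp only [sub_self, Finset.sum_const_zero, add_zero] at hst
  rw [← MeasureTheory.integral_finsetSum _ fun i _ => integrableOn_openSimplex (hF' i)] at hst
  simp only [Finset.sum_add_distrib, ← Finset.mul_sum, ← Finset.sum_mul, Finset.sum_ite_eq,
    Finset.mem_univ, if_true, one_mul, ← J_sum] at hst
  have hz : ∑ i : Fin (k + 1), quad (n := n) (dmat (i + j)) = 0 := 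
    (Equiv.sum_comp (Equiv.addRight j) fun i => quad (n := n) (dmat i)).trans sum_quad_dmat
  simp only [hz, zero_mul, J_zero, mul_zero, add_zero] at hst
  rw [hst]
  refine MeasureTheory.integral_congr_ae (Filter.Eventually.of_forall fun v => ?_)
  simp only [bern_rotate, sub_add, sub_sub_eq_add_sub]

theorem sum_integral_rotated {n k : ℕ} (P F : Tens n (k + 1)) :
    ∑ j, ∫ u in openSimplex (k + 1), J (fun a b => bern u (a - j) (b - j)) P F =
      ∫ v in openSimplex k, J (circ v) P F := by
  have hJ : ∀ j, Continuous fun v : Fin k → ℝ =>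
      J (fun a b => bern (Fin.cons 0 v : Fin (k + 1) → ℝ) (a - j) (b - j)) P F := fun j =>
    (continuous_J P F).comp <| continuous_pi fun a => continuous_pi fun b =>
      (continuous_apply_apply (a - j) (b - j)).comp (continuous_circ k)
  -- The point `κ = -j` is the position of slot `0` in the `j`-th rotation. With this choice the sum
  -- over `j` telescopes by `snoc_sub_cons`, and only `j = 0` survives.
  rw [Finset.sum_congr rfl fun j _ => integral_rotated P F j (-j),
    ← MeasureTheory.integral_finsetSum]
  · refine MeasureTheory.integral_congr_ae (Filter.Eventually.of_forall fun v => ?_)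
    dsimp only
    rw [Finset.sum_sub_distrib, ← Equiv.sum_comp (Equiv.addRight (1 : Fin (k + 1))),
      ← Finset.sum_sub_distrib]
    simp only [Equiv.coe_addRight, add_sub_cancel_right, neg_add, ← sub_mul, ← Complex.ofReal_sub,
      ← sub_eq_add_neg, snoc_sub_cons, neg_eq_zero]
    rw [Finset.sum_eq_single 0] <;> simp +contextual [circ]
  · intro j _
    refine integrableOn_openSimplex (Continuous.sub ?_ ?_)
    · exact (Complex.continuous_ofReal.comp
        ((continuous_apply (-j)).comp (continuous_snoc_one k))).mul (hJ _)
    · exact (Complex.continuous_ofReal.comp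
        ((continuous_apply (-j)).comp (continuous_cons_zero k))).mul (hJ _)

/-- This is the sign in the Connes operator, so it cancels the sign from permuting the rows of an
alternating form. -/
theorem sign_addRight {k : ℕ} (j : Fin (k + 1)) :
    Equiv.Perm.sign (Equiv.addRight j) = (-1) ^ (k * (j : ℕ)) := by
  have h : ∀ (m : ℕ) (hm : m < k + 1) (i : Fin (k + 1)),
      (finRotate (k + 1) ^ m) i = i + ⟨m, hm⟩ := by
    intro m
    induction m with
    | zero => intro _ i; simp
    | succ m ih =>
      intro hm i
      have : (⟨m + 1, hm⟩ : Fin (k + 1)) = ⟨m, by omega⟩ + 1 :=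
        Fin.ext (Fin.val_add_one_of_lt (i := (⟨m, by omega⟩ : Fin (k + 1)))
          (Fin.lt_def.2 (by simpa using hm))).symm
      rw [pow_succ', Equiv.Perm.mul_apply, ih (by omega), finRotate_apply, this, add_assoc]
  have : Equiv.addRight j = finRotate (k + 1) ^ (j : ℕ) :=
    Equiv.ext fun i => (h j j.2 i).symm
  rw [this, map_pow, sign_finRotate, Nat.add_sub_cancel, pow_mul]

theorem wt_rotate {n k : ℕ} (j : Fin (k + 1)) (a : Fin (k + 1) → Weyl n) :
    wt (rotate j a) = relabel n (fun i => (i - j).succ) (wt a) := by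
  rw [wt, wt, tens_apply, tens_apply, Fin.prod_univ_succ, map_prod]
  simp only [relabel_rename]
  rw [← Equiv.prod_comp (Equiv.addLeft j) fun i =>
    MvPolynomial.rename (Prod.mk (i - j).succ) (Weyl.toPoly (a i))]
  simp [rotate, Weyl.toPoly_one]

/-- The unit in slot `0` decouples the base point and leaves `k + 1` points on the circle. Summing
over the rotations amounts to fixing slot `0` at the origin (`sum_integral_rotated`). In contrast to
`Rep`, the form is now evaluated on the rows starting with `row 0`. -/
theorem Rep.connesB {n k : ℕ} {ψ : NForm n (k + 1)} {φ : Cochain (Weyl n) (k + 1)} (h : Rep ψ φ)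
    (a : Fin (k + 1) → Weyl n) : (connesB k φ).1 a =
      ∫ u in openSimplex k, J (circ u) (ψ.form _ fun i => row i) (wt a) := by
  change preB k φ.1 a = _
  rw [preB_apply, ← sum_integral_rotated]
  refine Finset.sum_congr rfl fun j _ => ?_
  rw [h, ← MeasureTheory.integral_const_mul]
  refine MeasureTheory.integral_congr_ae (Filter.Eventually.of_forall fun u => ?_)
  dsimp only
  have e : (fun (i : Fin (k + 1)) β =>
      pull n (fun i : Fin (k + 1) => (i - j).succ) (row i.succ β)) =
      (fun i => row (n := n) i) ∘ Equiv.addRight j := funext fun i => by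
    rw [pull_row]
    simp [sub_eq_iff_eq_add]
  rw [wt_rotate, J_relabel, NForm.pull_form, e, AlternatingMap.map_perm, sign_addRight]
  have hs : (((-1 : ℤˣ) ^ (k * (j : ℕ))) • ψ.form (Tens n (k + 1)) fun i => row i) =
      MvPolynomial.C ((-1) ^ (k * (j : ℕ))) * ψ.form (Tens n (k + 1)) fun i => row i := by
    simp [Units.smul_def]
  rw [hs, J_C_mul, ← mul_assoc, ← mul_pow]
  simp only [mul_neg, mul_one, neg_neg, one_pow, one_mul]
  congr 1
  funext a b
  exact (congrFun (congrFun (bern_comp_strictMono (Fin.cons 0 u : Fin (k + 2) → ℝ)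
    (Fin.strictMono_succ)) (a - j)) (b - j)).trans rfl

/-! ### Contractions -/

theorem alternatingMap_sum_apply {R M N κ ι : Type*} [CommRing R] [AddCommGroup M] [AddCommGroup N]
    [Module R M] [Module R N] (s : Finset κ) (f : κ → M [⋀^ι]→ₗ[R] N) (v : ι → M) :
    (∑ i ∈ s, f i) v = ∑ i ∈ s, f i v :=
  map_sum (⟨⟨fun g => g v, rfl⟩, fun _ _ => rfl⟩ : (M [⋀^ι]→ₗ[R] N) →+ N) f s

/-- Contraction of a form with a basis vector. -/
def NForm.contract {n k : ℕ} (ψ : NForm n (k + 1)) (γ : Fin (2 * n)) : NForm n k where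
  form S _ := (ψ.form S).curryLeft (Pi.single γ 1)
  map_form f v := by
    rw [AlternatingMap.curryLeft_apply_apply, AlternatingMap.curryLeft_apply_apply, ψ.map_form]
    congr 1
    funext i
    refine Fin.cases ?_ (fun i => ?_) i
    · funext β
      by_cases h : β = γ
      · subst h; simp
      · simp [h]
    · rfl

theorem NForm.contract_apply {n k : ℕ} (ψ : NForm n (k + 1)) (γ : Fin (2 * n)) {S : Type}
    [CommRing S] (v : Fin k → Fin (2 * n) → S) :
    (ψ.contract γ).form S v = ψ.form S (Matrix.vecCons (Pi.single γ 1) v) := rfl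

theorem relabel_form {n k l m : ℕ} (ψ : NForm n k) (f : Fin l → Fin m)
    (v : Fin k → Fin (2 * n) → Tens n l) :
    relabel n f (ψ.form _ v) = ψ.form _ fun i β => relabel n f (v i β) :=
  ψ.map_form (relabel n f : Tens n l →+* Tens n m) v

theorem relabel_row {n k l : ℕ} (f : Fin k → Fin l) (i : Fin k) :
    (fun β => relabel n f (row i β)) = row (f i) := by
  funext β
  simp [relabel, row]

theorem pull_relabel {n k l : ℕ} {f : Fin k → Fin l} (hf : Function.Injective f) (x : Tens n k) :
    pull n f (relabel n f x) = x := by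
  have : (pull n f).comp (relabel n f) = AlgHom.id ℂ _ := by
    refine MvPolynomial.algHom_ext fun v => ?_
    simp [relabel, pull_X, hf.eq_iff]
  exact DFunLike.congr_fun this x

theorem pull_X_eq_zero {n k l : ℕ} {f : Fin k → Fin l} {j : Fin l} (hf : ∀ i, f i ≠ j)
    (β : Fin (2 * n)) : pull n f (MvPolynomial.X (j, β)) = 0 := by
  rw [pull_X]
  exact Finset.sum_eq_zero fun i _ => if_neg (hf i)

theorem pderiv_relabel_eq_zero {n k l : ℕ} {f : Fin k → Fin l} {j : Fin l} (hf : ∀ i, f i ≠ j)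
    (β : Fin (2 * n)) (x : Tens n k) : MvPolynomial.pderiv (j, β) (relabel n f x) = 0 := by
  rw [← slotD_apply, slotD_relabel]
  exact Finset.sum_eq_zero fun i _ => if_neg (hf i)

/-- Expansion of the symbol of `ψ` along the row of one slot. -/
theorem form_row_expand {n k : ℕ} (ψ : NForm n (k + 1)) (j : Fin (k + 1)) :
    ψ.form (Tens n (k + 2)) (fun i => row i.succ) = ∑ γ, MvPolynomial.X (j.succ, γ) *
      relabel n j.succ.succAbove ((MvPolynomial.C ((-1) ^ (j : ℕ)) : Tens n (k + 1)) *
        (ψ.contract γ).form (Tens n (k + 1)) fun i => row i.succ) := by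
  have h1 : (fun i : Fin (k + 1) => row (n := n) i.succ) =
      (j.insertNth (row j.succ) fun i : Fin k => row (j.succAbove i).succ :
        Fin (k + 1) → Fin (2 * n) → Tens n (k + 2)) := by
    rw [Fin.eq_insertNth_iff]
    exact ⟨rfl, rfl⟩
  have h2 : row (n := n) j.succ = ∑ γ, (MvPolynomial.X (j.succ, γ) : Tens n (k + 2)) •
      (Pi.single γ 1 : Fin (2 * n) → Tens n (k + 2)) := by
    funext β
    simp [row, Finset.sum_apply, Pi.single_apply]
  have h3 : ∀ γ : Fin (2 * n), relabel n j.succ.succAbove ((ψ.contract γ).form (Tens n (k + 1))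
      fun i => row i.succ) = (ψ.contract γ).form _ fun i => row (j.succAbove i).succ := by
    intro γ
    rw [relabel_form]
    congr 1
    funext i
    rw [relabel_row, Fin.succ_succAbove_succ]
  rw [h1, AlternatingMap.map_insertNth, ← AlternatingMap.curryLeft_apply_apply, h2, map_sum,
    alternatingMap_sum_apply, Finset.smul_sum]
  refine Finset.sum_congr rfl fun γ _ => ?_
  have hC : relabel n j.succ.succAbove (MvPolynomial.C ((-1) ^ (j : ℕ)) : Tens n (k + 1)) =
      (-1) ^ (j : ℕ) := by simp
  rw [map_mul, h3, hC, map_smul, AlternatingMap.smul_apply, smul_eq_mul, zsmul_eq_mul]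
  push_cast
  change _ = _ * (_ * (ψ.form _).curryLeft _ _)
  ring

/-- The symbol is linear in the row of slot `j.succ`, and the derivative picks out a coefficient of
the expansion; the sign comes from moving that row to the front. -/
theorem pderiv_form_row {n k : ℕ} (ψ : NForm n (k + 1)) (j : Fin (k + 1)) (β : Fin (2 * n)) :
    MvPolynomial.pderiv (j.succ, β) (ψ.form (Tens n (k + 2)) fun i => row i.succ) =
      relabel n j.succ.succAbove (MvPolynomial.C ((-1) ^ (j : ℕ)) *
        (ψ.contract β).form (Tens n (k + 1)) fun i => row i.succ) := by
  classical
  rw [form_row_expand ψ j, map_sum, Finset.sum_eq_single β]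
  · rw [MvPolynomial.pderiv_mul, pderiv_relabel_eq_zero (Fin.succAbove_ne _),
      MvPolynomial.pderiv_X_self]
    ring
  · intro γ _ hγ
    have : MvPolynomial.pderiv (j.succ, β) (MvPolynomial.X (j.succ, γ) : Tens n (k + 2)) = 0 := by
      rw [MvPolynomial.pderiv_X_of_ne]
      simpa using hγ
    rw [MvPolynomial.pderiv_mul, pderiv_relabel_eq_zero (Fin.succAbove_ne _), this]
    ring
  · intro h; exact absurd (Finset.mem_univ _) h

/-- Pulling back along `succAbove` sets the row of the omitted slot to zero, and the form is linear
in it. -/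
theorem pull_form_row_eq_zero {n k : ℕ} (ψ : NForm n (k + 1)) (j : Fin (k + 1)) :
    pull n j.succ.succAbove (ψ.form (Tens n (k + 2)) fun i => row i.succ) = 0 := by
  rw [form_row_expand ψ j, map_sum]
  refine Finset.sum_eq_zero fun γ _ => ?_
  rw [map_mul, pull_X_eq_zero (Fin.succAbove_ne _), zero_mul]

theorem wt_insertAfter {n k : ℕ} (x : Weyl n) (j : Fin (k + 1)) (a : Fin (k + 1) → Weyl n) :
    wt (insertAfter x j a) = MvPolynomial.rename (Prod.mk j.succ) (Weyl.toPoly x) *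
      relabel n j.succ.succAbove (wt a) := by
  rw [wt, wt, tens_apply, tens_apply, Fin.prod_univ_succAbove _ j.succ, map_prod]
  simp [insertAfter, relabel_rename]

theorem circ_comp_succAbove {k : ℕ} (u : Fin (k + 1) → ℝ) (j : Fin (k + 1)) :
    (fun a b => circ u (j.succ.succAbove a) (j.succ.succAbove b)) = circ (u ∘ j.succAbove) := by
  rw [circ, bern_comp_strictMono _ (Fin.strictMono_succAbove _), circ]
  congr 1
  funext i
  refine Fin.cases ?_ (fun i => ?_) i
  · simp
  · simp [Fin.succ_succAbove_succ]

/-- The inserted coordinate differentiates the symbol, after which the row of its slot is set to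
zero. The term where the exponential is differentiated keeps the form untouched and vanishes, so the
contraction remains and the inserted point no longer enters the exponent. -/
theorem J_insert_y {n k : ℕ} (ψ : NForm n (k + 1)) (u : Fin (k + 1) → ℝ) (j : Fin (k + 1))
    (β : Fin (2 * n)) (a : Fin (k + 1) → Weyl n) :
    J (circ u) (ψ.form _ fun i => row i.succ) (wt (insertAfter (Weyl.y β) j a)) =
      (-1) ^ (j : ℕ) * J (circ (u ∘ j.succAbove)) ((ψ.contract β).form _ fun i => row i.succ)
        (wt a) := by
  have hx : MvPolynomial.rename (Prod.mk j.succ) (Weyl.toPoly (Weyl.y β)) =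
      (MvPolynomial.X (j.succ, β) : Tens n (k + 2)) := MvPolynomial.rename_X _ _
  rw [wt_insertAfter, hx, J_X_mul, J_relabel, map_add, map_mul, pull_form_row_eq_zero, mul_zero,
    add_zero, pderiv_form_row, pull_relabel Fin.succAbove_right_injective, J_C_mul,
    circ_comp_succAbove]

theorem continuous_comp_succAbove {k : ℕ} (j : Fin (k + 1)) :
    Continuous fun u : Fin (k + 1) → ℝ => u ∘ j.succAbove :=
  continuous_pi fun i => continuous_apply (j.succAbove i)

/-- Integrating out an additional point on the circle. -/
theorem sum_integral_comp_succAbove {k : ℕ} {g : (Fin k → ℝ) → ℂ} (hg : Continuous g) :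
    ∑ j : Fin (k + 1), ∫ u in openSimplex (k + 1), g (u ∘ j.succAbove) =
      ∫ v in openSimplex k, g v := by
  have hc : ∀ j : Fin (k + 1), Continuous fun u : Fin (k + 1) → ℝ => g (u ∘ j.succAbove) :=
    fun j => hg.comp (continuous_comp_succAbove j)
  -- The antiderivative in the extra point is `u_j g`. It agrees on the two sides of each wall, and
  -- the ends contribute `1 · g - 0 · g`.
  have hst := sum_integral_openSimplex_deriv
    (fun (j : Fin (k + 1)) u => (u j : ℂ) * g (u ∘ j.succAbove))
    (fun j u => g (u ∘ j.succAbove))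
    (fun j => (Complex.continuous_ofReal.comp (continuous_apply j)).mul (hc j)) hc
    (fun j v x => by
      simp only [Fin.insertNth_apply_same, Fin.insertNth_comp_succAbove]
      simpa using ((hasDerivAt_id x).ofReal_comp).mul_const (g v))
  rw [hst]
  refine MeasureTheory.integral_congr_ae (Filter.Eventually.of_forall fun v => ?_)
  have h : ∀ (j : Fin (k + 1)) (t : ℝ), (((j.insertNth t v : Fin (k + 1) → ℝ) j : ℝ) : ℂ) *
      g ((j.insertNth t v : Fin (k + 1) → ℝ) ∘ j.succAbove) = t * g v := fun j t => by
    rw [Fin.insertNth_apply_same, Fin.insertNth_comp_succAbove]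
  have h1 := h (Fin.last k) 1
  have h2 := h 0 0
  rw [Fin.insertNth_last'] at h1
  rw [Fin.insertNth_zero'] at h2
  dsimp only
  rw [h1, h2, Finset.sum_eq_zero]
  · simp
  · intro j _
    have h3 := h j.castSucc (v j)
    have h4 := h j.succ (v j)
    rw [insertNth_castSucc_self] at h3
    rw [insertNth_succ_self] at h4
    rw [h3, h4, sub_self]

/-- The sign of `j` in the contraction cancels the one in `J_insert_y`, so the positions of the
inserted point add up to the whole circle, which has length one. -/
theorem Rep.contr_y {n k : ℕ} {ψ : NForm n (k + 1)} {φ : Cochain (Weyl n) (k + 1)} (h : Rep ψ φ)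
    (β : Fin (2 * n)) : Rep (ψ.contract β) (contr (Weyl.y β) k φ) := by
  intro a
  change preIota (Weyl.y β) k φ.1 a = _
  rw [preIota_apply, ← sum_integral_comp_succAbove (continuous_J_circ _ _)]
  refine Finset.sum_congr rfl fun j _ => ?_
  rw [h, ← MeasureTheory.integral_const_mul]
  refine MeasureTheory.integral_congr_ae (Filter.Eventually.of_forall fun u => ?_)
  dsimp only
  rw [J_insert_y, ← mul_assoc, ← mul_pow]
  simp

/-- The operation on forms corresponding to `ι_ω`. -/
def NForm.iom {n k : ℕ} (ψ : NForm n (k + 2)) : NForm n k where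
  form S _ := ∑ j : Fin n, ((ψ.contract (qIdx j)).contract (pIdx j)).form S
  map_form f v := by
    simp only [alternatingMap_sum_apply, map_sum, NForm.map_form]

theorem NForm.iom_apply {n k : ℕ} (ψ : NForm n (k + 2)) {S : Type} [CommRing S]
    (v : Fin k → Fin (2 * n) → S) : ψ.iom.form S v = ∑ j : Fin n, ψ.form S
      (Matrix.vecCons (Pi.single (qIdx j) 1) (Matrix.vecCons (Pi.single (pIdx j) 1) v)) := by
  simp only [NForm.iom, alternatingMap_sum_apply, NForm.contract_apply]

theorem Rep.iotaOmega {n k : ℕ} {ψ : NForm n (k + 2)} {φ : Cochain (Weyl n) (k + 2)}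
    (h : Rep ψ φ) : ∃ φ' : Cochain (Weyl n) k,
      iotaOmega n (ofDeg (k + 2) φ) = ofDeg k φ' ∧ Rep ψ.iom φ' := by
  refine ⟨∑ j : Fin n, contr (Weyl.y (pIdx j)) k (contr (Weyl.y (qIdx j)) (k + 1) φ), ?_, ?_⟩
  · rw [WeylCyclic.iotaOmega, LinearMap.sum_apply, map_sum]
    refine Finset.sum_congr rfl fun j _ => ?_
    rw [Module.End.mul_apply, iota, iota, lowering_succ, lowering_succ]
  · intro a
    have h1 : (∑ j : Fin n, contr (Weyl.y (pIdx j)) k (contr (Weyl.y (qIdx j)) (k + 1) φ)).1 a =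
        ∑ j : Fin n, (contr (Weyl.y (pIdx j)) k (contr (Weyl.y (qIdx j)) (k + 1) φ)).1 a :=
      map_sum (evalAt a) _ _
    rw [h1, Finset.sum_congr rfl fun j _ => ((h.contr_y (qIdx j)).contr_y (pIdx j)) a,
      ← MeasureTheory.integral_finsetSum _ fun j _ =>
        integrableOn_openSimplex (continuous_J_circ _ _)]
    simp only [NForm.iom, alternatingMap_sum_apply, J_sum]

/-! ### Contraction with quadratic polynomials -/

theorem circ_antisymm {k : ℕ} (u : Fin k → ℝ) (a b : Fin (k + 1)) : circ u a b = - circ u b a := by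
  simp only [circ, bern]
  rcases lt_trichotomy a b with h | rfl | h
  · simp [h, h.not_gt]; ring
  · simp
  · simp [h, h.not_gt]; ring

theorem pderiv_row {n k : ℕ} (p a : Fin k) (β : Fin (2 * n)) :
    (fun γ => MvPolynomial.pderiv (p, β) (row (n := n) a γ)) =
      if a = p then Pi.single β 1 else 0 := by
  classical
  funext γ
  rw [row]
  by_cases h : a = p
  · subst h
    by_cases h' : γ = β
    · subst h'; simp
    · rw [MvPolynomial.pderiv_X_of_ne (by simpa using h'), if_pos rfl, Pi.single_eq_of_ne h']
  · rw [MvPolynomial.pderiv_X_of_ne (by simp [h]), if_neg h]; rfl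

theorem pderiv_quad {n k : ℕ} (c : Fin k → Fin k → ℝ) (hc : ∀ a b, c a b = - c b a) (p : Fin k)
    (β : Fin (2 * n)) : MvPolynomial.pderiv (p, β) (quad c) =
      ∑ b, MvPolynomial.C (c p b : ℂ) * om (Pi.single β 1) (row b) := by
  have hom : ∀ a b : Fin k, MvPolynomial.pderiv (p, β) (om (row (n := n) a) (row b)) =
      (if a = p then om (Pi.single β 1) (row b) else 0) +
      (if b = p then om (row a) (Pi.single β 1) else 0) := by
    intro a b
    have h1 : MvPolynomial.pderiv (p, β) (om (row (n := n) a) (row b)) =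
        om (fun γ => MvPolynomial.pderiv (p, β) (row (n := n) a γ)) (row b) +
        om (row a) (fun γ => MvPolynomial.pderiv (p, β) (row (n := n) b γ)) := by
      simp only [om, map_sum, map_sub, MvPolynomial.pderiv_mul, ← Finset.sum_add_distrib]
      exact Finset.sum_congr rfl fun j _ => by ring
    rw [h1, pderiv_row, pderiv_row]
    congr 1 <;> split_ifs <;> simp [om]
  simp only [quad, map_sum, MvPolynomial.pderiv_C_mul, hom, mul_add, Finset.sum_add_distrib,
    mul_ite, mul_zero, Finset.sum_ite_eq', Finset.mem_univ, if_true]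
  rw [Finset.sum_comm]
  simp only [Finset.sum_ite_eq', Finset.mem_univ, if_true]
  rw [← Finset.sum_add_distrib]
  refine Finset.sum_congr rfl fun b _ => ?_
  rw [om_neg (row b), hc b p]
  simp only [Complex.ofReal_neg]
  have : (MvPolynomial.C (c p b : ℂ) : Tens n k) =
      MvPolynomial.C (c p b / 2 : ℂ) - MvPolynomial.C (-c p b / 2 : ℂ) := by
    rw [← map_sub]; congr 1; ring
  rw [this]
  ring

theorem pull_pderiv_quad {n k : ℕ} (c : Fin (k + 1) → Fin (k + 1) → ℝ)
    (hc : ∀ a b, c a b = - c b a) (p : Fin (k + 1)) (β : Fin (2 * n)) :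
    pull n p.succAbove (MvPolynomial.pderiv (p, β) (quad c)) =
      ∑ l, MvPolynomial.C (c p (p.succAbove l) : ℂ) * om (Pi.single β 1) (row l) := by
  have hC : ∀ a, pull n p.succAbove (MvPolynomial.C a) = MvPolynomial.C a := fun a =>
    (pull n p.succAbove).commutes a
  have hom : ∀ b, pull n p.succAbove (om (Pi.single β 1) (row b)) =
      om (Pi.single β 1) (fun γ => pull n p.succAbove (row b γ)) := by
    intro b
    have h := map_om (pull n p.succAbove : Tens n (k + 1) →+* Tens n k) (Pi.single β 1) (row b)
    have h' : (fun γ => pull n p.succAbove ((Pi.single β 1 : Fin (2 * n) → Tens n (k + 1)) γ)) =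
        Pi.single β 1 := by
      funext γ
      by_cases h : γ = β
      · subst h; simp
      · simp [h]
    exact h.trans (congrArg (fun v => om v _) h')
  have h0 : c p p = 0 := by linarith [hc p p]
  rw [pderiv_quad c hc, map_sum, Fin.sum_univ_succAbove _ p, h0]
  simp only [map_mul, hC, hom, pull_row, Complex.ofReal_zero, map_zero, zero_mul, zero_add]
  refine Finset.sum_congr rfl fun l _ => ?_
  simp [(Fin.succAbove_right_injective (p := p)).eq_iff]

/-- The symbol obtained by inserting the quadratic polynomial `y_β y_γ` into an additional slot. -/
def quadSymbol {n k : ℕ} (ψ : NForm n (k + 1)) (β γ : Fin (2 * n)) (l : Fin (k + 1)) :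
    Tens n (k + 1) :=
  om (Pi.single β 1) (row l) * ((ψ.contract γ).form _ fun i => row i.succ) +
    om (Pi.single γ 1) (row l) * ((ψ.contract β).form _ fun i => row i.succ)

/-- Of the two derivatives, exactly one must hit the form: with none it vanishes once the row is set
to zero, and two kill it by linearity. The other hits the exponent and produces the factor `circ u
j.succ _`, the only place where the position of the inserted point enters. -/
theorem J_insert_y_y {n k : ℕ} (ψ : NForm n (k + 1)) (u : Fin (k + 1) → ℝ) (j : Fin (k + 1))
    (β γ : Fin (2 * n)) (a : Fin (k + 1) → Weyl n) :
    J (circ u) (ψ.form _ fun i => row i.succ)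
      (wt (insertAfter (Weyl.toPoly.symm (MvPolynomial.X β * MvPolynomial.X γ)) j a)) =
      (-1) ^ (j : ℕ) * ∑ l, (circ u j.succ (j.succ.succAbove l) : ℂ) *
        J (circ (u ∘ j.succAbove)) (quadSymbol ψ β γ l) (wt a) := by
  have hx : MvPolynomial.rename (Prod.mk j.succ) (Weyl.toPoly (n := n) (Weyl.toPoly.symm
      (MvPolynomial.X β * MvPolynomial.X γ))) =
      (MvPolynomial.X (j.succ, β) * MvPolynomial.X (j.succ, γ) : Tens n (k + 2)) := by
    rw [LinearEquiv.apply_symm_apply, map_mul, MvPolynomial.rename_X, MvPolynomial.rename_X]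
  rw [wt_insertAfter, hx, mul_assoc, J_X_mul, J_X_mul, J_relabel, circ_comp_succAbove]
  have hP := pderiv_form_row ψ j
  have hrel := fun x => pull_relabel (n := n) (f := j.succ.succAbove)
    Fin.succAbove_right_injective x
  have hs : pull n j.succ.succAbove
      (MvPolynomial.pderiv (j.succ, γ)
        (MvPolynomial.pderiv (j.succ, β) (ψ.form (Tens n (k + 2)) fun i => row i.succ) +
          MvPolynomial.pderiv (j.succ, β) (quad (circ u)) * ψ.form _ fun i => row i.succ) +
        MvPolynomial.pderiv (j.succ, γ) (quad (circ u)) *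
        (MvPolynomial.pderiv (j.succ, β) (ψ.form (Tens n (k + 2)) fun i => row i.succ) +
          MvPolynomial.pderiv (j.succ, β) (quad (circ u)) * ψ.form _ fun i => row i.succ)) =
      ∑ l, MvPolynomial.C (circ u j.succ (j.succ.succAbove l) : ℂ) *
        (MvPolynomial.C ((-1) ^ (j : ℕ)) * quadSymbol ψ β γ l) := by
    simp only [map_add, map_mul, MvPolynomial.pderiv_mul, pull_form_row_eq_zero, hP, hrel,
      pderiv_relabel_eq_zero (Fin.succAbove_ne _), pull_pderiv_quad _ (circ_antisymm u),
      zero_mul, mul_zero, zero_add, add_zero, Finset.sum_mul, quadSymbol]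
    rw [← Finset.sum_add_distrib]
    exact Finset.sum_congr rfl fun l _ => by ring
  rw [hs, J_sum, Finset.mul_sum]
  refine Finset.sum_congr rfl fun l _ => ?_
  rw [J_C_mul, J_C_mul]
  ring

/-- The first Bernoulli polynomial integrates to zero over the circle. -/
theorem sum_integral_circ_mul {k : ℕ} {K : Fin (k + 1) → (Fin k → ℝ) → ℂ}
    (hK : ∀ l, Continuous (K l)) :
    ∑ j : Fin (k + 1), ∫ u in openSimplex (k + 1),
      ∑ l, (circ u j.succ (j.succ.succAbove l) : ℂ) * K l (u ∘ j.succAbove) = 0 := by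
  let s : Fin (k + 1) → Fin (k + 1) → ℝ := fun j l => if l ≤ j then 1 else -1
  let w : (Fin k → ℝ) → Fin (k + 1) → ℝ := fun v => Fin.cons 0 v
  have hw : ∀ l, Continuous fun v => w v l := fun l =>
    (continuous_apply l).comp (continuous_cons_zero k)
  have hcirc : ∀ u j l, circ u j.succ (j.succ.succAbove l) =
      u j - w (u ∘ j.succAbove) l - s j l / 2 := by
    intro u j l
    have h1 : (Fin.cons 0 u : Fin (k + 2) → ℝ) (j.succ.succAbove l) = w (u ∘ j.succAbove) l := by
      refine Fin.cases ?_ (fun l => ?_) l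
      · simp [w]
      · simp [w, Fin.succ_succAbove_succ]
    have h2 : j.succ.succAbove l < j.succ ↔ l ≤ j := by
      rw [Fin.succAbove_lt_iff_castSucc_lt, Fin.castSucc_lt_succ_iff]
    have h3 : j.succ < j.succ.succAbove l ↔ ¬ l ≤ j := by
      rw [← h2, not_lt]
      exact ⟨fun h => h.le, fun h => lt_of_le_of_ne h (Fin.succAbove_ne _ _).symm⟩
    rw [circ, bern, h1]
    by_cases h : l ≤ j
    · simp [h2, h, s]
    · simp [h2, h3, h, s]; ring
  -- With `x` the difference to point `l`, the antiderivative of `x - s/2` is `(x² - s x)/2`, the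
  -- second Bernoulli polynomial up to normalization; it is continuous and periodic on the circle.
  let F : Fin (k + 1) → (Fin (k + 1) → ℝ) → ℂ := fun j u =>
    ∑ l, (((u j - w (u ∘ j.succAbove) l) ^ 2 - s j l * (u j - w (u ∘ j.succAbove) l) : ℝ) / 2 : ℂ) *
      K l (u ∘ j.succAbove)
  have hdiff : ∀ j l, Continuous fun u : Fin (k + 1) → ℝ => u j - w (u ∘ j.succAbove) l :=
    fun j l => (continuous_apply j).sub ((hw l).comp (continuous_comp_succAbove j))
  have hF : ∀ j v t, F j (j.insertNth t v) =
      ∑ l, (((t - w v l) ^ 2 - s j l * (t - w v l) : ℝ) / 2 : ℂ) * K l v := by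
    intro j v t
    simp only [F, Fin.insertNth_apply_same, Fin.insertNth_comp_succAbove]
  have hst := sum_integral_openSimplex_deriv F
    (fun j u => ∑ l, (circ u j.succ (j.succ.succAbove l) : ℂ) * K l (u ∘ j.succAbove))
    (fun j => continuous_finsetSum _ fun l _ =>
      ((Complex.continuous_ofReal.comp (((hdiff j l).pow 2).sub
        (continuous_const.mul (hdiff j l)))).div_const 2).mul
          ((hK l).comp (continuous_comp_succAbove j)))
    (fun j => continuous_finsetSum _ fun l _ =>
      (Complex.continuous_ofReal.comp ((continuous_apply_apply _ _).comp (continuous_circ _))).mul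
        ((hK l).comp (continuous_comp_succAbove j)))
    (fun j v x => by
      simp only [hF, hcirc, Fin.insertNth_apply_same, Fin.insertNth_comp_succAbove]
      refine HasDerivAt.fun_sum fun l _ => HasDerivAt.mul_const ?_ _
      have h1 : HasDerivAt (fun t : ℝ => t - w v l) 1 x := (hasDerivAt_id x).sub_const (w v l)
      have h2 : HasDerivAt (fun t : ℝ => ((t - w v l) ^ 2 - s j l * (t - w v l)) / 2)
          (x - w v l - s j l / 2) x :=
        (((h1.fun_pow 2).fun_sub (h1.const_mul (s j l))).div_const 2).congr_deriv (by
          norm_num; ring)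
      simpa using h2.ofReal_comp)
  rw [hst]
  refine MeasureTheory.integral_eq_zero_of_ae (Filter.Eventually.of_forall fun v => ?_)
  have hlast := hF (Fin.last k) v 1
  have hzero := hF 0 v 0
  rw [Fin.insertNth_last'] at hlast
  rw [Fin.insertNth_zero'] at hzero
  -- Crossing the wall flips `s` only for `l = j.succ`, where the difference is zero and both
  -- expressions vanish.
  have hwall : ∀ j : Fin k, F j.castSucc (v ∘ j.predAbove) = F j.succ (v ∘ j.predAbove) := by
    intro j
    have h3 := hF j.castSucc v (v j)
    have h4 := hF j.succ v (v j)
    rw [insertNth_castSucc_self] at h3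
    rw [insertNth_succ_self] at h4
    rw [h3, h4]
    refine Finset.sum_congr rfl fun l _ => ?_
    by_cases hl : l = j.succ
    · subst hl
      simp [w]
    · have : l ≤ j.castSucc ↔ l ≤ j.succ := by
        have : (l : ℕ) ≠ j + 1 := fun h => hl (Fin.ext h)
        simp only [Fin.le_def, Fin.val_castSucc, Fin.val_succ]
        omega
      simp only [s, this]
  simp only [hwall, sub_self, Finset.sum_const_zero, add_zero]
  rw [hlast, hzero]
  refine sub_eq_zero.2 ?_
  refine Finset.sum_congr rfl fun l _ => ?_
  congr 3
  simp only [s, Fin.le_last, if_true]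
  -- Periodicity: for `l = 0` both ends are roots of `x² - x`; otherwise `s` changes sign between
  -- the ends and `(1 - w)² - (1 - w) = w² - w`.
  by_cases hl : l ≤ 0
  · rw [Fin.le_zero_iff.1 hl]
    simp [w]
  · rw [if_neg hl]
    ring

/-- The value of `ι_x φ` as a linear function of `x`. -/
def contrLin {n k : ℕ} (φ : Cochain (Weyl n) (k + 1)) (a : Fin (k + 1) → Weyl n) :
    Weyl n →ₗ[ℂ] ℂ :=
  ∑ j : Fin (k + 1), (-1 : ℂ) ^ (j : ℕ) • φ.1.toLinearMap (insertAfter 0 j a) j.succ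

theorem contrLin_apply {n k : ℕ} (φ : Cochain (Weyl n) (k + 1)) (a : Fin (k + 1) → Weyl n)
    (x : Weyl n) : contrLin φ a x = (contr x k φ).1 a := by
  change _ = preIota x k φ.1 a
  rw [preIota_apply, contrLin, LinearMap.sum_apply]
  refine Finset.sum_congr rfl fun j _ => ?_
  rw [LinearMap.smul_apply, MultilinearMap.toLinearMap_apply, insertAfter, Fin.update_insertNth]
  rfl

/-- By linearity in `x` it suffices to treat the commutative products `y_β y_γ`, which span the
quadratic polynomials. -/
theorem Rep.contr_sp {n k : ℕ} {ψ : NForm n (k + 1)} {φ : Cochain (Weyl n) (k + 1)} (h : Rep ψ φ)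
    {x : Weyl n} (hx : x ∈ sp n) : contr x k φ = 0 := by
  refine Subtype.ext (MultilinearMap.ext fun a => ?_)
  rw [← contrLin_apply]
  change _ = 0
  have hle : MvPolynomial.homogeneousSubmodule (Fin (2 * n)) ℂ 2 ≤
      LinearMap.ker ((contrLin φ a).comp Weyl.toPoly.symm.toLinearMap) := by
    rw [← MvPolynomial.homogeneousSubmodule_one_pow, pow_two,
      MvPolynomial.homogeneousSubmodule_one_eq_span_X, Submodule.span_mul_span, Submodule.span_le]
    rintro _ ⟨_, ⟨β, rfl⟩, _, ⟨γ, rfl⟩, rfl⟩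
    change contrLin φ a (Weyl.toPoly.symm (MvPolynomial.X β * MvPolynomial.X γ)) = 0
    rw [contrLin_apply]
    change preIota _ k φ.1 a = 0
    rw [preIota_apply, ← sum_integral_circ_mul (K := fun l v =>
      J (circ v) (quadSymbol ψ β γ l) (wt a)) fun l => continuous_J_circ _ _]
    refine Finset.sum_congr rfl fun j _ => ?_
    rw [h, ← MeasureTheory.integral_const_mul]
    refine MeasureTheory.integral_congr_ae (Filter.Eventually.of_forall fun u => ?_)
    dsimp only
    rw [J_insert_y_y, ← mul_assoc, ← mul_pow]
    simp
  exact hle hx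

/-! ### The cocycle property -/

theorem sum_fin_two_mul {n : ℕ} {M : Type*} [AddCommMonoid M] (f : Fin (2 * n) → M) :
    ∑ γ, f γ = ∑ j : Fin n, (f (pIdx j) + f (qIdx j)) := by
  let e : Fin n × Fin 2 ≃ Fin (2 * n) := finProdFinEquiv.trans (finCongr (mul_comm n 2))
  rw [← e.sum_comp, Fintype.sum_prod_type]
  refine Finset.sum_congr rfl fun j _ => ?_
  rw [Fin.sum_univ_two]
  congr 2
  · exact Fin.ext (by simp [e, pIdx, finProdFinEquiv])
  · exact Fin.ext (by simp [e, qIdx, finProdFinEquiv]; omega)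

theorem pIdx_ne_qIdx {n : ℕ} (i j : Fin n) : pIdx i ≠ qIdx j := fun h => by
  have := congrArg Fin.val h
  simp only [pIdx, qIdx] at this
  omega

theorem pIdx_injective {n : ℕ} : Function.Injective (pIdx (n := n)) := fun i j h => by
  have := congrArg Fin.val h
  simp only [pIdx] at this
  exact Fin.ext (by omega)

theorem qIdx_injective {n : ℕ} : Function.Injective (qIdx (n := n)) := fun i j h => by
  have := congrArg Fin.val h
  simp only [qIdx] at this
  exact Fin.ext (by omega)

theorem om_single_p {n : ℕ} {S : Type*} [CommRing S] (j : Fin n) (t : Fin (2 * n) → S) :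
    om (Pi.single (pIdx j) 1) t = t (qIdx j) := by
  simp [om, Pi.single_apply, pIdx_injective.eq_iff, (pIdx_ne_qIdx _ _).symm]

theorem om_single_q {n : ℕ} {S : Type*} [CommRing S] (j : Fin n) (t : Fin (2 * n) → S) :
    om (Pi.single (qIdx j) 1) t = - t (pIdx j) := by
  simp [om, Pi.single_apply, qIdx_injective.eq_iff, pIdx_ne_qIdx]

theorem form_vecCons_eq_sum {n k : ℕ} {S : Type} [CommRing S] (ψ : NForm n (k + 1))
    (t : Fin (2 * n) → S) (v : Fin k → Fin (2 * n) → S) :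
    ψ.form S (Matrix.vecCons t v) =
      ∑ j : Fin n, (t (pIdx j) * ψ.form S (Matrix.vecCons (Pi.single (pIdx j) 1) v) +
        t (qIdx j) * ψ.form S (Matrix.vecCons (Pi.single (qIdx j) 1) v)) := by
  have h : t = ∑ γ, t γ • (Pi.single γ 1 : Fin (2 * n) → S) := by
    funext β
    simp [Finset.sum_apply, Pi.single_apply]
  rw [← sum_fin_two_mul fun γ => t γ * ψ.form S (Matrix.vecCons (Pi.single γ 1) v),
    ← AlternatingMap.curryLeft_apply_apply]
  conv_lhs => rw [h]
  rw [map_sum, alternatingMap_sum_apply]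
  refine Finset.sum_congr rfl fun γ _ => ?_
  rw [map_smul, AlternatingMap.smul_apply, AlternatingMap.curryLeft_apply_apply, smul_eq_mul]

theorem vecCons_comp_succAbove {k : ℕ} {M : Type*} (x : M) (v : Fin (k + 1) → M)
    (i : Fin (k + 1)) : (fun l => (Matrix.vecCons x v : Fin (k + 2) → M) (i.succ.succAbove l)) =
      Matrix.vecCons x fun l => v (i.succAbove l) := by
  funext l
  refine Fin.cases ?_ (fun l => ?_) l
  · simp
  · simp [Fin.succ_succAbove_succ]

theorem NForm.wedge_vecCons {n k : ℕ} {S : Type} [CommRing S] (ψ : NForm n (k + 1))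
    (t x : Fin (2 * n) → S) (v : Fin (k + 1) → Fin (2 * n) → S) :
    ψ.wedge t (Matrix.vecCons x v) = om x t * ψ.form S v -
      ∑ i : Fin (k + 1), (-1) ^ (i : ℕ) *
        (om (v i) t * ψ.form S (Matrix.vecCons x fun l => v (i.succAbove l))) := by
  rw [NForm.wedge, Fin.sum_univ_succ, sub_eq_add_neg, ← Finset.sum_neg_distrib]
  congr 1
  · simp
  · refine Finset.sum_congr rfl fun i _ => ?_
    rw [vecCons_comp_succAbove, Matrix.cons_val_succ, Fin.val_succ, pow_succ]
    ring

/-- The commutator of the contraction with the bivector `ω` and the exterior multiplication. -/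
theorem NForm.wedge_iom {n k : ℕ} {S : Type} [CommRing S] (ψ : NForm n (k + 2))
    (t : Fin (2 * n) → S) (v : Fin (k + 1) → Fin (2 * n) → S) :
    ψ.iom.wedge t v = ∑ j : Fin n, ψ.wedge t (Matrix.vecCons (Pi.single (qIdx j) 1)
      (Matrix.vecCons (Pi.single (pIdx j) 1) v)) + ψ.form S (Matrix.vecCons t v) := by
  -- The two terms in which `om · t` takes the vectors `e_q` and `e_p` itself give the coordinates
  -- of `t`; summed over `j` they form the contraction with `t`.
  have h : ∀ j : Fin n, ψ.wedge t (Matrix.vecCons (Pi.single (qIdx j) 1)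
      (Matrix.vecCons (Pi.single (pIdx j) 1) v)) =
      ∑ i : Fin (k + 1), (-1) ^ (i : ℕ) * (om (v i) t * ψ.form S
        (Matrix.vecCons (Pi.single (qIdx j) 1) (Matrix.vecCons (Pi.single (pIdx j) 1)
          fun l => v (i.succAbove l)))) -
      (t (pIdx j) * ψ.form S (Matrix.vecCons (Pi.single (pIdx j) 1) v) +
        t (qIdx j) * ψ.form S (Matrix.vecCons (Pi.single (qIdx j) 1) v)) := by
    intro j
    rw [NForm.wedge_vecCons, Fin.sum_univ_succ]
    have e : (fun l : Fin (k + 1) => (Matrix.vecCons (Pi.single (pIdx j) 1) v :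
        Fin (k + 2) → Fin (2 * n) → S) ((0 : Fin (k + 2)).succAbove l)) = v := by
      funext l; simp
    simp only [vecCons_comp_succAbove, Matrix.cons_val_zero, Matrix.cons_val_succ, om_single_p,
      om_single_q, Fin.val_zero, Fin.val_succ, pow_succ, e, mul_neg, mul_one, neg_mul,
      Finset.sum_neg_distrib]
    ring
  rw [form_vecCons_eq_sum, Finset.sum_congr rfl fun j _ => h j, Finset.sum_sub_distrib,
    sub_add_cancel, Finset.sum_comm, NForm.wedge]
  refine Finset.sum_congr rfl fun i _ => ?_
  rw [NForm.iom_apply, Finset.mul_sum, Finset.mul_sum]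

/-- A form of degree `2n + 1` in `2n` variables vanishes. Concretely, prefixing the matrix of the `v
i` with a copy of one of its columns gives determinant zero, and one expands along the new column.
-/
theorem volForm_wedge {n : ℕ} {S : Type} [CommRing S] (t : Fin (2 * n) → S)
    (v : Fin (2 * n + 1) → Fin (2 * n) → S) : (volForm n).wedge t v = 0 := by
  have key : ∀ γ : Fin (2 * n), ∑ i : Fin (2 * n + 1),
      (-1) ^ (i : ℕ) * v i γ * (volForm n).form S (fun l => v (i.succAbove l)) = 0 := by
    intro γ
    have h := Matrix.det_succ_column_zero (Matrix.of fun i => (Fin.cons (v i γ) (v i) :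
      Fin (2 * n + 1) → S))
    rw [Matrix.det_zero_of_column_eq (Fin.succ_ne_zero γ).symm (fun i => by simp)] at h
    exact h.symm
  have h : (volForm n).wedge t v = ∑ j : Fin n,
      (t (qIdx j) * ∑ i : Fin (2 * n + 1),
        (-1) ^ (i : ℕ) * v i (pIdx j) * (volForm n).form S (fun l => v (i.succAbove l)) -
      t (pIdx j) * ∑ i : Fin (2 * n + 1),
        (-1) ^ (i : ℕ) * v i (qIdx j) * (volForm n).form S (fun l => v (i.succAbove l))) := by
    simp only [Finset.mul_sum, ← Finset.sum_sub_distrib]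
    rw [Finset.sum_comm]
    refine Finset.sum_congr rfl fun i _ => ?_
    rw [om, Finset.sum_mul, Finset.mul_sum]
    exact Finset.sum_congr rfl fun j _ => by ring
  rw [h]
  exact Finset.sum_eq_zero fun j _ => by rw [key, key]; ring

/-- `∑_j (l ∧ ψ)(e_{q_j}, e_{p_j}, ·) = c ψ(t, ·)` for all `t`, where `l = ω(·, t)`. -/
def NForm.Lefschetz {n k : ℕ} (ψ : NForm n (k + 2)) (c : ℕ) : Prop :=
  ∀ (S : Type) [CommRing S] (t : Fin (2 * n) → S) (v : Fin (k + 1) → Fin (2 * n) → S),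
    ∑ j : Fin n, ψ.wedge t (Matrix.vecCons (Pi.single (qIdx j) 1)
      (Matrix.vecCons (Pi.single (pIdx j) 1) v)) = c * ψ.form S (Matrix.vecCons t v)

theorem NForm.Lefschetz.wedge_iom {n k : ℕ} {ψ : NForm n (k + 2)} {c : ℕ} (h : ψ.Lefschetz c)
    {S : Type} [CommRing S] (t : Fin (2 * n) → S) (v : Fin (k + 1) → Fin (2 * n) → S) :
    ψ.iom.wedge t v = (c + 1) * ψ.form S (Matrix.vecCons t v) := by
  rw [NForm.wedge_iom, h]
  ring

theorem alternatingMap_vecCons_swap {R M N : Type*} [CommRing R] [AddCommGroup M] [AddCommGroup N]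
    [Module R M] [Module R N] {k : ℕ} (f : M [⋀^Fin (k + 2)]→ₗ[R] N) (x y : M) (v : Fin k → M) :
    f (Matrix.vecCons x (Matrix.vecCons y v)) = - f (Matrix.vecCons y (Matrix.vecCons x v)) := by
  have h : (Matrix.vecCons x (Matrix.vecCons y v)) =
      (Matrix.vecCons y (Matrix.vecCons x v)) ∘ Equiv.swap (0 : Fin (k + 2)) 1 := by
    funext i
    refine Fin.cases ?_ (fun i => Fin.cases ?_ (fun i => ?_) i) i
    · simp
    · simp
    · have e1 : (i.succ.succ : Fin (k + 2)) ≠ 0 := Fin.succ_ne_zero _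
      have e2 : (i.succ.succ : Fin (k + 2)) ≠ 1 := by
        rw [← Fin.succ_zero_eq_one, Ne, Fin.succ_inj]; exact Fin.succ_ne_zero _
      rw [Function.comp_apply, Equiv.swap_apply_of_ne_of_ne e1 e2]
      rfl
  rw [h, AlternatingMap.map_swap _ _ (by simp)]

theorem alternatingMap_vecCons_rotate {R M N : Type*} [CommRing R] [AddCommGroup M]
    [AddCommGroup N] [Module R M] [Module R N] {k : ℕ} (f : M [⋀^Fin (k + 3)]→ₗ[R] N) (x y z : M)
    (v : Fin k → M) : f (Matrix.vecCons x (Matrix.vecCons y (Matrix.vecCons z v))) =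
      f (Matrix.vecCons y (Matrix.vecCons z (Matrix.vecCons x v))) := by
  rw [alternatingMap_vecCons_swap, ← AlternatingMap.curryLeft_apply_apply,
    alternatingMap_vecCons_swap, neg_neg, AlternatingMap.curryLeft_apply_apply]

/-- Each contraction raises the constant by one through the commutator; moving `t` past `e_q` and
`e_p` is an even permutation. -/
theorem NForm.Lefschetz.iom {n k : ℕ} {ψ : NForm n (k + 4)} {c : ℕ} (h : ψ.Lefschetz c) :
    ψ.iom.Lefschetz (c + 1) := by
  intro S _ t v
  rw [NForm.iom_apply, Finset.mul_sum]
  refine Finset.sum_congr rfl fun j _ => ?_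
  rw [h.wedge_iom, alternatingMap_vecCons_rotate]
  push_cast
  rfl

/-- Of the summands of `t` only `row 0` is not already among the arguments. This matches the
contraction with `t` coming from `d` with the shape of `Rep.connesB`. -/
theorem form_sum_row {n k : ℕ} (ψ : NForm n (k + 1)) :
    ψ.form (Tens n (k + 1)) (Matrix.vecCons (∑ j, row j) fun i => row i.succ) =
      ψ.form _ fun i => row i := by
  rw [← AlternatingMap.curryLeft_apply_apply, map_sum, alternatingMap_sum_apply,
    Fin.sum_univ_succ, Finset.sum_eq_zero, add_zero, AlternatingMap.curryLeft_apply_apply]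
  · congr 1
    funext i
    refine Fin.cases ?_ (fun i => ?_) i <;> rfl
  · intro i _
    rw [AlternatingMap.curryLeft_apply_apply]
    exact AlternatingMap.map_eq_zero_of_eq _ _ (i := 0) (j := i.succ) rfl (Fin.succ_ne_zero i).symm

theorem hochD_rep_iom {n k c : ℕ} {ψ : NForm n (k + 2)} {φ : Cochain (Weyl n) (k + 2)}
    {φ' : Cochain (Weyl n) k} (h : Rep ψ φ) (h' : Rep ψ.iom φ') (hc : ψ.Lefschetz c) :
    hochD k φ' = -((c : ℂ) + 1) • connesB (k + 1) φ := by
  refine Subtype.ext (MultilinearMap.ext fun a => ?_)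
  rw [h'.hochD]
  change _ = -((c : ℂ) + 1) * (connesB (k + 1) φ).1 a
  rw [h.connesB, neg_mul, ← MeasureTheory.integral_const_mul]
  congr 1
  refine MeasureTheory.integral_congr_ae (Filter.Eventually.of_forall fun u => ?_)
  have hC : ((c : Tens n (k + 2)) + 1) = MvPolynomial.C ((c : ℂ) + 1) := by simp
  dsimp only
  rw [hc.wedge_iom, form_sum_row, hC, J_C_mul]

theorem exists_rep_iotaOmega_pow (n : ℕ) : ∀ j k : ℕ, k + 2 * j = 2 * n →
    ∃ (ψ : NForm n k) (φ : Cochain (Weyl n) k),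
      (iotaOmega n ^ j) (ofDeg (2 * n) (tau n)) = ofDeg k φ ∧ Rep ψ φ := by
  intro j
  induction j with
  | zero =>
    intro k hk
    obtain rfl : k = 2 * n := by omega
    exact ⟨volForm n, tau n, by simp, rep_tau n⟩
  | succ j ih =>
    intro k hk
    obtain ⟨ψ, φ, h1, h2⟩ := ih (k + 2) (by omega)
    obtain ⟨φ', h3, h4⟩ := h2.iotaOmega
    exact ⟨ψ.iom, φ', by rw [pow_succ', Module.End.mul_apply, h1, h3], h4⟩

theorem exists_lefschetz_iotaOmega_pow (n : ℕ) : ∀ j k : ℕ, k + 2 + 2 * j = 2 * n →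
    ∃ (ψ : NForm n (k + 2)) (φ : Cochain (Weyl n) (k + 2)),
      (iotaOmega n ^ j) (ofDeg (2 * n) (tau n)) = ofDeg (k + 2) φ ∧ Rep ψ φ ∧ ψ.Lefschetz j := by
  intro j
  induction j with
  | zero =>
    intro k hk
    -- The degree `k + 2` equals `2 * n` only propositionally, so the statement is generalized to a
    -- variable degree. The initial constant is `0` because the exterior product with the volume
    -- form vanishes.
    have key : ∀ m (hm : m = 2 * n), ∃ (ψ : NForm n m) (φ : Cochain (Weyl n) m),
        ofDeg (2 * n) (tau n) = ofDeg m φ ∧ Rep ψ φ ∧ ∀ (S : Type) [CommRing S]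
          (t : Fin (2 * n) → S) (v : Fin (m + 1) → Fin (2 * n) → S), ψ.wedge t v = 0 := by
      rintro m rfl
      exact ⟨volForm n, tau n, rfl, rep_tau n, fun S _ t v => volForm_wedge t v⟩
    obtain ⟨ψ, φ, h1, h2, h3⟩ := key (k + 2) (by omega)
    refine ⟨ψ, φ, by simpa using h1, h2, fun S _ t v => ?_⟩
    rw [Nat.cast_zero, zero_mul]
    exact Finset.sum_eq_zero fun j _ => h3 _ _ _
  | succ j ih =>
    intro k hk
    obtain ⟨ψ, φ, h1, h2, h3⟩ := ih (k + 2) (by omega)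
    obtain ⟨φ', h4, h5⟩ := h2.iotaOmega
    exact ⟨ψ.iom, φ', by rw [pow_succ', Module.End.mul_apply, h1, h4], h5, h3.iom⟩

/-! ### The descent relations and the exponential series -/

theorem dTot_ofDeg {A : Type*} [Ring A] [Algebra ℂ A] (k : ℕ) (φ : Cochain A k) :
    dTot (ofDeg k φ) = ofDeg (k + 1) (hochD k φ) := by
  simp [dTot, ofDeg, DirectSum.toModule_lof]

theorem dTot_tau (n : ℕ) : dTot (ofDeg (2 * n) (tau n)) = 0 := by
  rw [dTot_ofDeg]
  have : hochD (2 * n) (tau n) = 0 := by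
    refine Subtype.ext (MultilinearMap.ext fun a => ?_)
    rw [(rep_tau n).hochD]
    change _ = 0
    simp only [volForm_wedge, J_zero, MeasureTheory.integral_zero, neg_zero]
  rw [this, map_zero]

theorem dTot_iotaOmega_pow_succ (n j : ℕ) :
    dTot ((iotaOmega n ^ (j + 1)) (ofDeg (2 * n) (tau n))) =
      -((j : ℂ) + 1) • bTot ((iotaOmega n ^ j) (ofDeg (2 * n) (tau n))) := by
  rcases lt_or_ge j n with hj | hj
  · obtain ⟨k, hk⟩ : ∃ k, k + 2 + 2 * j = 2 * n := ⟨2 * n - 2 * j - 2, by omega⟩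
    obtain ⟨ψ, φ, h1, h2, h3⟩ := exists_lefschetz_iotaOmega_pow n j k hk
    obtain ⟨φ', h4, h5⟩ := h2.iotaOmega
    rw [pow_succ', Module.End.mul_apply, h1, h4, dTot_ofDeg, hochD_rep_iom h2 h5 h3, map_smul, bTot,
      lowering_succ]
  -- For `j = n` the right side is `B` of a cochain of degree `0`; for `j > n` the power of `ι_ω` is
  -- already zero.
  · rw [iotaOmega_pow (j + 1) (2 * n) (by omega), map_zero]
    rcases hj.eq_or_lt with rfl | hj
    · obtain ⟨ψ, φ, h1, -⟩ := exists_rep_iotaOmega_pow n n 0 (by omega)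
      rw [h1, bTot, lowering_zero, smul_zero]
    · rw [iotaOmega_pow j (2 * n) (by omega), map_zero, smul_zero]

theorem iota_iotaOmega_pow {n : ℕ} {a : Weyl n} (ha : a ∈ sp n) (j : ℕ) :
    iota a ((iotaOmega n ^ j) (ofDeg (2 * n) (tau n))) = 0 := by
  rcases lt_or_ge n j with hj | hj
  · rw [iotaOmega_pow j (2 * n) (by omega), map_zero]
  · obtain ⟨k, hk⟩ : ∃ k, k + 2 * j = 2 * n := ⟨2 * n - 2 * j, by omega⟩
    obtain ⟨ψ, φ, h1, h2⟩ := exists_rep_iotaOmega_pow n j k hk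
    rw [h1, iota]
    match k, ψ, φ, h2 with
    | 0, _, φ, _ => rw [lowering_zero]
    | k + 1, ψ, φ, h2 => rw [lowering_succ, h2.contr_sp ha, map_zero]

section Coefficients

variable {W : Type*} [AddCommGroup W] [Module ℂ W] [Module (Polynomial ℂ) W]
  [IsScalarTower ℂ (Polynomial ℂ) W]

theorem tauW_eq_sum (n : ℕ) (w : W) : tauW n w = ∑ j ∈ Finset.range (n + 1),
    ((j.factorial : ℂ)⁻¹) • ((iotaOmega n ^ j) (ofDeg (2 * n) (tau n)) ⊗ₜ[ℂ] (uAct W ^ j) w) := by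
  have h : (uOp W (iotaOmega n) ^ (n + 1)) (ofDeg (2 * n) (tau n) ⊗ₜ[ℂ] w) = 0 := by
    rw [uOp, TensorProduct.map_pow, TensorProduct.map_tmul, iotaOmega_pow _ _ (by omega),
      TensorProduct.zero_tmul]
  rw [tauW, locExp_eq_sum h]
  refine Finset.sum_congr rfl fun j _ => ?_
  rw [uOp, TensorProduct.map_pow, TensorProduct.map_tmul]

/-- With `T j` the image of the `j`-th term under `u B`, the descent relation says that `d` maps
term `j + 1` to `-T j`. The factor `j + 1` turns `1/(j+1)!` into `1/j!`, so everything cancels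
except `T n`, which is zero because the `n`-th term has degree `0`. -/
theorem cycD_tauW (n : ℕ) (w : W) : cycD W (tauW n w) = 0 := by
  let T : ℕ → Cyc (Weyl n) W := fun j => ((j.factorial : ℂ)⁻¹) •
    (bTot ((iotaOmega n ^ j) (ofDeg (2 * n) (tau n))) ⊗ₜ[ℂ] (uAct W ^ (j + 1)) w)
  have hd : ∀ j, dTot.rTensor W (((j.factorial : ℂ)⁻¹) • ((iotaOmega n ^ j)
      (ofDeg (2 * n) (tau n)) ⊗ₜ[ℂ] (uAct W ^ j) w)) =
      if j = 0 then 0 else (-1 : ℂ) • T (j - 1) := by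
    intro j
    rw [map_smul, LinearMap.rTensor_tmul]
    cases j with
    | zero => rw [pow_zero, Module.End.one_apply, dTot_tau]; simp
    | succ j =>
      rw [dTot_iotaOmega_pow_succ, TensorProduct.smul_tmul', smul_smul, if_neg (Nat.succ_ne_zero j),
        Nat.add_sub_cancel, smul_smul, Nat.factorial_succ, ← TensorProduct.smul_tmul']
      congr 1
      have : (j : ℂ) + 1 ≠ 0 := by exact_mod_cast Nat.succ_ne_zero j
      have h2 : (j.factorial : ℂ) ≠ 0 := by exact_mod_cast Nat.factorial_ne_zero j
      push_cast
      field_simp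
  have hb : ∀ j, uOp W bTot (((j.factorial : ℂ)⁻¹) • ((iotaOmega n ^ j)
      (ofDeg (2 * n) (tau n)) ⊗ₜ[ℂ] (uAct W ^ j) w)) = T j := by
    intro j
    rw [map_smul, uOp, TensorProduct.map_tmul]
    simp only [T, pow_succ', Module.End.mul_apply]
  have hlast : T n = 0 := by
    obtain ⟨ψ, φ, h1, -⟩ := exists_rep_iotaOmega_pow n n 0 (by omega)
    simp only [T]
    rw [h1, bTot, lowering_zero, TensorProduct.zero_tmul, smul_zero]
  rw [cycD, tauW_eq_sum, LinearMap.add_apply, map_sum, map_sum]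
  simp only [hd, hb]
  rw [Finset.sum_range_succ', Finset.sum_range_succ, hlast]
  simp only [Nat.succ_ne_zero, if_false, if_true, Nat.add_sub_cancel, add_zero]
  rw [← Finset.sum_add_distrib]
  refine Finset.sum_eq_zero fun j _ => ?_
  rw [← one_smul ℂ (T j), smul_smul, ← add_smul]
  norm_num

theorem iota_tauW (n : ℕ) (w : W) {a : Weyl n} (ha : a ∈ sp n) :
    (iota a).rTensor W (tauW n w) = 0 := by
  rw [tauW_eq_sum, map_sum]
  refine Finset.sum_eq_zero fun j _ => ?_
  rw [map_smul, LinearMap.rTensor_tmul, iota_iotaOmega_pow ha, TensorProduct.zero_tmul, smul_zero]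

end Coefficients

/-! ### Evaluation on the volume chain -/

/-- Integrating out one point in each of its `m + 1` positions shows that `m + 1` times one volume
is the previous volume. -/
theorem integral_openSimplex_one (m : ℕ) :
    ∫ _u in openSimplex m, (1 : ℂ) = ((m.factorial : ℂ))⁻¹ := by
  induction m with
  | zero =>
    have : openSimplex 0 = Set.univ := Set.eq_univ_of_forall fun u =>
      ⟨fun i => i.elim0, fun i => i.elim0⟩
    rw [this, MeasureTheory.setIntegral_univ, MeasureTheory.volume_pi,
      MeasureTheory.Measure.pi_of_empty,
      MeasureTheory.integral_dirac]
    simp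
  | succ m ih =>
    have h := sum_integral_comp_succAbove (k := m) (g := fun _ => (1 : ℂ)) continuous_const
    rw [Finset.sum_const, Finset.card_univ, Fintype.card_fin, nsmul_eq_mul, ih] at h
    have h1 : ((m : ℂ) + 1) ≠ 0 := by exact_mod_cast Nat.succ_ne_zero m
    have h2 : (m.factorial : ℂ) ≠ 0 := by exact_mod_cast Nat.factorial_ne_zero m
    rw [Nat.factorial_succ]
    push_cast at h ⊢
    rw [mul_inv, ← h, inv_mul_cancel_left₀ h1]

theorem sym_prod_X_apply {n k : ℕ} (ρ σ : Fin k → Fin (2 * n)) (s : Finset (Fin k)) :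
    sym n (k + 1) (∏ i ∈ s, MvPolynomial.X (i.succ, ρ i))
      (∏ i ∈ s, MvPolynomial.X (i.succ, σ i)) =
      MvPolynomial.C (∏ i ∈ s, if ρ i = σ i then 1 else 0) := by
  classical
  induction s using Finset.induction_on with
  | empty => simp
  | insert i s hi ih =>
    have h1 : MvPolynomial.pderiv (i.succ, ρ i)
        (∏ i ∈ s, (MvPolynomial.X (i.succ, σ i) : Tens n (k + 1))) = 0 := by
      apply MvPolynomial.pderiv_eq_zero_of_notMem_vars
      intro hm
      obtain ⟨l, hl, hl'⟩ := Finset.mem_biUnion.1 (MvPolynomial.vars_prod _ hm)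
      rw [MvPolynomial.vars_X, Finset.mem_singleton, Prod.mk.injEq, Fin.succ_inj] at hl'
      exact hi (hl'.1 ▸ hl)
    have h2 : MvPolynomial.pderiv (i.succ, ρ i) (MvPolynomial.X (i.succ, σ i) : Tens n (k + 1)) =
        MvPolynomial.C (if ρ i = σ i then 1 else 0) := by
      by_cases h : ρ i = σ i
      · rw [h]; simp
      · rw [MvPolynomial.pderiv_X_of_ne fun h' => h (congrArg Prod.snd h').symm, if_neg h, map_zero]
    rw [Finset.prod_insert hi, Finset.prod_insert hi, Finset.prod_insert hi,
      mul_comm (MvPolynomial.X (i.succ, ρ i)),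
      sym_mul_apply, sym_X, slotD_apply, MvPolynomial.pderiv_mul, h1, h2, mul_zero, add_zero,
      ← MvPolynomial.smul_eq_C_mul, map_smul, ih, MvPolynomial.smul_eq_C_mul, ← map_mul]

theorem wt_cons_one_y {n k : ℕ} (σ : Fin k → Fin (2 * n)) :
    wt (Fin.cons 1 fun i => Weyl.y (σ i) : Fin (k + 1) → Weyl n) =
      ∏ i, MvPolynomial.X (i.succ, σ i) := by
  have h : ∀ β : Fin (2 * n), Weyl.toPoly (Weyl.y β) = MvPolynomial.X β := fun _ => rfl
  rw [wt, tens_apply, Fin.prod_univ_succ]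
  simp [Weyl.toPoly_one, h]

/-- Only the term of the determinant whose permutation matches `σ` slot by slot survives. The result
is constant, so the exponential acts trivially on it and the integral is the volume of the simplex.
-/
theorem piOp_wt_y {n : ℕ} (σ : Equiv.Perm (Fin (2 * n))) :
    piOp n (wt (Fin.cons 1 fun i => Weyl.y (σ i))) =
      MvPolynomial.C ((Equiv.Perm.sign σ : ℤ) : ℂ) := by
  classical
  have hdet : (Matrix.detRowAlternating fun i : Fin (2 * n) => row (n := n) i.succ) =
      ∑ ρ : Equiv.Perm (Fin (2 * n)), ((Equiv.Perm.sign ρ : ℤ) : ℂ) •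
        ∏ i, (MvPolynomial.X (i.succ, ρ i) : Tens n (2 * n + 1)) := by
    change Matrix.det (Matrix.of fun i : Fin (2 * n) => row (n := n) i.succ) = _
    rw [← Matrix.det_transpose, Matrix.det_apply']
    refine Finset.sum_congr rfl fun ρ _ => ?_
    rw [MvPolynomial.smul_eq_C_mul]
    simp [row]
  rw [piOp_eq, hdet, wt_cons_one_y, map_sum, LinearMap.sum_apply, Finset.sum_eq_single σ]
  · rw [map_smul, LinearMap.smul_apply, sym_prod_X_apply, MvPolynomial.smul_eq_C_mul, ← map_mul]
    simp
  · intro ρ _ hρ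
    obtain ⟨i, hi⟩ : ∃ i, ρ i ≠ σ i := by
      by_contra! h
      exact hρ (Equiv.ext h)
    rw [map_smul, LinearMap.smul_apply, sym_prod_X_apply,
      Finset.prod_eq_zero (Finset.mem_univ i) (if_neg hi), map_zero, smul_zero]
  · intro h; exact absurd (Finset.mem_univ _) h

theorem integrand_C {n : ℕ} (u : Fin (2 * n) → ℝ) (c : ℂ) :
    integrand n (MvPolynomial.C c) u = c := by
  rw [integrand, locExp_of_apply_eq_zero, MvPolynomial.constantCoeff_C]
  simp [exponent, LinearMap.sum_apply, alpha, slotD_apply]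

theorem tau_y {n : ℕ} (σ : Equiv.Perm (Fin (2 * n))) :
    (tau n).1 (Fin.cons 1 fun i => Weyl.y (σ i)) =
      ((Equiv.Perm.sign σ : ℤ) : ℂ) * (((2 * n).factorial : ℂ))⁻¹ := by
  change ∫ u in openSimplex (2 * n),
    integrand n (piOp n (wt (Fin.cons 1 fun i => Weyl.y (σ i)))) u = _
  rw [piOp_wt_y, ← integral_openSimplex_one, ← MeasureTheory.integral_const_mul]
  simp only [integrand_C, mul_one]

/-- The degree is kept as a variable so that the formula applies to `hochD k φ`, whose degree `k +
1` is not syntactically `2 * n`. -/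
theorem evalVol_ofDeg {n m : ℕ} (h : m = 2 * n) (φ : Cochain (Weyl n) m) :
    evalVol n (ofDeg m φ) = ∑ σ : Equiv.Perm (Fin m), ((Equiv.Perm.sign σ : ℤ) : ℂ) *
      φ.1 (Fin.cons 1 fun i => Weyl.y (Fin.cast h (σ i))) := by
  subst h
  rw [evalVol, LinearMap.comp_apply, ofDeg, DirectSum.component.lof_self, LinearMap.sum_apply]
  rfl

theorem evalVol_ofDeg_of_ne {n m : ℕ} (h : m ≠ 2 * n) (φ : Cochain (Weyl n) m) :
    evalVol n (ofDeg m φ) = 0 := by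
  rw [evalVol, LinearMap.comp_apply, ofDeg, DirectSum.component.of, dif_neg h, map_zero]

theorem evalVol_tau (n : ℕ) : evalVol n (ofDeg (2 * n) (tau n)) = 1 := by
  rw [evalVol_ofDeg rfl]
  have h : ∀ σ : Equiv.Perm (Fin (2 * n)), ((Equiv.Perm.sign σ : ℤ) : ℂ) *
      (tau n).1 (Fin.cons 1 fun i => Weyl.y (Fin.cast rfl (σ i))) =
      (((2 * n).factorial : ℂ))⁻¹ := by
    intro σ
    have h1 : ((Equiv.Perm.sign σ : ℤ) : ℂ) * ((Equiv.Perm.sign σ : ℤ) : ℂ) = 1 := by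
      rw [← Int.cast_mul, Int.units_coe_mul_self, Int.cast_one]
    have h2 := tau_y σ
    simp only [Fin.cast_eq_self]
    rw [h2, ← mul_assoc, h1, one_mul]
  rw [Finset.sum_congr rfl fun σ _ => h σ, Finset.sum_const, Finset.card_univ, Fintype.card_perm,
    Fintype.card_fin, nsmul_eq_mul, mul_inv_cancel₀]
  exact_mod_cast Nat.factorial_ne_zero _

/-! ### The volume chain is a cycle -/

section Cycle

variable {A : Type*} [Ring A] [Algebra ℂ A]

theorem connesB_cons_one {k : ℕ} (φ : Cochain A (k + 1)) (y : Fin k → A) :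
    (connesB k φ).1 (Fin.cons 1 y) = 0 := by
  change preB k φ.1 _ = 0
  rw [preB_apply]
  refine Finset.sum_eq_zero fun j _ => ?_
  -- Rotation by `j` moves the unit from slot `0` to the slot `(-j).succ`, where a normalized
  -- cochain vanishes.
  rw [φ.2 _ (-j), mul_zero]
  simp [rotate]

/-- Exchanging the two multiplied entries changes the product by a commutator, a multiple of `1` in
a slot with positive index, which a normalized cochain does not see. So the signed sum equals its
own negative. -/
theorem sum_sign_innerFace {k : ℕ} (φ : Cochain A k) (y : Fin (k + 1) → A)
    (hy : ∀ i j, ∃ c : ℂ, y i * y j - y j * y i = c • (1 : A)) (l : Fin k) :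
    ∑ σ : Equiv.Perm (Fin (k + 1)), ((Equiv.Perm.sign σ : ℤ) : ℂ) *
      φ.1 (innerFace l.succ (Fin.cons 1 fun i => y (σ i))) = 0 := by
  let s : Equiv.Perm (Fin (k + 1)) := Equiv.swap l.castSucc l.succ
  have hs : Equiv.Perm.sign s = -1 := Equiv.Perm.sign_swap (Fin.castSucc_lt_succ).ne
  have hupd : ∀ σ : Equiv.Perm (Fin (k + 1)),
      innerFace l.succ (Fin.cons 1 fun i => y ((σ * s) i)) =
      Function.update (innerFace l.succ (Fin.cons 1 fun i => y (σ i))) l.succ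
        (y (σ l.succ) * y (σ l.castSucc)) := by
    intro σ
    funext i
    by_cases hi : i = l.succ
    · subst hi
      rw [Function.update_self, innerFace_apply, if_neg (lt_irrefl _), if_pos rfl,
        ← Fin.succ_castSucc, Fin.cons_succ, Fin.cons_succ]
      simp [s]
    · rw [Function.update_of_ne hi, innerFace_apply, innerFace_apply]
      have hi' : (i : ℕ) ≠ l + 1 := fun h => hi (Fin.ext (by simpa using h))
      have hfix : ∀ p : Fin (k + 1), (p : ℕ) ≠ l → (p : ℕ) ≠ l + 1 → s p = p := fun p h1 h2 =>
        Equiv.swap_apply_of_ne_of_ne (fun h => h1 (by simp [h])) fun h => h2 (by simp [h])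
      have hv : ((l.succ : Fin (k + 1)) : ℕ) = l + 1 := Fin.val_succ l
      rw [hv, if_neg hi', if_neg hi']
      split_ifs with h
      · refine Fin.cases (fun _ => rfl) (fun p hp => ?_) i h
        rw [← Fin.succ_castSucc, Fin.cons_succ, Fin.cons_succ, Equiv.Perm.mul_apply, hfix]
        · simp at hp ⊢; omega
        · simp at hp ⊢; omega
      · rw [Fin.cons_succ, Fin.cons_succ, Equiv.Perm.mul_apply, hfix]
        · omega
        · omega
  have hself : ∀ σ : Equiv.Perm (Fin (k + 1)),
      innerFace l.succ (Fin.cons 1 fun i => y (σ i)) =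
      Function.update (innerFace l.succ (Fin.cons 1 fun i => y (σ i))) l.succ
        (y (σ l.castSucc) * y (σ l.succ)) := by
    intro σ
    rw [eq_comm, Function.update_eq_self_iff, innerFace_apply, if_neg (lt_irrefl _), if_pos rfl,
      ← Fin.succ_castSucc, Fin.cons_succ, Fin.cons_succ]
  have heq : ∀ σ : Equiv.Perm (Fin (k + 1)),
      φ.1 (innerFace l.succ (Fin.cons 1 fun i => y ((σ * s) i))) =
      φ.1 (innerFace l.succ (Fin.cons 1 fun i => y (σ i))) := by
    intro σ
    obtain ⟨c, hc⟩ := hy (σ l.succ) (σ l.castSucc)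
    rw [hupd, ← sub_eq_zero]
    nth_rewrite 2 [hself]
    rw [← MultilinearMap.map_update_sub, hc, MultilinearMap.map_update_smul, φ.2 _ l, smul_zero]
    rw [Function.update_self]
  have h := Equiv.sum_comp (Equiv.mulRight s) fun σ : Equiv.Perm (Fin (k + 1)) =>
    ((Equiv.Perm.sign σ : ℤ) : ℂ) * φ.1 (innerFace l.succ (Fin.cons 1 fun i => y (σ i)))
  simp only [Equiv.coe_mulRight, heq, Equiv.Perm.sign_mul, hs, mul_neg, mul_one, Units.val_neg,
    Int.cast_neg, neg_mul, Finset.sum_neg_distrib] at h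
  exact self_eq_neg.1 h.symm

/-- The inner faces vanish by `sum_sign_innerFace`. The first and the last face only remove the
unit, and they differ by a cyclic rotation of sign `(-1)^k`; with the sign `(-1)^(k+1)` of the last
face they cancel. -/
theorem sum_sign_hochD {k : ℕ} (φ : Cochain A k) (y : Fin (k + 1) → A)
    (hy : ∀ i j, ∃ c : ℂ, y i * y j - y j * y i = c • (1 : A)) :
    ∑ σ : Equiv.Perm (Fin (k + 1)), ((Equiv.Perm.sign σ : ℤ) : ℂ) *
      (hochD k φ).1 (Fin.cons 1 fun i => y (σ i)) = 0 := by
  have h : ∀ σ : Equiv.Perm (Fin (k + 1)), (hochD k φ).1 (Fin.cons 1 fun i => y (σ i)) =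
      φ.1 (fun i => y (σ i)) + ∑ l : Fin k, (-1) ^ ((l : ℕ) + 1) *
        φ.1 (innerFace l.succ (Fin.cons 1 fun i => y (σ i))) +
      (-1) ^ (k + 1) * φ.1 (fun i => y ((σ * (finRotate (k + 1))⁻¹) i)) := by
    intro σ
    change preD k φ.1 _ = _
    have e0 : innerFace 0 (Fin.cons 1 fun i => y (σ i) : Fin (k + 2) → A) = fun i => y (σ i) := by
      funext i
      rw [innerFace_apply, if_neg (by simp)]
      split_ifs with h
      · obtain rfl : i = 0 := Fin.ext (by simpa using h)
        rw [Fin.cons_succ, Fin.castSucc_zero, Fin.cons_zero, one_mul]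
      · rw [Fin.cons_succ]
    have e1 : lastFace (Fin.cons 1 fun i => y (σ i) : Fin (k + 2) → A) =
        fun i => y ((σ * (finRotate (k + 1))⁻¹) i) := by
      funext i
      have hr : ∀ p q : Fin (k + 1), finRotate (k + 1) q = p →
          (σ * (finRotate (k + 1))⁻¹) p = σ q := by
        rintro _ q rfl
        simp
      refine Fin.cases ?_ (fun i => ?_) i
      · rw [lastFace, Function.update_self, Fin.cons_zero, mul_one, ← Fin.succ_last, Fin.cons_succ,
          hr 0 (Fin.last k) finRotate_last]
      · rw [lastFace, Function.update_of_ne (Fin.succ_ne_zero i), ← Fin.succ_castSucc,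
          Fin.cons_succ, hr i.succ i.castSucc (by simp)]
    rw [preD_apply, Fin.sum_univ_succ, e0, e1]
    simp
  have hr : ∑ σ : Equiv.Perm (Fin (k + 1)), ((Equiv.Perm.sign σ : ℤ) : ℂ) *
      φ.1 (fun i => y ((σ * (finRotate (k + 1))⁻¹) i)) =
      (-1) ^ k * ∑ σ : Equiv.Perm (Fin (k + 1)), ((Equiv.Perm.sign σ : ℤ) : ℂ) *
        φ.1 (fun i => y (σ i)) := by
    rw [← Equiv.sum_comp (Equiv.mulRight (finRotate (k + 1))), Finset.mul_sum]
    refine Finset.sum_congr rfl fun σ _ => ?_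
    rw [Equiv.coe_mulRight, mul_inv_cancel_right, Equiv.Perm.sign_mul, sign_finRotate]
    push_cast
    ring
  simp only [h, mul_add, Finset.sum_add_distrib, Finset.mul_sum]
  rw [Finset.sum_comm]
  have h2 : ∀ l : Fin k, ∑ σ : Equiv.Perm (Fin (k + 1)), ((Equiv.Perm.sign σ : ℤ) : ℂ) *
      ((-1) ^ ((l : ℕ) + 1) * φ.1 (innerFace l.succ (Fin.cons 1 fun i => y (σ i)))) = 0 := by
    intro l
    simp only [mul_left_comm _ ((-1 : ℂ) ^ ((l : ℕ) + 1)), ← Finset.mul_sum,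
      sum_sign_innerFace φ y hy, mul_zero]
  simp only [h2, Finset.sum_const_zero, add_zero, mul_left_comm _ ((-1 : ℂ) ^ (k + 1)),
    ← Finset.mul_sum, hr]
  rw [← mul_assoc, ← pow_add]
  have : (-1 : ℂ) ^ (k + 1 + k) = -1 := Odd.neg_one_pow ⟨k, by ring⟩
  rw [this]
  ring

end Cycle

/-! ### Nontriviality in the Weyl algebra -/

theorem toPoly_y_mul_y {n : ℕ} (β γ : Fin (2 * n)) : ∃ c : ℂ,
    Weyl.toPoly (Weyl.y β * Weyl.y γ) = MvPolynomial.X β * MvPolynomial.X γ + MvPolynomial.C c := by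
  classical
  have hx : tens n 2 ![MvPolynomial.X β, MvPolynomial.X γ] =
      MvPolynomial.X (0, β) * MvPolynomial.X (1, γ) := by
    simp [tens_apply, Fin.prod_univ_two]
  have hs : ∀ p q, ∃ c : ℂ, slotD (0 : Fin 2) p (slotD 1 q
      (MvPolynomial.X (0, β) * MvPolynomial.X (1, γ) : Tens n 2)) = MvPolynomial.C c := by
    intro p q
    refine ⟨(if β = p then 1 else 0) * (if γ = q then 1 else 0), ?_⟩
    by_cases h1 : β = p <;> by_cases h2 : γ = q <;>
      simp [slotD_apply, MvPolynomial.pderiv_X, h1, h2]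
  choose c hc using hs
  have ha : ((1 / 2 : ℂ) • alpha (n := n) (0 : Fin 2) 1)
      (MvPolynomial.X (0, β) * MvPolynomial.X (1, γ)) =
      MvPolynomial.C ((1 / 2 : ℂ) * ∑ j : Fin n, (c (pIdx j) (qIdx j) - c (qIdx j) (pIdx j))) := by
    simp only [LinearMap.smul_apply, alpha, LinearMap.sum_apply, LinearMap.sub_apply,
      Module.End.mul_apply, hc, MvPolynomial.smul_eq_C_mul, map_mul, map_sum, map_sub]
  -- On a product of two linear factors `alpha` already yields a constant, so the exponential series
  -- stops after the linear term.
  have h2 : (((1 / 2 : ℂ) • alpha (n := n) (0 : Fin 2) 1) ^ 2)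
      (MvPolynomial.X (0, β) * MvPolynomial.X (1, γ)) = 0 := by
    rw [pow_two, Module.End.mul_apply, ha]
    simp [alpha, LinearMap.sum_apply, slotD_apply]
  refine ⟨(1 / 2 : ℂ) * ∑ j : Fin n, (c (pIdx j) (qIdx j) - c (qIdx j) (pIdx j)), ?_⟩
  · change mulSlots n 2 (locExp _ (tens n 2 ![MvPolynomial.X β, MvPolynomial.X γ])) = _
    rw [hx, locExp_eq_sum h2, Finset.sum_range_succ, Finset.sum_range_one, pow_one, ha]
    simp only [Nat.factorial_zero, Nat.factorial_one, Nat.cast_one, inv_one, one_smul, pow_zero,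
      Module.End.one_apply, map_add, map_mul, mulSlots, MvPolynomial.rename_X,
      MvPolynomial.rename_C]

theorem y_commutator {n : ℕ} (β γ : Fin (2 * n)) :
    ∃ c : ℂ, Weyl.y β * Weyl.y γ - Weyl.y γ * Weyl.y β = c • (1 : Weyl n) := by
  obtain ⟨c, hc⟩ := toPoly_y_mul_y β γ
  obtain ⟨c', hc'⟩ := toPoly_y_mul_y γ β
  refine ⟨c - c', Weyl.toPoly.injective ?_⟩
  rw [map_sub, hc, hc', map_smul, Weyl.toPoly_one, MvPolynomial.smul_eq_C_mul, map_sub]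
  ring

theorem evalVol_comp_dTot (n : ℕ) : (evalVol n).comp dTot = 0 := by
  refine DirectSum.linearMap_ext ℂ fun k => LinearMap.ext fun φ => ?_
  change evalVol n (dTot (ofDeg k φ)) = 0
  rw [dTot_ofDeg]
  by_cases h : k + 1 = 2 * n
  · rw [evalVol_ofDeg h]
    exact sum_sign_hochD φ (fun i => Weyl.y (Fin.cast h i)) fun i j => y_commutator _ _
  · exact evalVol_ofDeg_of_ne h _

theorem evalVol_comp_bTot (n : ℕ) : (evalVol n).comp bTot = 0 := by
  refine DirectSum.linearMap_ext ℂ fun k => LinearMap.ext fun φ => ?_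
  change evalVol n (bTot (ofDeg k φ)) = 0
  match k, φ with
  | 0, φ => rw [bTot, lowering_zero, map_zero]
  | k + 1, φ =>
    rw [bTot, lowering_succ]
    by_cases h : k = 2 * n
    · rw [evalVol_ofDeg h]
      exact Finset.sum_eq_zero fun σ _ => by rw [connesB_cons_one, mul_zero]
    · exact evalVol_ofDeg_of_ne h _

theorem evalVolW_tmul {W : Type*} [AddCommGroup W] [Module ℂ W] (n : ℕ)
    (φ : Cochains (Weyl n)) (w : W) :
    evalVolW n W (φ ⊗ₜ w) = evalVol n φ • w := by
  simp [evalVolW]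

section Coefficients

variable {W : Type*} [AddCommGroup W] [Module ℂ W] [Module (Polynomial ℂ) W]
  [IsScalarTower ℂ (Polynomial ℂ) W]

theorem evalVolW_cycD (n : ℕ) (ψ : Cyc (Weyl n) W) : evalVolW n W (cycD W ψ) = 0 := by
  have h : (evalVolW n W).comp (cycD W) = 0 := by
    refine TensorProduct.ext' fun φ w => ?_
    have h1 : evalVol n (dTot φ) = 0 := LinearMap.congr_fun (evalVol_comp_dTot n) φ
    have h2 : evalVol n (bTot φ) = 0 := LinearMap.congr_fun (evalVol_comp_bTot n) φ
    rw [LinearMap.comp_apply, cycD, LinearMap.add_apply, LinearMap.rTensor_tmul, uOp,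
      TensorProduct.map_tmul, map_add, evalVolW_tmul, evalVolW_tmul, h1, h2]
    simp
  exact LinearMap.congr_fun h ψ

theorem evalVolW_tauW (n : ℕ) (w : W) : evalVolW n W (tauW n w) = w := by
  rw [tauW_eq_sum, map_sum, Finset.sum_eq_single 0]
  · rw [map_smul, evalVolW_tmul, pow_zero, pow_zero, Module.End.one_apply, Module.End.one_apply,
      evalVol_tau]
    simp
  · intro j hj hj0
    rw [Finset.mem_range] at hj
    -- For `j > 0` the term has degree `2n - 2j`, which differs from that of the volume chain.
    obtain ⟨ψ, φ, h1, -⟩ := exists_rep_iotaOmega_pow n j (2 * n - 2 * j) (by omega)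
    rw [map_smul, evalVolW_tmul, h1, evalVol_ofDeg_of_ne (by omega), zero_smul, smul_zero]
  · intro h
    exact absurd (Finset.mem_range.2 n.succ_pos) h

end Coefficients

end WeylCyclic

end

theorem theorem1p2 (n : ℕ) {W : Type*} [AddCommGroup W] [Module ℂ W] [Module (Polynomial ℂ) W]
    [IsScalarTower ℂ (Polynomial ℂ) W] (w : W) (hw : w ≠ 0) :
    -- the cochain `τ_w` is a cyclic cocycle
    WeylCyclic.cycD W (WeylCyclic.tauW n w) = 0 ∧
    -- it is nontrivial, that is, not a coboundary
    (¬ ∃ ψ : WeylCyclic.Cyc (WeylCyclic.Weyl n) W,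
      WeylCyclic.cycD W ψ = WeylCyclic.tauW n w) ∧
    -- it is annihilated by `ι_a` for all `a` in `sp_{2n}`
    (∀ a ∈ WeylCyclic.sp n, (WeylCyclic.iota a).rTensor W (WeylCyclic.tauW n w) = 0) ∧
    -- its value on the chain `1 ⊗ p₁ ∧ q₁ ∧ ⋯ ∧ p_n ∧ q_n` is `w`
    WeylCyclic.evalVolW n W (WeylCyclic.tauW n w) = w := by
  refine ⟨WeylCyclic.cycD_tauW n w, ?_, fun a ha => WeylCyclic.iota_tauW n w ha,
    WeylCyclic.evalVolW_tauW n w⟩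
  rintro ⟨ψ, hψ⟩
  apply hw
  rw [← WeylCyclic.evalVolW_tauW n w, ← hψ, WeylCyclic.evalVolW_cycD]
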